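/- Let $p$ be a prime, $k$ a field of characteristic $p$, and $Z$ a smooth scheme over $k$ (for instance a smooth variety), with tangent sheaf $T_Z$ of $k$-linear vector fields. Let $Z' = Z\times_{k,\mathrm{Frob}}k$ be its Frobenius twist; $Z$ and $Z'$ have the same underlying topological space, and for a 1-form $\alpha$ or a vector field $x$ on $Z$ write $\alpha'$, $x'$ for the corresponding objects on $Z'$. A *restricted Lie algebroid* on $Z$ is a Lie algebroid $\tau\colon\mathcal A\to T_Z$, locally free of finite rank over $\mathcal O_Z$, with an operation $x\mapsto x^{[p]}$ that makes $\mathcal A$ a sheaf of restricted Lie algebras over $k$ and satisfies $\tau(x^{[p]})=\tau(x)^p$ and $(fx)^{[p]}=f^p x^{[p]}+\tau(fx)^{p-1}(f)\,x$ for local sections $f$ of $\mathcal O_Z$ and $x$ of $\mathcal A$. A *restricted Atiyah algebra* on $Z$ is a restricted Lie algebroid together with an exact sequence of $\mathcal O_Z$-modules $0\to\mathcal O_Z\to\mathcal A\xrightarrow{\tau}T_Z\to0$ such that $[x,f]=\tau(x)(f)$ and $f^{[p]}=f^p$ for local sections $f$ of $\mathcal O_Z$ and $x$ of $\mathcal A$.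 Isomorphisms of restricted Atiyah algebras are $\mathcal O_Z$-linear isomorphisms compatible with the bracket, the $p$-operation, $\tau$ and the inclusion of $\mathcal O_Z$. Let $C\colon\Omega^1_{Z,cl}\to\Omega^1_{Z'}$ be the Cartier operator on closed 1-forms: the unique $\mathcal O_{Z'}$-linear map (where $\mathcal O_{Z'}$ acts on the source through the relative Frobenius) with $C(df)=0$ and $C(f^{p-1}df)=df'$. Let $K$ be the complex of Zariski sheaves $$K=\bigl\{\,\Omega^1_{Z,cl}\xrightarrow{\ \alpha\,\mapsto\,\alpha'-C(\alpha)\ }\Omega^1_{Z'}\,\bigr\}$$ in degrees $0$ and $1$. Its hypercohomology $H^1(Z,K)$ is described by Čech 1-cocycles: a cocycle on an open cover $\{U_i\}$ is a pair $(\{\alpha_{ij}\},\{\gamma_i\})$ with $\alpha_{ij}\in\Omega^1_{Z,cl}(U_i\cap U_j)$, $\gamma_i\in\Omega^1_{Z'}(U_i)$, $\alpha_{ij}+\alpha_{jl}=\alpha_{il}$ and $\gamma_i-\gamma_j=\alpha_{ij}'-C(\alpha_{ij})$, and classes are taken modulo coboundaries $(b_i-b_j,\ b_i'-C(b_i))$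 and refinement of covers. Then the set of isomorphism classes of restricted Atiyah algebras on $Z$ is in bijection with $H^1(Z,K)$. More precisely, every restricted Atiyah algebra $\mathcal A$ admits an open cover $\{U_i\}$, splittings $\sigma_i\colon T_{U_i}\to\mathcal A|_{U_i}$ of $\tau$ that are $\mathcal O$-linear and respect the Lie brackets, and a Čech 1-cocycle $(\{\alpha_{ij}\},\{\gamma_i\})$ of $K$ with $$\alpha_{ij}=\sigma_i-\sigma_j,\qquad \gamma_i(x')^p=\sigma_i(x)^{[p]}-\sigma_i(x^p)$$ for local vector fields $x$ (here $\gamma_i(x')^p$ denotes the function on $Z$ obtained from $\gamma_i(x')\in\mathcal O_{Z'}$ by the relative Frobenius $Z\to Z'$). There is a bijection from isomorphism classes of restricted Atiyah algebras to $H^1(Z,K)$ that sends the class of each $\mathcal A$ to the class of any cocycle obtained from $\mathcal A$ in this way. -/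

import Mathlib

open CategoryTheory TopologicalSpace Opposite AlgebraicGeometry TensorProduct

universe u

noncomputable section

namespace RAtiyah

/-! ## Kähler differentials: functoriality and the exterior derivative -/

section Kaehler

variable {R S A B : Type u} [CommRing R] [CommRing S] [CommRing A] [CommRing B]
  [Algebra R A] [Algebra S B]

/-- Additive maps out of `Ω[A⁄R]` agree if they agree on all `a • db`. -/
theorem kaehler_addHom_ext {N : Type*} [AddCommMonoid N] {f g : Ω[A⁄R] →+ N}
    (h : ∀ a b : A, f (a • KaehlerDifferential.D R A b) = g (a • KaehlerDifferential.D R A b)) :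
    f = g := by
  ext x
  have hx : x ∈ Submodule.span A (Set.range (KaehlerDifferential.D R A)) := by
    rw [KaehlerDifferential.span_range_derivation]; trivial
  induction hx using Submodule.closure_induction with
  | zero => simp
  | add x y _ _ hx hy => rw [map_add, map_add, hx, hy]
  | smul_mem a x hx => obtain ⟨b, rfl⟩ := hx; exact h a b

/-- Pull-back of differentials `Ω[A⁄R] → Ω[B⁄S]`, `a db ↦ φ(a) dφ(b)`, along a ring homomorphism
`φ : A → B` that lies over a homomorphism `ψ : R → S` of the base rings. -/
def kaehlerMap (ψ : R →+* S) (φ : A →+* B)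
    (h : φ.comp (algebraMap R A) = (algebraMap S B).comp ψ) : Ω[A⁄R] →+ Ω[B⁄S] :=
  letI : Algebra R S := ψ.toAlgebra
  letI : Algebra A B := φ.toAlgebra
  letI : Algebra R B := ((algebraMap S B).comp ψ).toAlgebra
  haveI : IsScalarTower R A B := IsScalarTower.of_algebraMap_eq' h.symm
  haveI : IsScalarTower R S B := IsScalarTower.of_algebraMap_eq' rfl
  (KaehlerDifferential.map R S A B).toAddMonoidHom

theorem kaehlerMap_smul (ψ : R →+* S) (φ : A →+* B)
    (h : φ.comp (algebraMap R A) = (algebraMap S B).comp ψ) (a : A) (x : Ω[A⁄R]) :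
    kaehlerMap ψ φ h (a • x) = φ a • kaehlerMap ψ φ h x := by
  let _ : Algebra R S := ψ.toAlgebra
  let _ : Algebra A B := φ.toAlgebra
  let _ : Algebra R B := ((algebraMap S B).comp ψ).toAlgebra
  have _ : IsScalarTower R A B := IsScalarTower.of_algebraMap_eq' h.symm
  have _ : IsScalarTower R S B := IsScalarTower.of_algebraMap_eq' rfl
  exact (KaehlerDifferential.map R S A B).map_smul a x

theorem kaehlerMap_D (ψ : R →+* S) (φ : A →+* B)
    (h : φ.comp (algebraMap R A) = (algebraMap S B).comp ψ) (a : A) :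
    kaehlerMap ψ φ h (KaehlerDifferential.D R A a) = KaehlerDifferential.D S B (φ a) := by
  let _ : Algebra R S := ψ.toAlgebra
  let _ : Algebra A B := φ.toAlgebra
  let _ : Algebra R B := ((algebraMap S B).comp ψ).toAlgebra
  have _ : IsScalarTower R A B := IsScalarTower.of_algebraMap_eq' h.symm
  have _ : IsScalarTower R S B := IsScalarTower.of_algebraMap_eq' rfl
  exact KaehlerDifferential.map_D R S A B a

variable (R A)

/-- The product of `Ω[A⁄R]` and its exterior algebra, with the twisted `A`-module structure
`a • (ω, η) = (a ω, a η + da ∧ ω)`. It serves to construct the exterior derivative. -/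
def JetModule : Type u := Ω[A⁄R] × ExteriorAlgebra A Ω[A⁄R]

instance : AddCommGroup (JetModule R A) :=
  inferInstanceAs (AddCommGroup (Ω[A⁄R] × ExteriorAlgebra A Ω[A⁄R]))

variable {R A}

/-- The product `da ∧ ω` in the exterior algebra of `Ω[A⁄R]`. -/
def dWedge (a : A) (ω : Ω[A⁄R]) : ExteriorAlgebra A Ω[A⁄R] :=
  ExteriorAlgebra.ι A (KaehlerDifferential.D R A a) * ExteriorAlgebra.ι A ω

theorem dWedge_swap (a b : A) :
    dWedge (R := R) a (KaehlerDifferential.D R A b) +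
      dWedge b (KaehlerDifferential.D R A a) = 0 :=
  ExteriorAlgebra.ι_add_mul_swap _ _

instance : Module A (JetModule R A) where
  smul a x := (a • x.1, a • x.2 + dWedge a x.1)
  one_smul x := by
    refine Prod.ext (one_smul A x.1) ?_
    change (1 : A) • x.2 + dWedge 1 x.1 = x.2
    simp [dWedge]
  mul_smul a b x := by
    refine Prod.ext (mul_smul a b x.1) ?_
    change (a * b) • x.2 + dWedge (a * b) x.1
      = a • (b • x.2 + dWedge b x.1) + dWedge a (b • x.1)
    simp only [dWedge, Derivation.leibniz, map_add, map_smul, add_mul, smul_mul_assoc,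
      mul_smul_comm, smul_add, mul_smul]
    abel
  smul_zero a := by
    refine Prod.ext (smul_zero a) ?_
    change a • (0 : ExteriorAlgebra A Ω[A⁄R]) + dWedge a 0 = 0
    simp [dWedge]
  smul_add a x y := by
    refine Prod.ext (smul_add a x.1 y.1) ?_
    change a • (x.2 + y.2) + dWedge a (x.1 + y.1)
      = a • x.2 + dWedge a x.1 + (a • y.2 + dWedge a y.1)
    simp only [dWedge, smul_add, map_add, mul_add]
    abel
  add_smul a b x := by
    refine Prod.ext (add_smul a b x.1) ?_
    change (a + b) • x.2 + dWedge (a + b) x.1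
      = a • x.2 + dWedge a x.1 + (b • x.2 + dWedge b x.1)
    simp only [dWedge, add_smul, map_add, add_mul]
    abel
  zero_smul x := by
    refine Prod.ext (zero_smul A x.1) ?_
    change (0 : A) • x.2 + dWedge 0 x.1 = 0
    simp [dWedge]

instance : Module R (JetModule R A) := Module.compHom _ (algebraMap R A)

instance : IsScalarTower R A (JetModule R A) where
  smul_assoc r a x := by
    change (r • a) • x = algebraMap R A r • (a • x)
    rw [Algebra.smul_def, mul_smul]

variable (R A)

/-- The derivation `a ↦ (da, 0)`. -/
def jetDerivation : Derivation R A (JetModule R A) where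
  toFun a := (KaehlerDifferential.D R A a, 0)
  map_add' a b := by
    refine Prod.ext (map_add _ a b) ?_
    change (0 : ExteriorAlgebra A Ω[A⁄R]) = 0 + 0
    simp
  map_smul' r a := by
    refine Prod.ext ?_ ?_
    · change KaehlerDifferential.D R A (r • a) = algebraMap R A r • KaehlerDifferential.D R A a
      rw [Derivation.map_smul, algebraMap_smul]
    · change (0 : ExteriorAlgebra A Ω[A⁄R])
        = algebraMap R A r • 0 + dWedge (algebraMap R A r) (KaehlerDifferential.D R A a)
      simp [dWedge]
  map_one_eq_zero' := by
    refine Prod.ext ?_ rfl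
    exact Derivation.map_one_eq_zero _
  leibniz' a b := by
    refine Prod.ext (Derivation.leibniz _ a b) ?_
    change (0 : ExteriorAlgebra A Ω[A⁄R])
      = (a • 0 + dWedge a (KaehlerDifferential.D R A b))
        + (b • 0 + dWedge b (KaehlerDifferential.D R A a))
    rw [smul_zero, smul_zero, zero_add, zero_add, dWedge_swap]

/-- The exterior derivative on `1`-forms, `d (a db) = da ∧ db`, with values in the exterior
algebra of `Ω[A⁄R]` (which contains the `2`-forms as its part of degree `2`). -/
def extDeriv : Ω[A⁄R] →+ ExteriorAlgebra A Ω[A⁄R] :=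
  (AddMonoidHom.snd Ω[A⁄R] (ExteriorAlgebra A Ω[A⁄R])).comp
    (jetDerivation R A).liftKaehlerDifferential.toAddMonoidHom

theorem extDeriv_smul_D (a b : A) :
    extDeriv R A (a • KaehlerDifferential.D R A b)
      = ExteriorAlgebra.ι A (KaehlerDifferential.D R A a)
        * ExteriorAlgebra.ι A (KaehlerDifferential.D R A b) := by
  change ((jetDerivation R A).liftKaehlerDifferential (a • KaehlerDifferential.D R A b)).2 = _
  rw [map_smul, Derivation.liftKaehlerDifferential_comp_D]
  change a • (0 : ExteriorAlgebra A Ω[A⁄R]) + dWedge a (KaehlerDifferential.D R A b) = _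
  rw [smul_zero, zero_add, dWedge]

/-- The closed `1`-forms of the `R`-algebra `A`. -/
def closedForms : AddSubgroup Ω[A⁄R] := (extDeriv R A).ker

variable {R A} {B : Type u} [CommRing B] [Algebra R B]

/-- Pull-back of `1`-forms along a homomorphism of `R`-algebras. -/
def kaehlerMapAlg (φ : A →ₐ[R] B) : Ω[A⁄R] →+ Ω[B⁄R] :=
  kaehlerMap (RingHom.id R) φ.toRingHom (by ext r; simp)

theorem kaehlerMapAlg_smul_D (φ : A →ₐ[R] B) (a b : A) :
    kaehlerMapAlg φ (a • KaehlerDifferential.D R A b) = φ a • KaehlerDifferential.D R B (φ b) := by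
  rw [kaehlerMapAlg, kaehlerMap_smul, kaehlerMap_D]; rfl

theorem kaehlerMapAlg_id : kaehlerMapAlg (AlgHom.id R A) = AddMonoidHom.id _ :=
  kaehler_addHom_ext fun a b => by rw [kaehlerMapAlg_smul_D]; rfl

theorem kaehlerMapAlg_comp {C : Type u} [CommRing C] [Algebra R C] (χ : B →ₐ[R] C)
    (φ : A →ₐ[R] B) : kaehlerMapAlg (χ.comp φ) = (kaehlerMapAlg χ).comp (kaehlerMapAlg φ) :=
  kaehler_addHom_ext fun a b => by
    rw [AddMonoidHom.comp_apply, kaehlerMapAlg_smul_D, kaehlerMapAlg_smul_D,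
      kaehlerMapAlg_smul_D]; rfl

theorem closedForms_map (φ : A →ₐ[R] B) {x : Ω[A⁄R]} (hx : x ∈ closedForms R A) :
    kaehlerMapAlg φ x ∈ closedForms R B := by
  let _ : Algebra A B := φ.toRingHom.toAlgebra
  have _ : IsScalarTower R A B := IsScalarTower.of_algebraMap_eq' (by
    ext r; exact (φ.commutes r).symm)
  let m : Ω[A⁄R] →ₗ[A] Ω[B⁄R] := KaehlerDifferential.map R R A B
  let e : ExteriorAlgebra A Ω[A⁄R] →ₐ[A] ExteriorAlgebra B Ω[B⁄R] :=
    ExteriorAlgebra.lift A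
      ⟨((ExteriorAlgebra.ι B).restrictScalars A).comp m, fun y => by
        exact ExteriorAlgebra.ι_sq_zero _⟩
  have key : (extDeriv R B).comp (kaehlerMapAlg φ)
      = e.toRingHom.toAddMonoidHom.comp (extDeriv R A) := by
    refine kaehler_addHom_ext fun a b => ?_
    have h1 : ∀ c : A, e (ExteriorAlgebra.ι A (KaehlerDifferential.D R A c))
        = ExteriorAlgebra.ι B (KaehlerDifferential.D R B (φ c)) := by
      intro c
      refine (ExteriorAlgebra.lift_ι_apply A _ _ _).trans ?_
      change ExteriorAlgebra.ι B (KaehlerDifferential.map R R A B _) = _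
      rw [KaehlerDifferential.map_D]; rfl
    rw [AddMonoidHom.comp_apply, AddMonoidHom.comp_apply, kaehlerMapAlg_smul_D, extDeriv_smul_D,
      extDeriv_smul_D]
    have h2 : ∀ y z, e.toRingHom.toAddMonoidHom (y * z) = e y * e z := fun y z => map_mul e y z
    rw [h2, h1, h1]
  have := DFunLike.congr_fun key x
  change extDeriv R B (kaehlerMapAlg φ x) = 0
  change extDeriv R B (kaehlerMapAlg φ x) = e (extDeriv R A x) at this
  rw [this, show extDeriv R A x = 0 from hx, map_zero]

end Kaehler

/-! ## The Frobenius twist -/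

section Frobenius

variable (p : ℕ) [Fact p.Prime] (k : Type u) [Field k] [CharP k p]

/-- A copy of the `k`-algebra `A` on which `c ∈ k` acts as multiplication by `c ^ p`.
In particular `Frob p k k` is `k` regarded as a `k`-algebra through its Frobenius. -/
def Frob (_p : ℕ) (k : Type u) [Field k] (A : Type u) [CommRing A] [Algebra k A] : Type u := A

variable (A : Type u) [CommRing A] [Algebra k A]

instance : CommRing (Frob p k A) := inferInstanceAs (CommRing A)

instance : Algebra k (Frob p k A) :=
  ((algebraMap k A).comp (frobenius k p)).toAlgebra

instance : Algebra (Frob p k k) (Frob p k A) := (algebraMap k A).toAlgebra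

instance : IsScalarTower k (Frob p k k) (Frob p k A) := IsScalarTower.of_algebraMap_eq' rfl

/-- The Frobenius twist `A' = k ⊗_{Frob, k} A` of a `k`-algebra `A`, as a `k`-algebra through the
left factor. For affine `Z = Spec A`, the Frobenius twist `Z'` is `Spec A'`. -/
abbrev Twist : Type u := Frob p k k ⊗[k] A

/-- The `p`-th power map of a `k`-algebra, as a `k`-linear homomorphism to `Frob p k A`. -/
def powFrob : A →ₐ[k] Frob p k A where
  toFun a := (a ^ p : A)
  map_one' := one_pow (M := A) p
  map_mul' a b := mul_pow (M := A) a b p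
  map_zero' := zero_pow (M₀ := A) (Fact.out : p.Prime).ne_zero
  map_add' a b := by
    have hp : (p : A) = 0 := by
      rw [← map_natCast (algebraMap k A), CharP.cast_eq_zero, map_zero]
    obtain ⟨r, hr⟩ := (Commute.all a b).exists_add_pow_prime_eq (Fact.out : p.Prime)
    change (a + b) ^ p = a ^ p + b ^ p
    rw [hr, hp]; ring
  commutes' c := by
    change (algebraMap k A c) ^ p = algebraMap k A (frobenius k p c)
    rw [frobenius_def, map_pow]

/-- The identity, from `Frob p k A` to `A`. -/
def unFrob : Frob p k A →+* A := RingHom.id A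

/-- The relative Frobenius `A' → A`, `c ⊗ a ↦ c a ^ p`. -/
def relFrob : Twist p k A →+* A :=
  (unFrob p k A).comp (Algebra.TensorProduct.lift (Algebra.ofId (Frob p k k) (Frob p k A))
    (powFrob p k A) fun _ _ => Commute.all _ _).toRingHom

theorem relFrob_tmul (c : k) (a : A) :
    relFrob p k A ((show Frob p k k from c) ⊗ₜ[k] a) = algebraMap k A c * a ^ p :=
  Algebra.TensorProduct.lift_tmul (Algebra.ofId (Frob p k k) (Frob p k A)) (powFrob p k A)
    (fun _ _ => Commute.all _ _) _ _

/-- The `1`-forms on the Frobenius twist. -/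
abbrev TwistForms : Type u := Ω[Twist p k A⁄Frob p k k]

/-- `α ↦ α'`: the pull-back of a `1`-form along the projection `Z' → Z`,
`a db ↦ (1 ⊗ a) d(1 ⊗ b)`. -/
def twistForm : Ω[A⁄k] →+ TwistForms p k A :=
  kaehlerMap (algebraMap k (Frob p k k))
    (Algebra.TensorProduct.includeRight : A →ₐ[k] Twist p k A).toRingHom (by
      ext c
      exact ((Algebra.TensorProduct.includeRight : A →ₐ[k] Twist p k A).commutes c).trans
        (IsScalarTower.algebraMap_apply k (Frob p k k) (Twist p k A) c))

theorem twistForm_smul_D (a b : A) :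
    twistForm p k A (a • KaehlerDifferential.D k A b)
      = (1 ⊗ₜ[k] a : Twist p k A) •
        KaehlerDifferential.D (Frob p k k) (Twist p k A) (1 ⊗ₜ[k] b) := by
  rw [twistForm, kaehlerMap_smul, kaehlerMap_D]; rfl

variable {A} {B : Type u} [CommRing B] [Algebra k B]

/-- The homomorphism `A' → B'` induced by `A → B`. -/
def twistMap (φ : A →ₐ[k] B) : Twist p k A →ₐ[Frob p k k] Twist p k B :=
  Algebra.TensorProduct.map (AlgHom.id (Frob p k k) (Frob p k k)) φ

theorem twistMap_id : twistMap p k (AlgHom.id k A) = AlgHom.id _ _ :=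
  Algebra.TensorProduct.map_id

theorem twistMap_comp {C : Type u} [CommRing C] [Algebra k C] (χ : B →ₐ[k] C) (φ : A →ₐ[k] B) :
    twistMap p k (χ.comp φ) = (twistMap p k χ).comp (twistMap p k φ) :=
  Algebra.TensorProduct.ext (by ext) (by ext a; rfl)

theorem twistForm_map (φ : A →ₐ[k] B) :
    (twistForm p k B).comp (kaehlerMapAlg φ)
      = (kaehlerMapAlg (twistMap p k φ)).comp (twistForm p k A) :=
  kaehler_addHom_ext fun a b => by
    rw [AddMonoidHom.comp_apply, AddMonoidHom.comp_apply, kaehlerMapAlg_smul_D, twistForm_smul_D,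
      twistForm_smul_D, kaehlerMapAlg_smul_D]
    rfl

variable {k}

/-- The vector field `x'` on the Frobenius twist given by a vector field `x`:
`x' (c ⊗ a) = c ⊗ x a`. -/
def twistDerivation (x : Derivation k A A) :
    Derivation (Frob p k k) (Twist p k A) (Twist p k A) :=
  Derivation.mk' (x.toLinearMap.baseChange (Frob p k k)) fun s t => by
    induction s using TensorProduct.induction_on with
    | zero => simp
    | add s₁ s₂ h₁ h₂ => rw [add_mul, map_add, h₁, h₂, map_add, smul_add, add_smul]; abel
    | tmul c a =>
      induction t using TensorProduct.induction_on with
      | zero => simp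
      | add t₁ t₂ h₁ h₂ => rw [mul_add, map_add, h₁, h₂, map_add, smul_add, add_smul]; abel
      | tmul d b =>
        simp [LinearMap.baseChange_tmul, TensorProduct.tmul_add, mul_comm]

/-- For a vector field `x` on `Z` and a `1`-form `γ` on `Z'`, the function `γ(x')` on `Z'`,
regarded as a function on `Z` through the relative Frobenius. For `γ = (c ⊗ a) d(1 ⊗ b)` it
is `c a ^ p x(b) ^ p`. -/
def twistPairing (x : Derivation k A A) (γ : TwistForms p k A) : A :=
  relFrob p k A ((twistDerivation p x).liftKaehlerDifferential γ)

/-- The `p`-th power of a derivation of a `k`-algebra is a derivation. -/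
def powDerivation (x : Derivation k A A) : Derivation k A A :=
  Derivation.mk' ((x.toLinearMap : Module.End k A) ^ p) fun a b => by
    let r : Module.End k (A ⊗[k] A) := x.toLinearMap.rTensor A
    let l : Module.End k (A ⊗[k] A) := x.toLinearMap.lTensor A
    have hc : Commute r l := by
      refine TensorProduct.ext' fun a b => ?_
      simp [r, l]
    have hp : (p : Module.End k (A ⊗[k] A)) = 0 := by
      rw [← map_natCast (algebraMap k (Module.End k (A ⊗[k] A))), CharP.cast_eq_zero, map_zero]
    have hpow : (r + l) ^ p = r ^ p + l ^ p := by
      obtain ⟨q, hq⟩ := hc.exists_add_pow_prime_eq (Fact.out : p.Prime)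
      rw [hq, hp]; simp
    have hμ : ∀ n : ℕ, (LinearMap.mul' k A).comp ((r + l) ^ n)
        = ((x.toLinearMap : Module.End k A) ^ n).comp (LinearMap.mul' k A) := by
      intro n
      induction n with
      | zero => rfl
      | succ n ih =>
        rw [pow_succ', pow_succ', Module.End.mul_eq_comp, Module.End.mul_eq_comp,
          LinearMap.comp_assoc, ← ih, ← LinearMap.comp_assoc, ← LinearMap.comp_assoc]
        congr 1
        refine TensorProduct.ext' fun a b => ?_
        simp [r, l, mul_comm, add_comm]
    have h := LinearMap.congr_fun (hμ p) (a ⊗ₜ b)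
    rw [hpow, LinearMap.rTensor_pow, LinearMap.lTensor_pow] at h
    simp only [LinearMap.comp_apply, LinearMap.add_apply, LinearMap.rTensor_tmul,
      LinearMap.lTensor_tmul, map_add, LinearMap.mul'_apply] at h
    rw [← h]
    simp only [smul_eq_mul]
    ring

theorem powDerivation_apply (x : Derivation k A A) (a : A) :
    powDerivation p x a = x^[p] a := by
  change ((x.toLinearMap : Module.End k A) ^ p) a = _
  rw [Module.End.pow_apply]; rfl

end Frobenius

/-! ## Presheaves of forms and the Cartier operator -/

section Forms

variable (p : ℕ) [Fact p.Prime] (k : Type u) [Field k] [CharP k p]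

/-- Closed `1`-forms, as a functor on `k`-algebras. -/
def closedFunctor : CommAlgCat.{u} k ⥤ AddCommGrpCat.{u} where
  obj A := .of (closedForms k A)
  map φ := AddCommGrpCat.ofHom
    (((kaehlerMapAlg φ.hom).comp (closedForms k _).subtype).codRestrict (closedForms k _)
      fun x => closedForms_map φ.hom x.2)
  map_id A := by
    ext x
    exact DFunLike.congr_fun (kaehlerMapAlg_id (R := k) (A := A)) x.1
  map_comp φ χ := by
    ext x
    exact DFunLike.congr_fun (kaehlerMapAlg_comp χ.hom φ.hom) x.1

/-- The `1`-forms on the Frobenius twist, as a functor on `k`-algebras. -/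
def twistFunctor : CommAlgCat.{u} k ⥤ AddCommGrpCat.{u} where
  obj A := .of (TwistForms p k A)
  map φ := AddCommGrpCat.ofHom (kaehlerMapAlg (twistMap p k φ.hom))
  map_id A := by
    ext x
    have := DFunLike.congr_fun (kaehlerMapAlg_id (R := Frob p k k) (A := Twist p k A)) x
    rw [← twistMap_id] at this
    exact this
  map_comp φ χ := by
    ext x
    have := DFunLike.congr_fun
      (kaehlerMapAlg_comp (twistMap p k χ.hom) (twistMap p k φ.hom)) x
    rw [← twistMap_comp] at this
    exact this

/-- `α ↦ α'` as a natural transformation from closed `1`-forms to `1`-forms on the twist. -/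
def twistTrans : closedFunctor k ⟶ twistFunctor p k where
  app A := AddCommGrpCat.ofHom ((twistForm p k A).comp (closedForms k A).subtype)
  naturality A B φ := by
    ext x
    exact DFunLike.congr_fun (twistForm_map p k φ.hom) x.1

variable (Z : Scheme.{u}) [Z.Over (Spec (.of k))]

/-- The `k`-algebra structure on the functions on an open subset of a `k`-scheme. -/
instance sectionsAlgebra (U : Z.Opens) : Algebra k Γ(Z, U) :=
  ((Scheme.ΓSpecIso (.of k)).inv ≫ (Z ↘ Spec (.of k)).appTop ≫
    Z.presheaf.map (homOfLE le_top).op).hom.toAlgebra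

variable {Z}

/-- Restriction of functions. -/
def res {U V : Z.Opens} (h : V ≤ U) : Γ(Z, U) →ₐ[k] Γ(Z, V) where
  __ := (Z.presheaf.map (homOfLE h).op).hom
  commutes' c := by
    change ((Scheme.ΓSpecIso (.of k)).inv ≫ (Z ↘ Spec (.of k)).appTop ≫
      Z.presheaf.map (homOfLE le_top).op ≫ Z.presheaf.map (homOfLE h).op).hom c = _
    rw [← Z.presheaf.map_comp]
    rfl

theorem res_apply {U V : Z.Opens} (h : V ≤ U) (f : Γ(Z, U)) :
    res k h f = Z.presheaf.map (homOfLE h).op f := rfl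

theorem res_refl {U : Z.Opens} (f : Γ(Z, U)) : res k (le_refl U) f = f := by
  rw [res_apply, show (homOfLE (le_refl U)).op = 𝟙 (op U) from rfl, Z.presheaf.map_id]; rfl

theorem res_res {U V W : Z.Opens} (h : V ≤ U) (h' : W ≤ V) (f : Γ(Z, U)) :
    res k h' (res k h f) = res k (h'.trans h) f := by
  simp only [res_apply]
  rw [← CommRingCat.comp_apply, ← Z.presheaf.map_comp]
  rfl

variable (Z)

/-- The structure sheaf on the affine open subsets of `Z`. -/
def affineSections : (Z.affineOpens)ᵒᵖ ⥤ CommAlgCat.{u} k where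
  obj V := .of k Γ(Z, V.unop.1)
  map i := CommAlgCat.ofHom (res k i.unop.le)
  map_id V := by
    ext f
    exact res_refl k f
  map_comp i j := by
    ext f
    exact (res_res k i.unop.le j.unop.le f).symm

/-- A morphism `C` from closed `1`-forms on `Z` to `1`-forms on `Z'` (on affine open subsets) is a
Cartier operator if it is linear over the functions on `Z'` (acting on forms on `Z` through the
relative Frobenius), kills exact forms, and sends `f ^ (p - 1) df` to `df'`. -/
structure IsCartierOperator
    (C : affineSections k Z ⋙ closedFunctor k ⟶ affineSections k Z ⋙ twistFunctor p k) :
    Prop where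
  map_smul (V : Z.affineOpens) (a : Twist p k Γ(Z, V)) (α β : closedForms k Γ(Z, V))
    (h : β.1 = relFrob p k Γ(Z, V) a • α.1) :
    (C.app (op V)).hom β = a • (show TwistForms p k Γ(Z, V) from (C.app (op V)).hom α)
  map_exact (V : Z.affineOpens) (f : Γ(Z, V)) (α : closedForms k Γ(Z, V))
    (h : α.1 = KaehlerDifferential.D k Γ(Z, V) f) : (C.app (op V)).hom α = 0
  map_pow_mul_D (V : Z.affineOpens) (f : Γ(Z, V)) (α : closedForms k Γ(Z, V))
    (h : α.1 = f ^ (p - 1) • KaehlerDifferential.D k Γ(Z, V) f) :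
    (C.app (op V)).hom α
      = KaehlerDifferential.D (Frob p k k) (Twist p k Γ(Z, V)) (1 ⊗ₜ[k] f)

open Classical in
/-- The Cartier operator: the morphism from closed `1`-forms on `Z` to `1`-forms on `Z'`
characterized by `IsCartierOperator` (with junk value `0` should there be none; on smooth `k`-schemes
it exists and is unique). -/
def cartierOperator :
    affineSections k Z ⋙ closedFunctor k ⟶ affineSections k Z ⋙ twistFunctor p k :=
  if h : ∃ C, IsCartierOperator p k Z C then h.choose else 0

/-- The sections over `U` of the extension to all open subsets of a presheaf `P` on the affine open
subsets: compatible families of sections over the affine open subsets of `U`. -/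
def extSections (P : (Z.affineOpens)ᵒᵖ ⥤ AddCommGrpCat.{u}) (U : Z.Opens) :
    AddSubgroup (∀ V : {V : Z.affineOpens // V.1 ≤ U}, P.obj (op V.1)) where
  carrier := {s | ∀ (V W : {V : Z.affineOpens // V.1 ≤ U}) (h : W.1 ≤ V.1),
    P.map (homOfLE h).op (s V) = s W}
  zero_mem' V W h := map_zero (P.map (homOfLE h).op).hom
  add_mem' {s t} hs ht V W h := by
    refine (map_add (P.map (homOfLE h).op).hom (s V) (t V)).trans ?_
    exact congrArg₂ (· + ·) (hs V W h) (ht V W h)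
  neg_mem' {s} hs V W h := by
    refine (map_neg (P.map (homOfLE h).op).hom (s V)).trans ?_
    exact congrArg (- ·) (hs V W h)

variable {Z} in
/-- The extension of a presheaf on affine open subsets to all open subsets. For a presheaf which
satisfies the sheaf condition on affine open subsets, this is the associated sheaf on `Z`. -/
def extendAffine (P : (Z.affineOpens)ᵒᵖ ⥤ AddCommGrpCat.{u}) :
    (Opens Z)ᵒᵖ ⥤ AddCommGrpCat.{u} where
  obj U := .of (extSections Z P U.unop)
  map {U U'} i := AddCommGrpCat.ofHom
    { toFun s := ⟨fun V => s.1 ⟨V.1, V.2.trans i.unop.le⟩, fun V W h =>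
        s.2 ⟨V.1, V.2.trans i.unop.le⟩ ⟨W.1, W.2.trans i.unop.le⟩ h⟩
      map_zero' := rfl
      map_add' _ _ := rfl }

variable {Z} in
/-- Functoriality of `extendAffine`. -/
def extendAffineMap {P Q : (Z.affineOpens)ᵒᵖ ⥤ AddCommGrpCat.{u}} (φ : P ⟶ Q) :
    extendAffine P ⟶ extendAffine Q where
  app U := AddCommGrpCat.ofHom
    (show extSections Z P U.unop →+ extSections Z Q U.unop from
      { toFun s := ⟨fun V => (φ.app (op V.1)).hom (s.1 V), fun V W h => by
          refine Eq.trans ?_ (congrArg (φ.app (op W.1)).hom (s.2 V W h))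
          exact (NatTrans.naturality_apply φ (homOfLE h).op (s.1 V)).symm⟩
        map_zero' := Subtype.ext (funext fun V => map_zero (φ.app (op V.1)).hom)
        map_add' s t := Subtype.ext (funext fun V => map_add (φ.app (op V.1)).hom _ _) })
  naturality _ _ _ := rfl

/-- The sheaf `Ω¹_{Z,cl}` of closed `1`-forms on `Z`. -/
abbrev closedSheaf : (Opens Z)ᵒᵖ ⥤ AddCommGrpCat.{u} :=
  extendAffine (affineSections k Z ⋙ closedFunctor k)

/-- The sheaf `Ω¹_{Z'}` of `1`-forms on the Frobenius twist `Z'`, regarded as a sheaf on `Z`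
through the homeomorphism `Z ≅ Z'`. -/
abbrev twistSheaf : (Opens Z)ᵒᵖ ⥤ AddCommGrpCat.{u} :=
  extendAffine (affineSections k Z ⋙ twistFunctor p k)

/-- The differential `α ↦ α' - C(α)` of the complex `Ω¹_{Z,cl} → Ω¹_{Z'}`. -/
def atiyahComplex : closedSheaf k Z ⟶ twistSheaf p k Z :=
  extendAffineMap (Functor.whiskerLeft (affineSections k Z) (twistTrans p k)
    - cartierOperator p k Z)

end Forms

/-! ## The first hypercohomology of a two-term complex -/

section Cech

variable {X : Type u} [TopologicalSpace X]

/-- Restriction of sections of a presheaf of abelian groups. -/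
def rst (F : (Opens X)ᵒᵖ ⥤ AddCommGrpCat.{u}) {U V : Opens X} (h : V ≤ U) :
    F.obj (op U) →+ F.obj (op V) := (F.map (homOfLE h).op).hom

theorem rst_rst (F : (Opens X)ᵒᵖ ⥤ AddCommGrpCat.{u}) {U V W : Opens X} (h : V ≤ U) (h' : W ≤ V)
    (s : F.obj (op U)) : rst F h' (rst F h s) = rst F (h'.trans h) s := by
  simp only [rst]
  rw [← AddCommGrpCat.comp_apply, ← F.map_comp]
  rfl

variable {F G : (Opens X)ᵒᵖ ⥤ AddCommGrpCat.{u}} (d : F ⟶ G)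

theorem rst_map {U V : Opens X} (h : V ≤ U) (s : F.obj (op U)) :
    rst G h ((d.app (op U)).hom s) = (d.app (op V)).hom (rst F h s) :=
  (NatTrans.naturality_apply d (homOfLE h).op s).symm

/-- A Čech `1`-cocycle of the complex `d : F → G` (with `F` in degree `0` and `G` in degree `1`): an
open cover `U i`, sections `α i j` of `F` over `U i ⊓ U j` and sections `γ i` of `G` over `U i` with
`α i j + α j l = α i l` and `γ i - γ j = d (α i j)`. -/
structure Cocycle where
  /-- The index set of the cover. -/
  ι : Type u
  /-- The members of the cover. -/
  U : ι → Opens X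
  cover : ∀ x : X, ∃ i, x ∈ U i
  /-- The part of the cocycle in `F`. -/
  α : ∀ i j, F.obj (op (U i ⊓ U j))
  /-- The part of the cocycle in `G`. -/
  γ : ∀ i, G.obj (op (U i))
  add_eq : ∀ (i j l : ι) (W : Opens X) (hi : W ≤ U i) (hj : W ≤ U j) (hl : W ≤ U l),
    rst F (le_inf hi hj) (α i j) + rst F (le_inf hj hl) (α j l) = rst F (le_inf hi hl) (α i l)
  sub_eq : ∀ i j, rst G inf_le_left (γ i) - rst G inf_le_right (γ j)
    = (d.app (op (U i ⊓ U j))).hom (α i j)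

variable {d}

/-- Two Čech `1`-cocycles are cohomologous if on a common refinement `W` of their covers they differ
by the coboundary `(b m - b n, d (b m))` of a `0`-cochain `b` of `F`. -/
def Cohomologous (c c' : Cocycle d) : Prop :=
  ∃ (κ : Type u) (W : κ → Opens X) (_ : ∀ x : X, ∃ m, x ∈ W m)
    (r : κ → c.ι) (r' : κ → c'.ι) (h : ∀ m, W m ≤ c.U (r m)) (h' : ∀ m, W m ≤ c'.U (r' m))
    (b : ∀ m, F.obj (op (W m))),
    (∀ m n, rst F (inf_le_inf (h m) (h n)) (c.α (r m) (r n))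
        - rst F (inf_le_inf (h' m) (h' n)) (c'.α (r' m) (r' n))
      = rst F inf_le_left (b m) - rst F inf_le_right (b n)) ∧
    ∀ m, rst G (h m) (c.γ (r m)) - rst G (h' m) (c'.γ (r' m)) = (d.app (op (W m))).hom (b m)

theorem Cocycle.rst_add (c : Cocycle d) (i j l : c.ι) {W : Opens X} (hi : W ≤ c.U i)
    (hj : W ≤ c.U j) (hl : W ≤ c.U l) :
    rst F (le_inf hi hj) (c.α i j) + rst F (le_inf hj hl) (c.α j l)
      = rst F (le_inf hi hl) (c.α i l) := c.add_eq i j l W hi hj hl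

theorem cohomologous_equivalence : Equivalence (Cohomologous (d := d)) where
  refl c := by
    refine ⟨c.ι, c.U, c.cover, id, id, fun _ => le_rfl, fun _ => le_rfl, fun _ => 0, ?_, ?_⟩
    · intro m n; simp
    · intro m; simp
  symm := by
    rintro c c' ⟨κ, W, hW, r, r', h, h', b, h1, h2⟩
    refine ⟨κ, W, hW, r', r, h', h, fun m => -b m, ?_, ?_⟩
    · intro m n
      rw [← neg_sub, h1, map_neg, map_neg]; abel
    · intro m
      rw [← neg_sub, h2, map_neg]
  trans := by
    rintro c c' c'' ⟨κ, W, hW, r, r', h, h', b, h1, h2⟩ ⟨κ', W', hW', s, s', g, g', b', h3, h4⟩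
    refine ⟨κ × κ', fun m => W m.1 ⊓ W' m.2, ?_, fun m => r m.1, fun m => s' m.2,
      fun m => inf_le_left.trans (h m.1), fun m => inf_le_right.trans (g' m.2),
      fun m => rst F inf_le_left (b m.1) + rst F inf_le_right (b' m.2)
        + rst F (le_inf (inf_le_left.trans (h' m.1)) (inf_le_right.trans (g m.2)))
            (c'.α (r' m.1) (s m.2)), ?_, ?_⟩
    · intro x
      obtain ⟨m, hm⟩ := hW x
      obtain ⟨n, hn⟩ := hW' x
      exact ⟨(m, n), hm, hn⟩
    · rintro ⟨m, m'⟩ ⟨n, n'⟩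
      have e1 := congrArg (rst F (show (W m ⊓ W' m') ⊓ (W n ⊓ W' n') ≤ W m ⊓ W n from
        inf_le_inf inf_le_left inf_le_left)) (h1 m n)
      have e3 := congrArg (rst F (show (W m ⊓ W' m') ⊓ (W n ⊓ W' n') ≤ W' m' ⊓ W' n' from
        inf_le_inf inf_le_right inf_le_right)) (h3 m' n')
      have hm : (W m ⊓ W' m') ⊓ (W n ⊓ W' n') ≤ c'.U (r' m) :=
        (inf_le_left.trans inf_le_left).trans (h' m)
      have hn : (W m ⊓ W' m') ⊓ (W n ⊓ W' n') ≤ c'.U (r' n) :=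
        (inf_le_right.trans inf_le_left).trans (h' n)
      have hm' : (W m ⊓ W' m') ⊓ (W n ⊓ W' n') ≤ c'.U (s m') :=
        (inf_le_left.trans inf_le_right).trans (g m')
      have hn' : (W m ⊓ W' m') ⊓ (W n ⊓ W' n') ≤ c'.U (s n') :=
        (inf_le_right.trans inf_le_right).trans (g n')
      have a1 := c'.rst_add (r' m) (r' n) (s n') hm hn hn'
      have a2 := c'.rst_add (r' m) (s m') (s n') hm hm' hn'
      simp only [map_sub, map_add, rst_rst] at e1 e3 ⊢
      rw [sub_eq_iff_eq_add] at e1 e3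
      rw [e1, ← sub_eq_zero]
      rw [← sub_eq_zero] at a1 a2 e3
      have := congrArg₂ (· + ·) (congrArg₂ (· - ·) a1 a2) e3
      simp only [sub_zero, add_zero] at this
      rw [← this]
      abel
    · rintro ⟨m, m'⟩
      have e2 := congrArg (rst G (show W m ⊓ W' m' ≤ W m from inf_le_left)) (h2 m)
      have e4 := congrArg (rst G (show W m ⊓ W' m' ≤ W' m' from inf_le_right)) (h4 m')
      have e := congrArg (rst G (show W m ⊓ W' m' ≤ c'.U (r' m) ⊓ c'.U (s m') from
        le_inf (inf_le_left.trans (h' m)) (inf_le_right.trans (g m')))) (c'.sub_eq (r' m) (s m'))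
      simp only [map_sub, map_add, rst_rst, rst_map] at e2 e4 e ⊢
      rw [← e, ← e2, ← e4]
      abel

/-- The relation of being cohomologous. -/
instance cocycleSetoid : Setoid (Cocycle d) := ⟨Cohomologous, cohomologous_equivalence⟩

variable (d)

/-- The first hypercohomology `H¹(X, F → G)` of the complex `d : F → G` of sheaves on `X`: classes
of Čech `1`-cocycles, over all open covers. (In degree one, Čech hypercohomology is hypercohomology
for every complex of sheaves on every topological space.) -/
def H1 : Type (u + 1) := Quotient (cocycleSetoid (d := d))

end Cech

/-! ## Vector fields -/

section VectorFields

variable (k : Type u) [Field k] {Z : Scheme.{u}} [Z.Over (Spec (.of k))]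

/-- The vector fields over the open subset `U` of the `k`-scheme `Z`, that is, the `k`-derivations
of the sheaf of rings `𝒪_U`: compatible families of `k`-derivations of `Γ(Z, V)`, `V ≤ U`. -/
def VectorFields (U : Z.Opens) :
    AddSubgroup (∀ V : {V : Z.Opens // V ≤ U}, Derivation k Γ(Z, V.1) Γ(Z, V.1)) where
  carrier := {D | ∀ (V W : {V : Z.Opens // V ≤ U}) (h : W.1 ≤ V.1) (f : Γ(Z, V.1)),
    res k h (D V f) = D W (res k h f)}
  zero_mem' V W h f := map_zero _
  add_mem' {D E} hD hE V W h f := by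
    simp only [Pi.add_apply, Derivation.add_apply, map_add, hD V W h f, hE V W h f]
  neg_mem' {D} hD V W h f := by
    simp only [Pi.neg_apply, Derivation.neg_apply, map_neg, hD V W h f]

namespace VectorFields

variable {k} {U V : Z.Opens}

/-- The commutator `[x, y]` of vector fields. -/
instance : Bracket (VectorFields k U) (VectorFields k U) where
  bracket x y := ⟨fun V => ⁅x.1 V, y.1 V⁆, fun V W h f => by
    simp only [Derivation.commutator_apply, map_sub, x.2 V W h, y.2 V W h]⟩

/-- Multiplication of a vector field by a function: `(f x)(g) = f x(g)`. -/
instance : Module Γ(Z, U) (VectorFields k U) where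
  smul f x := ⟨fun V => res k V.2 f • x.1 V, fun V W h g => by
    simp only [Derivation.smul_apply, smul_eq_mul, map_mul, res_res, x.2 V W h]⟩
  one_smul x := Subtype.ext (funext fun V => by
    change res k V.2 1 • x.1 V = _; rw [map_one, one_smul])
  mul_smul f g x := Subtype.ext (funext fun V => by
    change res k V.2 (f * g) • x.1 V = res k V.2 f • res k V.2 g • x.1 V
    rw [map_mul, mul_smul])
  smul_zero f := Subtype.ext (funext fun V => by
    change res k V.2 f • (0 : Derivation k Γ(Z, V.1) Γ(Z, V.1)) = 0; rw [smul_zero])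
  smul_add f x y := Subtype.ext (funext fun V => by
    change res k V.2 f • (x.1 V + y.1 V) = res k V.2 f • x.1 V + res k V.2 f • y.1 V
    rw [smul_add])
  add_smul f g x := Subtype.ext (funext fun V => by
    change res k V.2 (f + g) • x.1 V = res k V.2 f • x.1 V + res k V.2 g • x.1 V
    rw [map_add, add_smul])
  zero_smul x := Subtype.ext (funext fun V => by
    change res k V.2 0 • x.1 V = 0; rw [map_zero, zero_smul])

/-- The derivation of `Γ(Z, U)` given by a vector field over `U`. -/
def der (x : VectorFields k U) : Derivation k Γ(Z, U) Γ(Z, U) := x.1 ⟨U, le_rfl⟩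

/-- Restriction of vector fields. -/
def restrict (h : V ≤ U) (x : VectorFields k U) : VectorFields k V :=
  ⟨fun W => x.1 ⟨W.1, W.2.trans h⟩,
    fun W W' h' f => x.2 ⟨W.1, W.2.trans h⟩ ⟨W'.1, W'.2.trans h⟩ h' f⟩

/-- The `p`-th power `x ^ p` of a vector field in characteristic `p`. -/
def pPow (p : ℕ) [Fact p.Prime] [CharP k p] (x : VectorFields k U) : VectorFields k U :=
  ⟨fun V => powDerivation p (x.1 V), fun V W h f => by
    rw [powDerivation_apply, powDerivation_apply]
    exact ((Function.Semiconj.iterate_right (f := res k h) (ga := x.1 V) (gb := x.1 W)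
      (fun g => x.2 V W h g) p) f)⟩

end VectorFields

end VectorFields

/-! ## Restricted Atiyah algebras -/

section Atiyah

/-- `jacobsonCoeff br x y n j` is the coefficient of `t ^ j` in `ad(t x + y) ^ n (x)`, for a bracket
`br`. -/
def jacobsonCoeff {L : Type*} [AddCommGroup L] (br : L → L → L) (x y : L) : ℕ → ℕ → L
  | 0, 0 => x
  | 0, _ + 1 => 0
  | n + 1, 0 => br y (jacobsonCoeff br x y n 0)
  | n + 1, j + 1 => br y (jacobsonCoeff br x y n (j + 1)) + br x (jacobsonCoeff br x y n j)

variable (p : ℕ) [Fact p.Prime] (k : Type u) [Field k] [CharP k p]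
  (Z : Scheme.{u}) [Z.Over (Spec (.of k))]

variable {Z} in
/-- Restriction of sections of a sheaf of modules. -/
def resM (M : Z.Modules) {U V : Z.Opens} (h : V ≤ U) : Γ(M, U) →+ Γ(M, V) :=
  (M.presheaf.map (homOfLE h).op).hom

/-- A restricted Lie algebroid on the `k`-scheme `Z`: a locally free sheaf of `𝒪_Z`-modules of
finite rank with a Lie bracket, an anchor map to the vector fields, and a `p`-operation. -/
structure RestrictedLieAlgebroid where
  /-- The underlying sheaf of modules. -/
  M : Z.Modules
  locally_free : ∀ z : Z, ∃ (U : Z.Opens) (_ : z ∈ U) (n : ℕ) (e : Fin n → Γ(M, U)),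
    ∀ (V : Z.Opens) (h : V ≤ U), ∃ b : Module.Basis (Fin n) Γ(Z, V) Γ(M, V),
      ∀ i, b i = resM M h (e i)
  /-- The Lie bracket. -/
  br : ∀ U : Z.Opens, Γ(M, U) → Γ(M, U) → Γ(M, U)
  br_res : ∀ {U V : Z.Opens} (h : V ≤ U) (x y : Γ(M, U)),
    resM M h (br U x y) = br V (resM M h x) (resM M h y)
  add_br : ∀ (U : Z.Opens) (x y z : Γ(M, U)), br U (x + y) z = br U x z + br U y z
  br_add : ∀ (U : Z.Opens) (x y z : Γ(M, U)), br U x (y + z) = br U x y + br U x z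
  br_self : ∀ (U : Z.Opens) (x : Γ(M, U)), br U x x = 0
  jacobi : ∀ (U : Z.Opens) (x y z : Γ(M, U)),
    br U x (br U y z) = br U (br U x y) z + br U y (br U x z)
  /-- The anchor map. -/
  anchor : ∀ U : Z.Opens, Γ(M, U) →ₗ[Γ(Z, U)] VectorFields k U
  anchor_res : ∀ {U V : Z.Opens} (h : V ≤ U) (x : Γ(M, U)),
    VectorFields.restrict h (anchor U x) = anchor V (resM M h x)
  anchor_br : ∀ (U : Z.Opens) (x y : Γ(M, U)), anchor U (br U x y) = ⁅anchor U x, anchor U y⁆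
  /-- The Leibniz rule; it implies that the bracket is `k`-bilinear. -/
  br_smul : ∀ (U : Z.Opens) (x y : Γ(M, U)) (f : Γ(Z, U)),
    br U x (f • y) = f • br U x y + VectorFields.der (anchor U x) f • y
  /-- The `p`-operation. -/
  pOp : ∀ U : Z.Opens, Γ(M, U) → Γ(M, U)
  pOp_res : ∀ {U V : Z.Opens} (h : V ≤ U) (x : Γ(M, U)),
    resM M h (pOp U x) = pOp V (resM M h x)
  /-- `ad (x ^ [p]) = (ad x) ^ p`. -/
  pOp_br : ∀ (U : Z.Opens) (x y : Γ(M, U)), br U (pOp U x) y = (br U x)^[p] y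
  /-- `(c x) ^ [p] = c ^ p x ^ [p]` for `c ∈ k`. -/
  pOp_smul_const : ∀ (U : Z.Opens) (c : k) (x : Γ(M, U)),
    pOp U (algebraMap k Γ(Z, U) c • x) = algebraMap k Γ(Z, U) (c ^ p) • pOp U x
  /-- `(x + y) ^ [p] = x ^ [p] + y ^ [p] + ∑ sᵢ(x, y)`, `1 ≤ i ≤ p - 1`, where `i sᵢ(x, y)` is the
  coefficient of `t ^ (i - 1)` in `ad(t x + y) ^ (p - 1) (x)`. -/
  pOp_add : ∀ (U : Z.Opens) (x y : Γ(M, U)),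
    pOp U (x + y) = pOp U x + pOp U y + ∑ i ∈ Finset.Icc 1 (p - 1),
      algebraMap k Γ(Z, U) (i : k)⁻¹ • jacobsonCoeff (br U) x y (p - 1) (i - 1)
  anchor_pOp : ∀ (U : Z.Opens) (x : Γ(M, U)), anchor U (pOp U x) = VectorFields.pPow p (anchor U x)
  /-- `(f x) ^ [p] = f ^ p x ^ [p] + τ(f x) ^ (p - 1) (f) x`. -/
  pOp_smul : ∀ (U : Z.Opens) (f : Γ(Z, U)) (x : Γ(M, U)),
    pOp U (f • x) = f ^ p • pOp U x + (VectorFields.der (anchor U (f • x)))^[p - 1] f • x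

/-- A restricted Atiyah algebra on the `k`-scheme `Z`: a restricted Lie algebroid which is an
extension `0 → 𝒪_Z → M → T_Z → 0` through its anchor map, such that `[x, f] = τ(x)(f)` and
`f ^ [p] = f ^ p` for functions `f`. -/
structure RestrictedAtiyahAlgebra extends RestrictedLieAlgebroid p k Z where
  /-- The inclusion of the functions. -/
  incl : ∀ U : Z.Opens, Γ(Z, U) →ₗ[Γ(Z, U)] Γ(M, U)
  incl_res : ∀ {U V : Z.Opens} (h : V ≤ U) (f : Γ(Z, U)),
    resM M h (incl U f) = incl V (res k h f)
  incl_injective : ∀ U : Z.Opens, Function.Injective (incl U)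
  exact : ∀ (U : Z.Opens) (x : Γ(M, U)), anchor U x = 0 ↔ ∃ f, incl U f = x
  /-- Surjectivity of the anchor map, as a morphism of sheaves. -/
  anchor_surjective : ∀ (U : Z.Opens) (x : VectorFields k U) (z : Z), z ∈ U →
    ∃ (V : Z.Opens) (h : V ≤ U) (_ : z ∈ V) (y : Γ(M, V)), anchor V y = VectorFields.restrict h x
  br_incl : ∀ (U : Z.Opens) (x : Γ(M, U)) (f : Γ(Z, U)),
    br U x (incl U f) = incl U (VectorFields.der (anchor U x) f)
  pOp_incl : ∀ (U : Z.Opens) (f : Γ(Z, U)), pOp U (incl U f) = incl U (f ^ p)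

namespace RestrictedAtiyahAlgebra

variable {p k Z}

/-- Isomorphism of restricted Atiyah algebras: an isomorphism of sheaves of modules compatible with
the bracket, the `p`-operation, the anchor map and the inclusion of the functions. -/
def Isomorphic (A B : RestrictedAtiyahAlgebra p k Z) : Prop :=
  ∃ e : A.M ≅ B.M, ∀ U : Z.Opens,
    (∀ x y : Γ(A.M, U), e.hom.app U (A.br U x y) = B.br U (e.hom.app U x) (e.hom.app U y)) ∧
    (∀ x : Γ(A.M, U), e.hom.app U (A.pOp U x) = B.pOp U (e.hom.app U x)) ∧
    (∀ x : Γ(A.M, U), B.anchor U (e.hom.app U x) = A.anchor U x) ∧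
    (∀ f : Γ(Z, U), e.hom.app U (A.incl U f) = B.incl U f)

theorem isomorphic_equivalence : Equivalence (Isomorphic (p := p) (k := k) (Z := Z)) where
  refl A := ⟨Iso.refl _, fun U => ⟨fun _ _ => rfl, fun _ => rfl, fun _ => rfl, fun _ => rfl⟩⟩
  symm := by
    rintro A B ⟨e, he⟩
    have h1 : ∀ (U : Z.Opens) (x : Γ(A.M, U)), e.inv.app U (e.hom.app U x) = x := fun U x => by
      have := congrArg (fun φ : A.M ⟶ A.M => φ.app U x) e.hom_inv_id
      exact this
    have h2 : ∀ (U : Z.Opens) (x : Γ(B.M, U)), e.hom.app U (e.inv.app U x) = x := fun U x => by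
      have := congrArg (fun φ : B.M ⟶ B.M => φ.app U x) e.inv_hom_id
      exact this
    refine ⟨e.symm, fun U => ⟨fun x y => ?_, fun x => ?_, fun x => ?_, fun f => ?_⟩⟩
    · change e.inv.app U _ = A.br U (e.inv.app U x) (e.inv.app U y)
      rw [← h1 U (A.br U _ _), (he U).1, h2, h2]
    · change e.inv.app U _ = A.pOp U (e.inv.app U x)
      rw [← h1 U (A.pOp U _), (he U).2.1, h2]
    · change A.anchor U (e.inv.app U x) = _
      rw [← (he U).2.2.1, h2]
    · change e.inv.app U _ = _
      rw [← (he U).2.2.2, h1]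
  trans := by
    rintro A B C ⟨e, he⟩ ⟨g, hg⟩
    refine ⟨e.trans g, fun U => ⟨fun x y => ?_, fun x => ?_, fun x => ?_, fun f => ?_⟩⟩
    · change g.hom.app U (e.hom.app U _) = C.br U (g.hom.app U (e.hom.app U x)) _
      rw [(he U).1, (hg U).1]; rfl
    · change g.hom.app U (e.hom.app U _) = C.pOp U (g.hom.app U (e.hom.app U x))
      rw [(he U).2.1, (hg U).2.1]
    · change C.anchor U (g.hom.app U (e.hom.app U x)) = _
      rw [(hg U).2.2.1, (he U).2.2.1]
    · change g.hom.app U (e.hom.app U _) = _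
      rw [(he U).2.2.2, (hg U).2.2.2]

/-- The relation of being isomorphic. -/
instance isoSetoid : Setoid (RestrictedAtiyahAlgebra p k Z) :=
  ⟨Isomorphic, isomorphic_equivalence⟩

/-- A splitting over `U` of the anchor map as a map of Lie algebras: a morphism of sheaves of
modules `σ : T_U → A|_U` with `τ σ = id` that respects the brackets. -/
structure LieSplitting (A : RestrictedAtiyahAlgebra p k Z) (U : Z.Opens) where
  /-- The underlying maps. -/
  σ : ∀ V : Z.Opens, V ≤ U → (VectorFields k V →ₗ[Γ(Z, V)] Γ(A.M, V))
  σ_res : ∀ (V W : Z.Opens) (h : V ≤ U) (h' : W ≤ V) (x : VectorFields k V),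
    resM A.M h' (σ V h x) = σ W (h'.trans h) (VectorFields.restrict h' x)
  anchor_σ : ∀ (V : Z.Opens) (h : V ≤ U) (x : VectorFields k V), A.anchor V (σ V h x) = x
  σ_lie : ∀ (V : Z.Opens) (h : V ≤ U) (x y : VectorFields k V),
    σ V h ⁅x, y⁆ = A.br V (σ V h x) (σ V h y)

/-- The Čech cocycle `c = (U i, α i j, γ i)` of the complex `Ω¹_{Z,cl} → Ω¹_{Z'}` is a cocycle of the
restricted Atiyah algebra `A` if there are Lie splittings `σ i` of the anchor map over `U i` with
`α i j = σ i - σ j` on `U i ⊓ U j`, such that `γ i` is the `p`-curvature of `σ i`, that is,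
`γ i (x) ^ p = σ i (x) ^ [p] - σ i (x ^ p)`. -/
def IsCocycleOf (A : RestrictedAtiyahAlgebra p k Z) (c : Cocycle (atiyahComplex p k Z)) : Prop :=
  ∃ σ : ∀ i, A.LieSplitting (c.U i),
    (∀ (i j : c.ι) (V : {V : Z.affineOpens // V.1 ≤ c.U i ⊓ c.U j}) (x : VectorFields k V.1.1),
      (σ i).σ V.1 (V.2.trans inf_le_left) x - (σ j).σ V.1 (V.2.trans inf_le_right) x
        = A.incl V.1 ((VectorFields.der x).liftKaehlerDifferential ((c.α i j).1 V).1)) ∧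
    ∀ (i : c.ι) (V : {V : Z.affineOpens // V.1 ≤ c.U i}) (x : VectorFields k V.1.1),
      A.pOp V.1 ((σ i).σ V.1 V.2 x) - (σ i).σ V.1 V.2 (VectorFields.pPow p x)
        = A.incl V.1 (twistPairing p (VectorFields.der x) ((c.γ i).1 V))

end RestrictedAtiyahAlgebra

end Atiyah

end RAtiyah
end

/-!
Restricted Atiyah algebras are classified by comparing local splittings of the anchor map that
respect the Lie brackets.

Such splittings exist. Near a point choose coordinates `xᵢ` and lifts `eᵢ` of the coordinate vector
fields `∂ᵢ`. As `∂ᵢ ^ p = 0`, the section `eᵢ ^ [p]` is a function `hᵢ`, and `∂ᵢ hᵢ = 0`. Replacing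
`eᵢ` by `eᵢ + hᵢ xᵢ ^ (p - 1)` turns `eᵢ ^ [p]` into a `p`-th power, which is killed by all vector
fields (`exists_lift_pOp`). Then `ad(eᵢ) ^ p = 0`, so that the closed `2`-form with components
`Fᵢⱼ = [eᵢ, eⱼ]` satisfies `∂ᵢ ^ (p - 1) Fᵢⱼ = 0`. A closed form with this property is exact
(`exists_primitive_two`), by integration in one variable after the other, and a primitive corrects
the `eᵢ` to commuting lifts (`exists_commuting_lift`).

The difference of two such splittings is a closed `1`-form (`exists_evForm_eq`). The `p`-curvature
`x ↦ σ(x) ^ [p] - σ(x ^ p)` of a splitting is additive, `p`-linear, and has values killed by all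
vector fields (`pCurv_add`, `pCurv_smul`, `der_pCurv`). On a smooth algebra such functions come from
the Frobenius twist (`exists_relFrob_eq`), hence the `p`-curvature is a `1`-form on the twist
(`exists_evTwist_eq`).

The Cartier operator satisfies `C(α)(x') ^ p = α(x ^ p) - x ^ (p - 1) (α(x))`
(`twistPairing_of_mem_cartierGraph`). For `α = f ^ (p - 1) df` this is the identity
`iterate_pow_pred_mul`, which for a unit `f` expresses `(x + x(f) / f) ^ p` in two ways. The
operator is constructed as the additive relation generated by the pairs `(dg, 0)` and
`(t f ^ (p - 1) df, t df')`. On a smooth algebra this relation is single-valued, by the formula for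
`C(α)(x')`, and defined on all closed forms, because in coordinates a closed form `∑ᵢ aᵢ dxᵢ` with
`∂ᵢ ^ (p - 1) aᵢ = 0` is exact (`exists_mem_cartierGraph`, `eq_zero_of_mem_cartierGraph`). The
formula shows that the difference `α` of two splittings and the difference of their `p`-curvatures
are related by `α' - C(α)` (`evTwist_atiyahComplex_eq`), so that splittings over a cover define a
cocycle, and two choices of splittings define cohomologous cocycles (`cohomologous_of_isCocycleOf`).

If the cocycles of two restricted Atiyah algebras are cohomologous through forms `bₘ`, then the maps
`σₘ(x) + f ↦ σₘ'(x) + f + bₘ(x)` glue to an isomorphism (`isomorphic_of_cohomologous`). Conversely a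
cocycle `(α, γ)` is the cocycle of the algebra of pairs of a vector field `x` and functions `fᵢ`
with `fⱼ - fᵢ = αᵢⱼ(x)` (`modelAlgebra`, `isCocycleOf_modelAlgebra`). On the `i`-th member of the
cover a section acts on functions as the operator `x + fᵢ`; in these terms the bracket is the
commutator and the `p`-operation is the `p`-th power, corrected by the function `γᵢ(x') ^ p`. The
identities required of a restricted Atiyah algebra are therefore identities in associative algebras,
among them the formulas of Jacobson (`add_pow_prime_jacobson`) and Hochschild
(`lmul_mul_firstOrder_pow_prime`).
-/

noncomputable section

namespace RAtiyah

/-! ### `p`-th powers in associative algebras of characteristic `p` -/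

theorem natCast_eq_zero_of_algebra (k : Type*) [Field k] (p : ℕ) [CharP k p] (R : Type*) [Ring R]
    [Algebra k R] : (p : R) = 0 := by
  rw [← map_natCast (algebraMap k R), CharP.cast_eq_zero, map_zero]

section CharP

variable {p : ℕ} [hp : Fact p.Prime] {R : Type*} [Ring R]

/-- Modulo `p`, the binomial coefficient `C(p - 1, m)` is `(-1) ^ m`. -/
theorem choose_pred_prime_cast (h0 : (p : R) = 0) {m : ℕ} (hm : m < p) :
    ((p - 1).choose m : R) = (-1) ^ m := by
  induction m with
  | zero => simp
  | succ m ih =>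
    have h1 : p.choose (m + 1) = (p - 1).choose m + (p - 1).choose (m + 1) := by
      conv_lhs => rw [← Nat.sub_add_cancel hp.out.one_le]
      exact Nat.choose_succ_succ _ _
    have h2 : ((p.choose (m + 1) : ℕ) : R) = 0 := by
      obtain ⟨c, hc⟩ := hp.out.dvd_choose_self (Nat.succ_ne_zero m) hm
      rw [hc, Nat.cast_mul, h0, zero_mul]
    rw [h1, Nat.cast_add, ih (by omega)] at h2
    rw [pow_succ, mul_neg_one, eq_neg_iff_add_eq_zero, add_comm, h2]

theorem commute_add_pow_prime (h0 : (p : R) = 0) {a b : R} (h : Commute a b) :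
    (a + b) ^ p = a ^ p + b ^ p := by
  obtain ⟨r, hr⟩ := h.exists_add_pow_prime_eq hp.out
  rw [hr, h0]; simp

theorem commute_sub_pow_prime (h0 : (p : R) = 0) {a b : R} (h : Commute a b) :
    (a - b) ^ p = a ^ p - b ^ p := by
  rw [eq_sub_iff_add_eq, ← commute_add_pow_prime h0 (h.sub_left (Commute.refl b)),
    sub_add_cancel]

theorem commute_sub_pow_pred_prime (h0 : (p : R) = 0) {a b : R} (h : Commute a b) :
    (a - b) ^ (p - 1) = ∑ j ∈ Finset.range p, a ^ j * b ^ (p - 1 - j) := by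
  rw [← neg_add_eq_sub, (h.symm.neg_left).add_pow', Finset.Nat.sum_antidiagonal_eq_sum_range_succ
    (fun i j => (p - 1).choose i • ((-b) ^ i * a ^ j)), Nat.succ_eq_add_one,
    Nat.sub_add_cancel hp.out.one_le, ← Finset.sum_range_reflect]
  refine Finset.sum_congr rfl fun j hj => ?_
  have hj' : j < p := Finset.mem_range.mp hj
  rw [show p - 1 - (p - 1 - j) = j by omega, nsmul_eq_mul,
    choose_pred_prime_cast h0 (show p - 1 - j < p by omega), neg_pow b, ← mul_assoc, ← mul_assoc,
    ← pow_add, ← two_mul, pow_mul, neg_one_sq, one_pow, one_mul]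
  exact ((h.pow_pow _ _).eq).symm

/-- The commutator `a ↦ [x, a]` in an associative ring. -/
def comm (x a : R) : R := x * a - a * x

theorem comm_iterate (x : R) (n : ℕ) (a : R) :
    (comm x)^[n] a = ((LinearMap.mulLeft ℤ x - LinearMap.mulRight ℤ x) ^ n) a := by
  rw [Module.End.pow_apply]
  rfl

theorem natCast_moduleEnd_eq_zero {p : ℕ} {R : Type*} [Ring R] (h0 : (p : R) = 0) :
    (p : Module.End ℤ R) = 0 := by
  ext a
  rw [Module.End.natCast_apply, nsmul_eq_mul, h0, zero_mul]; rfl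

theorem comm_iterate_prime (h0 : (p : R) = 0) (x a : R) : (comm x)^[p] a = comm (x ^ p) a := by
  rw [comm_iterate, commute_sub_pow_prime (natCast_moduleEnd_eq_zero h0)
    (LinearMap.commute_mulLeft_right x x), LinearMap.pow_mulLeft, LinearMap.pow_mulRight]
  rfl

theorem comm_iterate_pred_prime (h0 : (p : R) = 0) (x a : R) :
    (comm x)^[p - 1] a = ∑ j ∈ Finset.range p, x ^ j * a * x ^ (p - 1 - j) := by
  rw [comm_iterate, commute_sub_pow_pred_prime (natCast_moduleEnd_eq_zero h0)
    (LinearMap.commute_mulLeft_right x x), LinearMap.sum_apply]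
  refine Finset.sum_congr rfl fun j _ => ?_
  rw [LinearMap.pow_mulLeft, LinearMap.pow_mulRight, mul_assoc]
  rfl

open Polynomial in
theorem derivative_pow_noncomm (z : R[X]) (n : ℕ) :
    derivative (z ^ n)
      = ∑ j ∈ Finset.range n, z ^ j * derivative z * z ^ (n - 1 - j) := by
  induction n with
  | zero => simp
  | succ n ih =>
    rw [pow_succ, derivative_mul, ih, Finset.sum_range_succ, Finset.sum_mul]
    congr 1
    · refine Finset.sum_congr rfl fun j hj => ?_
      have := Finset.mem_range.mp hj
      rw [mul_assoc _ _ z, ← pow_succ]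
      congr 2; omega
    · simp

open Polynomial in
theorem coeff_comm_iterate (x y : R) (n j : ℕ) :
    ((comm (C x * X + C y))^[n] (C x)).coeff j = jacobsonCoeff comm x y n j := by
  induction n generalizing j with
  | zero => cases j <;> simp [jacobsonCoeff, coeff_C]
  | succ n ih =>
    rw [Function.iterate_succ_apply', comm]
    cases j with
    | zero =>
      simp only [coeff_sub, mul_add, add_mul, coeff_add, mul_assoc, X_mul,
        mul_coeff_zero, coeff_X_zero, mul_zero, ih, jacobsonCoeff, comm, coeff_C_zero]
      simp
    | succ j =>
      have hX : ∀ q : R[X], q * (C x * X) = q * C x * X := fun q => (mul_assoc _ _ _).symm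
      have hX' : ∀ q : R[X], (C x * X) * q = C x * q * X := fun q => by
        rw [mul_assoc, X_mul, mul_assoc]
      rw [mul_add, add_mul, hX, hX']
      simp only [coeff_sub, coeff_add, coeff_mul_X, coeff_C_mul, coeff_mul_C, ih, jacobsonCoeff,
        comm]
      abel

open Polynomial in
/-- Jacobson's formula for the `p`-th power of a sum in an associative algebra. It comes from the
expansion of `(t x + y) ^ p`, whose derivative in `t` is `ad(t x + y) ^ (p - 1) (x)`. -/
theorem add_pow_prime_jacobson {k : Type*} [Field k] [CharP k p] [Algebra k R] (x y : R) :
    (x + y) ^ p = x ^ p + y ^ p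
      + ∑ i ∈ Finset.Icc 1 (p - 1), (i : k)⁻¹ • jacobsonCoeff comm x y (p - 1) (i - 1) := by
  have h0 : (p : R) = 0 := natCast_eq_zero_of_algebra k p R
  have h0' : (p : R[X]) = 0 := by
    rw [← map_natCast (C : R →+* R[X]), h0, map_zero]
  set z : R[X] := C x * X + C y with hz
  -- In characteristic `p` the sum `∑ⱼ z ^ j x z ^ (p - 1 - j)` is `ad(z) ^ (p - 1) (x)`.
  have hd : derivative (z ^ p) = (comm z)^[p - 1] (C x) := by
    rw [derivative_pow_noncomm, comm_iterate_pred_prime h0']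
    simp [hz]
  -- Comparing coefficients, `i` times the `i`-th coefficient of `z ^ p` is a Jacobson coefficient.
  have hc : ∀ i ∈ Finset.Icc 1 (p - 1),
      (z ^ p).coeff i = (i : k)⁻¹ • jacobsonCoeff comm x y (p - 1) (i - 1) := by
    intro i hi
    obtain ⟨h1, h2⟩ := Finset.mem_Icc.mp hi
    have hp1 := hp.out.one_lt
    have h3 := congrArg (fun q => coeff q (i - 1)) hd
    simp only [coeff_comm_iterate, coeff_derivative, Nat.sub_add_cancel h1, hz] at h3
    rw [← h3]
    have hi0 : (i : k) ≠ 0 := by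
      rw [Ne, CharP.cast_eq_zero_iff k p]
      exact Nat.not_dvd_of_pos_of_lt h1 (by omega)
    have h4 : (((i - 1 : ℕ) : R) + 1) = algebraMap k R i := by
      rw [map_natCast, ← Nat.cast_add_one, Nat.sub_add_cancel h1]
    rw [h4, ← Algebra.commutes, ← Algebra.smul_def, smul_smul, inv_mul_cancel₀ hi0, one_smul]
  have hdeg : z.natDegree ≤ 1 := by
    rw [hz]; exact natDegree_linear_le
  have hev : (x + y) ^ p = ∑ i ∈ Finset.range (p + 1), (z ^ p).coeff i := by
    have h1 : eval₂RingHom' (RingHom.id R) 1 (fun a => Commute.one_right a) z = x + y := by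
      change eval₂ (RingHom.id R) 1 z = _
      rw [hz, eval₂_add, eval₂_mul_X, eval₂_C, eval₂_C]; simp
    rw [← h1, ← map_pow]
    change eval₂ (RingHom.id R) 1 (z ^ p) = _
    rw [eval₂_eq_sum_range' (RingHom.id R)
      (Nat.lt_succ_of_le ((natDegree_pow_le_of_le p hdeg).trans (mul_one p).le))]
    simp
  have htop : (z ^ p).coeff p = x ^ p := by
    have := coeff_pow_of_natDegree_le (m := p) hdeg
    rw [mul_one] at this
    rw [this, hz]; simp
  have hbot : (z ^ p).coeff 0 = y ^ p := by
    have : ∀ n, (z ^ n).coeff 0 = y ^ n := fun n => by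
      induction n with
      | zero => simp
      | succ n ih => rw [pow_succ, mul_coeff_zero, ih, pow_succ, hz]; simp
    exact this p
  rw [hev, Finset.sum_range_succ, htop, Finset.range_eq_Ico,
    Finset.sum_eq_sum_Ico_succ_bot hp.out.pos, hbot, ← Finset.sum_congr rfl hc,
    show Finset.Icc 1 (p - 1) = Finset.Ico (0 + 1) p by
      ext i; have := hp.out.one_le; simp only [Finset.mem_Icc, Finset.mem_Ico]; omega]
  abel

end CharP

/-! ### First-order differential operators in characteristic `p` -/

theorem derivation_pow_char (p : ℕ) {k A : Type*} [Field k] [CharP k p] [CommRing A] [Algebra k A]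
    (x : Derivation k A A) (a : A) : x (a ^ p) = 0 := by
  rw [Derivation.leibniz_pow, ← Nat.cast_smul_eq_nsmul A, natCast_eq_zero_of_algebra k p A,
    zero_smul]

section FirstOrder

variable {p : ℕ} [hp : Fact p.Prime] {k : Type u} [Field k] [CharP k p]
  {A : Type u} [CommRing A] [Algebra k A]

/-- The first-order differential operator `a ↦ x a + f a` given by a derivation `x` and a
function `f`. -/
def firstOrder (x : Derivation k A A) (f : A) : Module.End k A :=
  x.toLinearMap + Algebra.lmul k A f

theorem firstOrder_apply (x : Derivation k A A) (f a : A) : firstOrder x f a = x a + f * a := rfl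

theorem comm_firstOrder (x y : Derivation k A A) (f g : A) :
    comm (firstOrder x f) (firstOrder y g) = firstOrder ⁅x, y⁆ (x g - y f) := by
  ext a
  change x (y a + g * a) + f * (y a + g * a) - (y (x a + f * a) + g * (x a + f * a)) = _
  rw [firstOrder_apply, Derivation.commutator_apply]
  simp only [map_add, Derivation.leibniz, smul_eq_mul]
  ring

theorem firstOrder_injective {x y : Derivation k A A} {f g : A}
    (h : firstOrder x f = firstOrder y g) : x = y ∧ f = g := by
  have h1 : f = g := by
    have := LinearMap.congr_fun h 1
    simpa [firstOrder_apply] using this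
  subst h1
  refine ⟨Derivation.ext fun a => ?_, rfl⟩
  have := LinearMap.congr_fun h a
  simpa [firstOrder_apply] using this

theorem jacobsonCoeff_lmul (x : Derivation k A A) (f : A) (n j : ℕ) :
    jacobsonCoeff comm (Algebra.lmul k A f) (x.toLinearMap : Module.End k A) n j
      = Algebra.lmul k A (if j = 0 then x^[n] f else 0) := by
  have h1 : ∀ g, comm (x.toLinearMap : Module.End k A) (Algebra.lmul k A g)
      = Algebra.lmul k A (x g) := fun g => by
    ext a
    change x (g * a) - g * x a = x g * a
    rw [Derivation.leibniz, smul_eq_mul, smul_eq_mul]; ring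
  have h2 : ∀ g, comm (Algebra.lmul k A f) (Algebra.lmul k A g) = 0 := fun g => by
    rw [comm, ← map_mul, ← map_mul, mul_comm, sub_self]
  induction n generalizing j with
  | zero => cases j <;> simp [jacobsonCoeff]
  | succ n ih =>
    cases j with
    | zero => rw [jacobsonCoeff, ih, h1, if_pos rfl, if_pos rfl, Function.iterate_succ_apply']
    | succ j =>
      rw [jacobsonCoeff, ih, ih, h1, h2, if_neg j.succ_ne_zero, if_neg j.succ_ne_zero, map_zero,
        add_zero]

/-- `(x + f) ^ p = x ^ p + f ^ p + x ^ (p - 1) (f)`: Jacobson's formula, in which only the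
coefficient of index `1` is not zero because functions commute. -/
theorem firstOrder_pow_prime (x : Derivation k A A) (f : A) :
    firstOrder x f ^ p = firstOrder (powDerivation p x) (f ^ p + x^[p - 1] f) := by
  rw [firstOrder, add_comm, add_pow_prime_jacobson (k := k) (p := p)]
  simp only [jacobsonCoeff_lmul]
  rw [Finset.sum_eq_single_of_mem 1 (Finset.mem_Icc.mpr
    ⟨le_rfl, Nat.le_sub_one_of_lt hp.out.one_lt⟩)]
  · rw [Nat.sub_self, if_pos rfl, Nat.cast_one, inv_one, one_smul, ← map_pow, firstOrder, map_add]
    change _ = (x.toLinearMap : Module.End k A) ^ p + _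
    abel
  · intro i hi hi1
    have := (Finset.mem_Icc.mp hi).1
    rw [if_neg (by omega), map_zero, smul_zero]

/-- The coefficients of `(f D) ^ n = ∑ⱼ cₙⱼ Dʲ`, for a derivation `D`. -/
def normalOrderCoeff (D : A → A) (f : A) : ℕ → ℕ → A
  | 0, 0 => 1
  | 0, _ + 1 => 0
  | n + 1, 0 => f * D (normalOrderCoeff D f n 0)
  | n + 1, j + 1 => f * (D (normalOrderCoeff D f n (j + 1)) + normalOrderCoeff D f n j)

theorem normalOrderCoeff_eq_zero (D : Derivation k A A) (f : A) {n j : ℕ} (h : n < j) :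
    normalOrderCoeff D f n j = 0 := by
  induction n generalizing j with
  | zero => cases j <;> [exact absurd h (lt_irrefl _); rfl]
  | succ n ih =>
    cases j with
    | zero => exact absurd h (Nat.not_lt_zero _)
    | succ j => rw [normalOrderCoeff, ih (by omega), ih (by omega), map_zero, add_zero, mul_zero]

theorem normalOrderCoeff_self (D : Derivation k A A) (f : A) (n : ℕ) :
    normalOrderCoeff D f n n = f ^ n := by
  induction n with
  | zero => simp [normalOrderCoeff]
  | succ n ih =>
    rw [normalOrderCoeff, ih, normalOrderCoeff_eq_zero D f n.lt_succ_self, map_zero, zero_add,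
      pow_succ']

theorem normalOrderCoeff_zero (D : Derivation k A A) (f : A) (n : ℕ) :
    normalOrderCoeff D f (n + 1) 0 = 0 := by
  induction n with
  | zero => simp [normalOrderCoeff]
  | succ n ih => rw [normalOrderCoeff, ih, map_zero, mul_zero]

theorem normalOrderCoeff_one (D : Derivation k A A) (f : A) (n : ℕ) :
    normalOrderCoeff D f (n + 1) 1 = (f • D)^[n] f := by
  induction n with
  | zero => simp [normalOrderCoeff]
  | succ n ih =>
    rw [normalOrderCoeff, ih, normalOrderCoeff_zero, add_zero, Function.iterate_succ_apply']; rfl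

/-- If `b a = a b + D(a)` for all `a`, then `(f b) ^ n = ∑ⱼ cₙⱼ b ^ j`. -/
theorem mul_pow_eq_sum_normalOrderCoeff (D : Derivation k A A) (f : A) {R : Type*} [Ring R]
    (ι : A →+* R) (b : R) (hb : ∀ a, b * ι a = ι a * b + ι (D a)) (n : ℕ) :
    (ι f * b) ^ n = ∑ j ∈ Finset.range (n + 1), ι (normalOrderCoeff D f n j) * b ^ j := by
  induction n with
  | zero => simp [normalOrderCoeff]
  | succ n ih =>
    have h1 : ∀ j, ι f * b * (ι (normalOrderCoeff D f n j) * b ^ j)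
        = ι f * ι (normalOrderCoeff D f n j) * b ^ (j + 1)
          + ι f * ι (D (normalOrderCoeff D f n j)) * b ^ j := fun j => by
      rw [mul_assoc, ← mul_assoc b, hb, add_mul, mul_assoc _ b, ← pow_succ', mul_add, mul_assoc,
        mul_assoc]
    have h2 : ∑ j ∈ Finset.range (n + 1), ι f * ι (D (normalOrderCoeff D f n j)) * b ^ j
        = ∑ j ∈ Finset.range (n + 1), ι f * ι (D (normalOrderCoeff D f n (j + 1))) * b ^ (j + 1)
          + ι f * ι (D (normalOrderCoeff D f n 0)) := by
      rw [Finset.sum_range_succ (fun j => ι f * ι (D (normalOrderCoeff D f n (j + 1)))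
        * b ^ (j + 1)), normalOrderCoeff_eq_zero D f n.lt_succ_self, map_zero, map_zero, mul_zero,
        zero_mul, add_zero, Finset.sum_range_succ', pow_zero, mul_one]
    rw [pow_succ', ih, Finset.mul_sum, Finset.sum_congr rfl fun j _ => h1 j,
      Finset.sum_add_distrib, h2, Finset.sum_range_succ' _ (n + 1), ← add_assoc,
      ← Finset.sum_add_distrib]
    congr 1
    · refine Finset.sum_congr rfl fun j _ => ?_
      rw [normalOrderCoeff, map_mul, map_add, mul_add, add_mul, add_comm]
    · rw [normalOrderCoeff, map_mul, pow_zero, mul_one]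

open PowerSeries in
/-- The extension of a derivation of `A` to `A⟦T⟧`, coefficient by coefficient. -/
def coeffDerivation (x : Derivation k A A) : Derivation k A⟦X⟧ A⟦X⟧ :=
  Derivation.mk'
    { toFun := fun q => PowerSeries.mk fun n => x (coeff n q)
      map_add' := fun q r => by ext n; simp
      map_smul' := fun c q => by ext n; simp }
    fun q r => by
      ext n
      simp only [LinearMap.coe_mk, AddHom.coe_mk, coeff_mk, coeff_mul, map_sum, Derivation.leibniz,
        smul_eq_mul, map_add, Finset.sum_add_distrib]
      congr 1
      rw [← Finset.Nat.sum_antidiagonal_swap]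
      rfl

open PowerSeries in
theorem coeff_coeffDerivation (x : Derivation k A A) (q : A⟦X⟧) (n : ℕ) :
    coeff n (coeffDerivation x q) = x (coeff n q) := by
  simp [coeffDerivation]

open PowerSeries in
theorem coeff_coeffDerivation_iterate (x : Derivation k A A) (q : A⟦X⟧) (n m : ℕ) :
    coeff n ((coeffDerivation x)^[m] q) = x^[m] (coeff n q) := by
  induction m with
  | zero => rfl
  | succ m ih =>
    rw [Function.iterate_succ_apply', coeff_coeffDerivation, ih, Function.iterate_succ_apply']

open PowerSeries in
/-- The derivation `D + d/dT` of `A⟦T⟧`; its iterates, evaluated at `T = 0` on the powers of `T`,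
are linearly independent over `A` in degrees less than `p`. -/
def shiftDerivation (x : Derivation k A A) : Derivation k A⟦X⟧ A⟦X⟧ :=
  coeffDerivation x + (PowerSeries.derivative A).restrictScalars k

open PowerSeries in
theorem shiftDerivation_iterate_X_pow (x : Derivation k A A) (j m : ℕ) :
    constantCoeff ((shiftDerivation x)^[j] (X ^ m)) = if j = m then (m.factorial : A) else 0 := by
  have h1 : shiftDerivation x (X : A⟦X⟧) = 1 := by
    change coeffDerivation x X + PowerSeries.derivative A X = 1
    rw [show coeffDerivation x (X : A⟦X⟧) = 0 by
      ext n; rw [coeff_coeffDerivation, coeff_X]; split_ifs <;> simp]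
    simp
  have h2 : ∀ m, shiftDerivation x ((X : A⟦X⟧) ^ (m + 1)) = (m + 1) • X ^ m := fun m => by
    rw [Derivation.leibniz_pow, h1]; simp
  have h3 : ∀ (j n : ℕ) (q : A⟦X⟧),
      (shiftDerivation x)^[j] (n • q) = n • (shiftDerivation x)^[j] q := fun j n q => by
    induction j with
    | zero => rfl
    | succ j ih => rw [Function.iterate_succ_apply', ih, map_nsmul, Function.iterate_succ_apply']
  induction j generalizing m with
  | zero =>
    cases m with
    | zero => simp
    | succ m => simp
  | succ j ih =>
    rw [Function.iterate_succ_apply]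
    cases m with
    | zero =>
      rw [pow_zero, Derivation.map_one_eq_zero, if_neg j.succ_ne_zero]
      have := h3 j 0 0
      rw [zero_smul, zero_smul] at this
      rw [this, map_zero]
    | succ m =>
      rw [h2, h3, map_nsmul, ih]
      simp only [Nat.add_right_cancel_iff, Nat.factorial_succ, nsmul_eq_mul, Nat.cast_mul]
      split_ifs <;> simp

theorem smul_pow_linearMap (x : Derivation k A A) (f : A) (n : ℕ) :
    (Algebra.lmul k A f * (x.toLinearMap : Module.End k A)) ^ n
      = (((f • x).toLinearMap : Module.End k A)) ^ n := rfl

open PowerSeries in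
/-- The `p`-th power of the derivation `f D` is again a derivation; on the powers of a variable `T`
with `D T = 1` this says that the intermediate coefficients of `(f D) ^ p` vanish. -/
theorem normalOrderCoeff_prime (x : Derivation k A A) (f : A) {j : ℕ} (h1 : 1 < j) (h2 : j < p) :
    normalOrderCoeff x f p j = 0 := by
  let D := shiftDerivation x
  have hb : ∀ a : A, (D.toLinearMap : Module.End k A⟦X⟧)
      * ((Algebra.lmul k A⟦X⟧).toRingHom.comp (C (R := A))) a
      = ((Algebra.lmul k A⟦X⟧).toRingHom.comp (C (R := A))) a * D.toLinearMap
        + ((Algebra.lmul k A⟦X⟧).toRingHom.comp (C (R := A))) (x a) := fun a => by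
    refine LinearMap.ext fun q => ?_
    change D (C a * q) = C a * D q + C (x a) * q
    have : D (C a) = C (x a) := by
      change coeffDerivation x (C a) + PowerSeries.derivative A (C a) = _
      rw [show PowerSeries.derivative A (C a) = 0 from PowerSeries.derivative_C, add_zero]
      ext n
      rw [coeff_coeffDerivation, coeff_C, coeff_C]
      split_ifs <;> simp
    rw [Derivation.leibniz, this, smul_eq_mul, smul_eq_mul]; ring
  -- Apply `(f D) ^ p = ∑ᵢ cᵢ Dⁱ` to `T ^ j` and put `T = 0`. On the left a derivation is applied to
  -- `T ^ j` with `j ≥ 2`, which gives `0`; on the right only `cⱼ j!` remains.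
  have h := mul_pow_eq_sum_normalOrderCoeff x f _ _ hb p
  have h3 := congrArg (fun L => constantCoeff (L (X ^ j))) h
  have h4 : constantCoeff ((((Algebra.lmul k A⟦X⟧) (C f) * (D.toLinearMap : Module.End k A⟦X⟧)) ^ p)
      (X ^ j)) = 0 := by
    rw [smul_pow_linearMap]
    change constantCoeff (powDerivation p (C f • D) (X ^ j)) = 0
    rw [Derivation.leibniz_pow, ← PowerSeries.coeff_zero_eq_constantCoeff_apply]
    obtain ⟨i, rfl⟩ : ∃ i, j = i + 2 := ⟨j - 2, by omega⟩
    rw [show i + 2 - 1 = i + 1 by omega, smul_eq_mul, map_nsmul, pow_succ, mul_assoc,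
      PowerSeries.coeff_zero_eq_constantCoeff_apply]
    simp
  have h5 : constantCoeff ((∑ i ∈ Finset.range (p + 1),
      ((Algebra.lmul k A⟦X⟧).toRingHom.comp (C (R := A))) (normalOrderCoeff x f p i)
        * (D.toLinearMap : Module.End k A⟦X⟧) ^ i) (X ^ j))
      = normalOrderCoeff x f p j * (j.factorial : A) := by
    rw [LinearMap.sum_apply, map_sum, Finset.sum_eq_single_of_mem j
      (Finset.mem_range.mpr (by omega))]
    · change constantCoeff (C (normalOrderCoeff x f p j) * ((D.toLinearMap : Module.End k A⟦X⟧) ^ j)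
        (X ^ j)) = _
      rw [Module.End.pow_apply, map_mul, constantCoeff_C]
      change _ * constantCoeff (D^[j] (X ^ j)) = _
      rw [shiftDerivation_iterate_X_pow, if_pos rfl]
    · intro i _ hi
      change constantCoeff (C (normalOrderCoeff x f p i) * ((D.toLinearMap : Module.End k A⟦X⟧) ^ i)
        (X ^ j)) = _
      rw [Module.End.pow_apply, map_mul, constantCoeff_C]
      change _ * constantCoeff (D^[i] (X ^ j)) = _
      rw [shiftDerivation_iterate_X_pow, if_neg hi, mul_zero]
  have h6 : normalOrderCoeff x f p j * (j.factorial : A) = 0 := h5.symm.trans (h3.symm.trans h4)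
  have h7 : IsUnit (j.factorial : A) := by
    have : (j.factorial : k) ≠ 0 := by
      rw [Ne, CharP.cast_eq_zero_iff k p, hp.out.dvd_factorial]; omega
    rw [← map_natCast (algebraMap k A)]
    exact (isUnit_iff_ne_zero.mpr this).map _
  exact h7.mul_left_eq_zero.mp h6

/-- Hochschild's formula, for first-order differential operators. -/
theorem lmul_mul_firstOrder_pow_prime (x : Derivation k A A) (f h : A) :
    (Algebra.lmul k A f * firstOrder x h) ^ p
      = Algebra.lmul k A (f ^ p) * firstOrder x h ^ p
        + Algebra.lmul k A ((f • x)^[p - 1] f) * firstOrder x h := by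
  have hb : ∀ a : A, firstOrder x h * (Algebra.lmul k A).toRingHom a
      = (Algebra.lmul k A).toRingHom a * firstOrder x h + (Algebra.lmul k A).toRingHom (x a) :=
    fun a => by
      refine LinearMap.ext fun q => ?_
      change x (a * q) + h * (a * q) = a * (x q + h * q) + x a * q
      rw [Derivation.leibniz, smul_eq_mul, smul_eq_mul]; ring
  have key := mul_pow_eq_sum_normalOrderCoeff x f (Algebra.lmul k A).toRingHom _ hb p
  have h0 : normalOrderCoeff x f p 0 = 0 := by
    rw [← Nat.sub_add_cancel hp.out.one_le]; exact normalOrderCoeff_zero x f _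
  have h1 : normalOrderCoeff x f p 1 = (f • x)^[p - 1] f := by
    conv_lhs => rw [← Nat.sub_add_cancel hp.out.one_le]
    exact normalOrderCoeff_one x f _
  rw [Finset.sum_range_succ, normalOrderCoeff_self, Finset.sum_eq_single_of_mem 1
    (Finset.mem_range.mpr hp.out.one_lt), h1, pow_one, add_comm] at key
  · exact key
  · intro j hj hj1
    have hj' := Finset.mem_range.mp hj
    rcases Nat.lt_or_ge 1 j with h | h
    · rw [normalOrderCoeff_prime x f h hj', map_zero, zero_mul]
    · obtain rfl : j = 0 := by omega
      rw [h0, map_zero, zero_mul]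

/-- The `p`-th power of `x + g` applied to `1`, where `g = x f / f`. -/
theorem mul_iterate_dlog (x : Derivation k A A) {f g : A} (hg : f * g = x f) :
    f * (x^[p - 1] g + g ^ p) = x^[p] f := by
  -- Conjugation by `f` turns `x` into the operator `x + g`.
  have h1 : ∀ n, f * ((firstOrder x g ^ n) 1) = x^[n] f := fun n => by
    induction n with
    | zero => simp
    | succ n ih =>
      rw [pow_succ', Module.End.mul_apply, firstOrder_apply, Function.iterate_succ_apply', ← ih,
        Derivation.leibniz, ← hg, smul_eq_mul, smul_eq_mul]
      ring
  rw [← h1 p, firstOrder_pow_prime, firstOrder_apply, Derivation.map_one_eq_zero]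
  ring

theorem iterate_map_zero' (x : Derivation k A A) (n : ℕ) : x^[n] (0 : A) = 0 := by
  induction n with
  | zero => rfl
  | succ n ih => rw [Function.iterate_succ_apply', ih, map_zero]

theorem iterate_mul_of_apply_eq_zero (x : Derivation k A A) {c : A} (hc : x c = 0) (n : ℕ) (a : A) :
    x^[n] (c * a) = c * x^[n] a := by
  induction n with
  | zero => rfl
  | succ n ih =>
    rw [Function.iterate_succ_apply', ih, Derivation.leibniz, hc, smul_zero, add_zero,
      Function.iterate_succ_apply', smul_eq_mul]

theorem iterate_pow_pred_mul_of_isUnit (x : Derivation k A A) {f : A} (hf : IsUnit f) :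
    x^[p - 1] (f ^ (p - 1) * x f) + x f ^ p = f ^ (p - 1) * x^[p] f := by
  obtain ⟨g, hg⟩ : ∃ g, f * g = x f := ⟨hf.unit.inv * x f, by
    rw [← mul_assoc]; simp⟩
  have hp1 : p - 1 + 1 = p := Nat.sub_add_cancel hp.out.one_le
  rw [← mul_iterate_dlog x hg, ← hg, ← mul_assoc, ← pow_succ, hp1,
    iterate_mul_of_apply_eq_zero x (derivation_pow_char p x f), mul_pow, ← mul_assoc, ← pow_succ,
    hp1]
  ring

open PowerSeries in
/-- The identity behind the Cartier operator: for `α = f ^ (p - 1) df` the function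
`α(x ^ p) - x ^ (p - 1) (α(x))` is `x(f) ^ p`. Both sides are homogeneous of degree `p` in `f`, so
that it is enough to replace `f` by the unit `1 + T f` of `A⟦T⟧` and to compare the coefficients
of `T ^ p`. -/
theorem iterate_pow_pred_mul (x : Derivation k A A) (f : A) :
    x^[p - 1] (f ^ (p - 1) * x f) + x f ^ p = f ^ (p - 1) * x^[p] f := by
  have hp1 : p - 1 + 1 = p := Nat.sub_add_cancel hp.out.one_le
  let D := coeffDerivation x
  have hDC : ∀ a : A, D (C a) = C (x a) := fun a => by
    ext n
    rw [coeff_coeffDerivation, coeff_C, coeff_C]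
    split_ifs <;> simp
  have hDX : D (X : A⟦X⟧) = 0 := by
    ext n; rw [coeff_coeffDerivation, coeff_X]; split_ifs <;> simp
  have hu : IsUnit (1 + X * C f : A⟦X⟧) := by
    rw [PowerSeries.isUnit_iff_constantCoeff]; simp
  have hD1 : D (1 + X * C f) = X * C (x f) := by
    rw [map_add, Derivation.map_one_eq_zero, Derivation.leibniz, hDX, hDC]; simp
  have hDn : ∀ n, D^[n] (X * C (x f)) = X * C (x^[n] (x f)) := fun n => by
    induction n with
    | zero => rfl
    | succ n ih =>
      rw [Function.iterate_succ_apply', ih, Derivation.leibniz, hDX, hDC,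
        Function.iterate_succ_apply']
      simp
  have hDp : D^[p] (1 + X * C f) = X * C (x^[p] f) := by
    rw [← hp1, Function.iterate_succ_apply, Function.iterate_succ_apply, hD1, hDn]
  have hc : ∀ a : A, coeff p ((1 + X * C f) ^ (p - 1) * (X * C a)) = f ^ (p - 1) * a := by
    intro a
    have : ∀ n : ℕ, coeff n ((1 + X * C f : A⟦X⟧) ^ n) = f ^ n := by
      intro n
      rw [add_comm, add_pow, map_sum, Finset.sum_eq_single_of_mem n (by simp)]
      · simp [mul_pow, ← map_pow]
      · intro i hi hin
        have : i < n := lt_of_le_of_ne (Nat.lt_succ_iff.mp (Finset.mem_range.mp hi)) hin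
        rw [one_pow, mul_one, mul_pow, ← map_pow, mul_assoc, ← map_natCast (C (R := A)), ← map_mul,
          coeff_X_pow_mul', if_pos this.le, coeff_C, if_neg (by omega)]
    rw [show (1 + X * C f) ^ (p - 1) * (X * C a) = (1 + X * C f) ^ (p - 1) * C a * X by ring]
    obtain ⟨n, rfl⟩ : ∃ n, p = n + 1 := ⟨p - 1, hp1.symm⟩
    rw [coeff_succ_mul_X, coeff_mul_C, Nat.add_sub_cancel, this]
  have h := congrArg (coeff p) (iterate_pow_pred_mul_of_isUnit (p := p) D hu)
  rw [hD1, hDp, hc, map_add, coeff_coeffDerivation_iterate, hc, mul_pow, ← map_pow, coeff_mul_C,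
    coeff_X_pow_self, one_mul] at h
  exact h

end FirstOrder

/-! ### Primitives in characteristic `p` -/

section Poincare

variable {p : ℕ} {k : Type u} [Field k] {A : Type u} [CommRing A] [Algebra k A]

/-- A primitive of `a` with respect to a derivation `D` with `D x = 1`, obtained by repeated
integration by parts: `∑ₘ (-1) ^ m x ^ (m + 1) / (m + 1)! D ^ m a`, `m < p - 1`. -/
def antideriv (p : ℕ) (D : Derivation k A A) (x a : A) : A :=
  ∑ m ∈ Finset.range (p - 1), (-1) ^ m *
    (algebraMap k A ((m + 1).factorial : k)⁻¹ * x ^ (m + 1) * D^[m] a)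

theorem derivation_antideriv [CharP k p] (D : Derivation k A A) {x a : A} (hx : D x = 1)
    (ha : D^[p - 1] a = 0) : D (antideriv p D x a) = a := by
  let T : ℕ → A := fun m => algebraMap k A (m.factorial : k)⁻¹ * x ^ m * D^[m] a
  have h1 : ∀ m < p - 1, D (algebraMap k A ((m + 1).factorial : k)⁻¹ * x ^ (m + 1) * D^[m] a)
      = T m + T (m + 1) := fun m hm => by
    have h3 : (algebraMap k A) ((m + 1).factorial : k)⁻¹ * (m + 1 : ℕ)
        = algebraMap k A (m.factorial : k)⁻¹ := by
      have h2 : ((m + 1 : ℕ) : k) ≠ 0 := by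
        rw [Ne, CharP.cast_eq_zero_iff k p]
        exact Nat.not_dvd_of_pos_of_lt m.succ_pos (by omega)
      rw [← map_natCast (algebraMap k A), ← map_mul, Nat.factorial_succ, Nat.cast_mul, mul_inv,
        mul_comm, ← mul_assoc, mul_inv_cancel₀ h2, one_mul]
    simp only [T]
    rw [Derivation.leibniz, Derivation.leibniz, Derivation.leibniz_pow, hx,
      Derivation.map_algebraMap, ← h3, Function.iterate_succ_apply', Nat.add_sub_cancel]
    simp only [smul_eq_mul, nsmul_eq_mul]
    ring
  -- The alternating sum telescopes.
  have h2 : ∀ n ≤ p - 1, ∑ m ∈ Finset.range n, (-1) ^ m * (T m + T (m + 1))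
      = T 0 - (-1) ^ n * T n := fun n hn => by
    induction n with
    | zero => simp
    | succ n ih => rw [Finset.sum_range_succ, ih (by omega)]; ring
  have h3 : T (p - 1) = 0 := by simp only [T]; rw [ha, mul_zero]
  have h4 : T 0 = a := by simp [T]
  have h5 := h2 _ le_rfl
  rw [h3, h4, mul_zero, sub_zero] at h5
  rw [antideriv, map_sum, ← h5]
  refine Finset.sum_congr rfl fun m hm => ?_
  rw [← h1 m (Finset.mem_range.mp hm), Derivation.leibniz,
    show D ((-1 : A) ^ m) = 0 by
      rw [Derivation.leibniz_pow, map_neg, Derivation.map_one_eq_zero]; simp]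
  rw [h5]; simp

theorem antideriv_zero (D : Derivation k A A) (x : A) : antideriv p D x 0 = 0 := by
  rw [antideriv]
  exact Finset.sum_eq_zero fun m _ => by rw [iterate_map_zero', mul_zero, mul_zero]

theorem apply_antideriv {D E : Derivation k A A} (h : ∀ a, E (D a) = D (E a)) {x : A}
    (hx : E x = 0) (a : A) : E (antideriv p D x a) = antideriv p D x (E a) := by
  have h1 : ∀ m, E (D^[m] a) = D^[m] (E a) := fun m => by
    induction m with
    | zero => rfl
    | succ m ih => rw [Function.iterate_succ_apply', h, ih, Function.iterate_succ_apply']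
  rw [antideriv, map_sum, antideriv]
  refine Finset.sum_congr rfl fun m _ => ?_
  rw [Derivation.leibniz, Derivation.leibniz, Derivation.leibniz, h1, Derivation.map_algebraMap,
    Derivation.leibniz_pow, hx, Derivation.leibniz_pow, map_neg, Derivation.map_one_eq_zero]
  simp

theorem iterate_antideriv {D E : Derivation k A A} (h : ∀ a, E (D a) = D (E a)) {x : A}
    (hx : E x = 0) (a : A) (n : ℕ) : E^[n] (antideriv p D x a) = antideriv p D x (E^[n] a) := by
  induction n with
  | zero => rfl
  | succ n ih =>
    rw [Function.iterate_succ_apply', ih, apply_antideriv h hx, Function.iterate_succ_apply']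

variable [hp : Fact p.Prime] [CharP k p] {n : ℕ} {x : Fin n → A} {d : Fin n → Derivation k A A}

/-- A closed `1`-form `∑ aᵢ dxᵢ` with `∂ᵢ ^ (p - 1) aᵢ = 0` is exact. -/
theorem exists_primitive (hx : ∀ i j, d i (x j) = if i = j then 1 else 0)
    (hcomm : ∀ i j a, d i (d j a) = d j (d i a)) (hpow : ∀ i a, (d i)^[p] a = 0)
    (a : Fin n → A) (hclosed : ∀ i j, d i (a j) = d j (a i)) (ha : ∀ i, (d i)^[p - 1] (a i) = 0) :
    ∃ f, ∀ i, d i f = a i := by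
  -- The partial derivatives are prescribed one after the other; the correction of `f` in step `m`
  -- is killed by `∂ᵢ` for `i < m`.
  suffices h : ∀ m, m ≤ n → ∃ f, ∀ i : Fin n, i.1 < m → d i f = a i by
    obtain ⟨f, hf⟩ := h n le_rfl
    exact ⟨f, fun i => hf i i.2⟩
  intro m
  induction m with
  | zero => exact fun _ => ⟨0, fun i hi => absurd hi (Nat.not_lt_zero _)⟩
  | succ m ih =>
    intro hm
    obtain ⟨f, hf⟩ := ih (by omega)
    let m' : Fin n := ⟨m, hm⟩
    refine ⟨f + antideriv p (d m') (x m') (a m' - d m' f), fun i hi => ?_⟩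
    rcases Nat.lt_succ_iff_lt_or_eq.mp hi with h | h
    · have him : i ≠ m' := fun h' => by rw [h'] at h; exact lt_irrefl _ h
      rw [map_add, hf i h, apply_antideriv (hcomm i m') (by rw [hx, if_neg him]), map_sub,
        hclosed i m', hcomm i m', hf i h, sub_self, antideriv_zero, add_zero]
    · obtain rfl : i = m' := Fin.ext h
      rw [map_add, derivation_antideriv _ (by rw [hx, if_pos rfl]), add_sub_cancel]
      rw [iterate_map_sub, ha, ← Function.iterate_succ_apply, Nat.succ_eq_add_one,
        Nat.sub_add_cancel hp.out.one_le, hpow, sub_zero]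

/-- A closed `2`-form with components `Fᵢⱼ` such that `∂ᵢ ^ (p - 1) Fᵢⱼ = 0` is exact. -/
theorem exists_primitive_two (hx : ∀ i j, d i (x j) = if i = j then 1 else 0)
    (hcomm : ∀ i j a, d i (d j a) = d j (d i a)) (hpow : ∀ i a, (d i)^[p] a = 0)
    (F : Fin n → Fin n → A) (hself : ∀ i, F i i = 0) (hskew : ∀ i j, F i j = -F j i)
    (hclosed : ∀ i j l, d i (F j l) + d j (F l i) + d l (F i j) = 0)
    (hF : ∀ i j, (d i)^[p - 1] (F i j) = 0) :
    ∃ g : Fin n → A, ∀ i j, F i j = d i (g j) - d j (g i) := by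
  -- The components `Fᵢⱼ` with `i < m` are matched one row after the other. The second condition
  -- ensures that the remaining form `F - dg` satisfies `∂ᵢ ^ (p - 1) (F - dg)ᵢⱼ = 0` again.
  suffices h : ∀ m, m ≤ n → ∃ g : Fin n → A,
      (∀ i j : Fin n, i.1 < m → F i j = d i (g j) - d j (g i)) ∧
      ∀ i j, (d i)^[p - 1] (d j (g i)) = 0 by
    obtain ⟨g, hg, -⟩ := h n le_rfl
    exact ⟨g, fun i j => hg i j i.2⟩
  intro m
  induction m with
  | zero =>
    exact fun _ => ⟨0, fun i _ hi => absurd hi (Nat.not_lt_zero _), fun i j => by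
      rw [Pi.zero_apply, map_zero, iterate_map_zero']⟩
  | succ m ih =>
    intro hm
    obtain ⟨g, hg, hg'⟩ := ih (by omega)
    let m' : Fin n := ⟨m, hm⟩
    have hp1 : p - 1 + 1 = p := Nat.sub_add_cancel hp.out.one_le
    -- The remaining form, whose rows of index less than `m` vanish.
    let G : Fin n → Fin n → A := fun i j => F i j - (d i (g j) - d j (g i))
    have Gclosed : ∀ i j l, d i (G j l) + d j (G l i) + d l (G i j) = 0 := fun i j l => by
      have := hclosed i j l
      simp only [G, map_sub]
      rw [hcomm j i, hcomm l j, hcomm i l]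
      linear_combination this
    have Gskew : ∀ i j, G i j = -G j i := fun i j => by
      simp only [G]; rw [hskew i j]; ring
    have Gself : ∀ i, G i i = 0 := fun i => by simp only [G]; rw [hself]; ring
    have Gpow : ∀ i j, (d i)^[p - 1] (G i j) = 0 := fun i j => by
      simp only [G]
      rw [iterate_map_sub, iterate_map_sub, hF, hg', ← Function.iterate_succ_apply,
        Nat.succ_eq_add_one, hp1, hpow]
      simp
    have Glt : ∀ i j : Fin n, i.1 < m → G i j = 0 := fun i j hi => by
      simp only [G]; rw [hg i j hi, sub_self]
    -- Integrating row `m` with respect to `xₘ` does not disturb the preceding rows, as closedness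
    -- of `G` implies that `∂ᵢ Gₘⱼ = 0` for `i < m`.
    let h : Fin n → A := fun j => antideriv p (d m') (x m') (G m' j)
    have hm0 : h m' = 0 := by
      simp only [h]; rw [Gself, antideriv_zero]
    refine ⟨fun j => g j + h j, fun i j hi => ?_, fun i j => ?_⟩
    · suffices hs : G i j = d i (h j) - d j (h i) by
        simp only [map_add]
        simp only [G] at hs
        linear_combination hs
      rcases Nat.lt_succ_iff_lt_or_eq.mp hi with hlt | heq
      · have him : i ≠ m' := fun h' => by rw [h'] at hlt; exact lt_irrefl _ hlt
        have e1 : d i (G m' j) = 0 := by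
          have := Gclosed i m' j
          rwa [Gskew j i, Glt i j hlt, Glt i m' hlt, neg_zero, map_zero, map_zero, add_zero,
            add_zero] at this
        have e2 : h i = 0 := by
          simp only [h]; rw [Gskew, Glt i m' hlt, neg_zero, antideriv_zero]
        rw [Glt i j hlt, e2, map_zero]
        simp only [h]
        rw [apply_antideriv (hcomm i m') (by rw [hx, if_neg him]), e1, antideriv_zero, sub_zero]
      · obtain rfl : i = m' := Fin.ext heq
        rw [hm0, map_zero, sub_zero]
        exact (derivation_antideriv _ (by rw [hx, if_pos rfl]) (Gpow m' j)).symm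
    · rw [map_add, iterate_map_add, hg', zero_add]
      by_cases him : i = m'
      · rw [him, hm0, map_zero, iterate_map_zero']
      · have hji : ∀ r a, (d i)^[r] (d j a) = d j ((d i)^[r] a) := fun r a => by
          induction r with
          | zero => rfl
          | succ r ih => rw [Function.iterate_succ_apply', ih, hcomm,
              Function.iterate_succ_apply']
        rw [hji]
        simp only [h]
        rw [iterate_antideriv (hcomm i m') (by rw [hx, if_neg him]), Gskew, iterate_map_neg,
          Gpow, neg_zero, antideriv_zero, map_zero]

end Poincare

/-! ### Coordinates -/

section Coordinates

/-- Coordinates on a `k`-algebra `A`: functions `xᵢ` and derivations `∂ᵢ` with `∂ᵢ xⱼ = δᵢⱼ` and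
`da = ∑ᵢ ∂ᵢ(a) dxᵢ`. -/
structure Coordinates (k : Type u) [Field k] (A : Type u) [CommRing A] [Algebra k A] (n : ℕ) where
  /-- The coordinate functions. -/
  x : Fin n → A
  /-- The partial derivatives. -/
  d : Fin n → Derivation k A A
  d_x : ∀ i j, d i (x j) = if i = j then 1 else 0
  D_eq : ∀ a, KaehlerDifferential.D k A a = ∑ i, d i a • KaehlerDifferential.D k A (x i)

variable {p : ℕ} [hp : Fact p.Prime] {k : Type u} [Field k]
  {A : Type u} [CommRing A] [Algebra k A]

theorem derivation_relFrob_eq_zero [CharP k p] {M : Type*} [AddCommGroup M] [Module A M]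
    [Module k M] [IsScalarTower k A M] (D : Derivation k A M) (t : Twist p k A) :
    D (relFrob p k A t) = 0 := by
  induction t using TensorProduct.induction_on with
  | zero => simp
  | add s t hs ht => rw [map_add, map_add, hs, ht, add_zero]
  | tmul c a =>
    refine (congrArg D (relFrob_tmul p k A c a)).trans ?_
    change D (algebraMap k A (show k from c) * a ^ p) = 0
    rw [Derivation.leibniz, Derivation.map_algebraMap, Derivation.leibniz_pow,
      ← Nat.cast_smul_eq_nsmul A, natCast_eq_zero_of_algebra k p A]
    simp

namespace Coordinates

variable {n : ℕ} (X : Coordinates k A n)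
include X

theorem derivation_apply {M : Type*} [AddCommGroup M] [Module A M] [Module k M]
    [IsScalarTower k A M] (D : Derivation k A M) (a : A) : D a = ∑ i, X.d i a • D (X.x i) := by
  have := congrArg D.liftKaehlerDifferential (X.D_eq a)
  simpa [map_sum] using this

theorem derivation_ext {M : Type*} [AddCommGroup M] [Module A M] [Module k M]
    [IsScalarTower k A M] {D E : Derivation k A M} (h : ∀ i, D (X.x i) = E (X.x i)) : D = E := by
  refine Derivation.ext fun a => ?_
  rw [X.derivation_apply, X.derivation_apply E]
  exact Finset.sum_congr rfl fun i _ => by rw [h]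

theorem d_comm (i j : Fin n) (a : A) : X.d i (X.d j a) = X.d j (X.d i a) := by
  have : ⁅X.d i, X.d j⁆ = 0 := X.derivation_ext fun l => by
    rw [Derivation.commutator_apply, X.d_x, X.d_x]
    split_ifs <;> simp
  rw [← sub_eq_zero, ← Derivation.commutator_apply, this, Derivation.zero_apply]

theorem d_iterate_prime [CharP k p] (i : Fin n) (a : A) : (X.d i)^[p] a = 0 := by
  have : powDerivation p (X.d i) = 0 := X.derivation_ext fun l => by
    obtain ⟨q, hq⟩ : ∃ q, p = q + 1 + 1 := ⟨p - 2, by have := hp.out.two_le; omega⟩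
    rw [powDerivation_apply, Derivation.zero_apply]
    have h0 : X.d i (X.d i (X.x l)) = 0 := by
      rw [X.d_x]; split_ifs <;> simp
    rw [hq, Function.iterate_succ_apply, Function.iterate_succ_apply, h0, iterate_map_zero']
  rw [← powDerivation_apply, this, Derivation.zero_apply]

theorem form_eq (ω : Ω[A⁄k]) :
    ω = ∑ i, (X.d i).liftKaehlerDifferential ω • KaehlerDifferential.D k A (X.x i) := by
  have hω : ω ∈ Submodule.span A (Set.range (KaehlerDifferential.D k A)) := by
    rw [KaehlerDifferential.span_range_derivation]; trivial
  induction hω using Submodule.span_induction with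
  | mem y hy =>
    obtain ⟨a, rfl⟩ := hy
    simpa using X.D_eq a
  | zero => simp
  | add y z _ _ hy hz =>
    conv_lhs => rw [hy, hz]
    rw [← Finset.sum_add_distrib]
    exact Finset.sum_congr rfl fun i _ => by rw [map_add, add_smul]
  | smul a y _ hy =>
    conv_lhs => rw [hy]
    rw [Finset.smul_sum]
    exact Finset.sum_congr rfl fun i _ => by rw [map_smul, smul_smul, smul_eq_mul]

theorem form_ext {ω η : Ω[A⁄k]}
    (h : ∀ i, (X.d i).liftKaehlerDifferential ω = (X.d i).liftKaehlerDifferential η) : ω = η := by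
  rw [X.form_eq ω, X.form_eq η]
  exact Finset.sum_congr rfl fun i _ => by rw [h]

theorem lift_sum (i : Fin n) (a : Fin n → A) :
    (X.d i).liftKaehlerDifferential (∑ j, a j • KaehlerDifferential.D k A (X.x j)) = a i := by
  simp [map_sum, X.d_x]

/-- The basis `dxᵢ` of the module of differentials. -/
def basis : Module.Basis (Fin n) A Ω[A⁄k] :=
  .ofEquivFun
    { toFun := fun ω i => (X.d i).liftKaehlerDifferential ω
      invFun := fun a => ∑ i, a i • KaehlerDifferential.D k A (X.x i)
      map_add' := fun ω η => by ext i; simp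
      map_smul' := fun a ω => by ext i; simp
      left_inv := fun ω => (X.form_eq ω).symm
      right_inv := fun a => by ext i; exact X.lift_sum i a }

theorem basis_apply (i : Fin n) : X.basis i = KaehlerDifferential.D k A (X.x i) := by
  rw [basis, Module.Basis.coe_ofEquivFun]
  change ∑ j, (Pi.single i (1 : A) : Fin n → A) j • KaehlerDifferential.D k A (X.x j) = _
  simp [Pi.single_apply, ite_smul]

end Coordinates

/-- Functions whose differentials form a basis of the module of differentials are coordinates. -/
def Coordinates.ofBasis {n : ℕ} (x : Fin n → A) (b : Module.Basis (Fin n) A Ω[A⁄k])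
    (hb : ∀ i, b i = KaehlerDifferential.D k A (x i)) : Coordinates k A n where
  x := x
  d i := (b.coord i).compDer (KaehlerDifferential.D k A)
  d_x i j := by
    change b.repr (KaehlerDifferential.D k A (x j)) i = _
    rw [← hb, b.repr_self, Finsupp.single_apply]
    simp only [eq_comm]
  D_eq a := by
    conv_lhs => rw [← b.sum_repr (KaehlerDifferential.D k A a)]
    exact Finset.sum_congr rfl fun i _ => by rw [hb]; rfl

/-- Coordinates on `A` induce coordinates on every formally étale `A`-algebra. -/
def Coordinates.etale {n : ℕ} (X : Coordinates k A n) (B : Type u) [CommRing B] [Algebra k B]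
    [Algebra A B] [IsScalarTower k A B] [Algebra.FormallyEtale A B] : Coordinates k B n :=
  .ofBasis (fun i => algebraMap A B (X.x i))
    ((X.basis.baseChange B).map (KaehlerDifferential.tensorKaehlerEquivOfFormallyEtale k A B))
    fun i => by
      rw [Module.Basis.map_apply, Module.Basis.baseChange_apply, X.basis_apply,
        KaehlerDifferential.tensorKaehlerEquivOfFormallyEtale_apply,
        KaehlerDifferential.mapBaseChange_tmul, one_smul, KaehlerDifferential.map_D]

theorem Coordinates.exists_of_isStandardSmooth [Algebra.IsStandardSmooth k A] :
    ∃ n, Nonempty (Coordinates k A n) := by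
  cases subsingleton_or_nontrivial A
  · exact ⟨0, ⟨.ofBasis (fun i => i.elim0)
      (have : Subsingleton Ω[A⁄k] := Module.subsingleton A _; Module.Basis.empty _)
      fun i => i.elim0⟩⟩
  · obtain ⟨-, I, b, hb⟩ := Algebra.IsStandardSmooth.iff_exists_basis_kaehlerDifferential.mp
      (‹_› : Algebra.IsStandardSmooth k A)
    have : Finite I := Module.Finite.finite_basis b
    have := Fintype.ofFinite I
    choose x hx using fun i : I => hb ⟨i, rfl⟩
    let e := Fintype.equivFin I
    exact ⟨Fintype.card I, ⟨.ofBasis (fun i => x (e.symm i)) (b.reindex e) fun i => by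
      rw [Module.Basis.reindex_apply, hx]⟩⟩

end Coordinates

/-! ### The relative Frobenius of an algebra with coordinates -/

section RelFrob

/-- An étale algebra over a domain embeds, by flatness, into an étale algebra over its fraction
field. -/
theorem isReduced_of_etale_isDomain (P B : Type*) [CommRing P] [IsDomain P] [CommRing B]
    [Algebra P B] [Algebra.Etale P B] : IsReduced B := by
  let K := FractionRing P
  have h1 : IsReduced (K ⊗[P] B) := Algebra.FormallyUnramified.isReduced_of_field K (K ⊗[P] B)
  have h2 : Function.Injective (Algebra.TensorProduct.includeRight : B →ₐ[P] K ⊗[P] B) :=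
    Algebra.TensorProduct.includeRight_injective (IsFractionRing.injective P K)
  exact isReduced_of_injective (Algebra.TensorProduct.includeRight : B →ₐ[P] K ⊗[P] B) h2

theorem isReduced_of_isStandardSmooth (K B : Type*) [Field K] [CommRing B] [Algebra K B]
    [Algebra.IsStandardSmooth K B] : IsReduced B := by
  obtain ⟨n, g, -, hg⟩ := RingHom.IsStandardSmooth.exists_etale_mvPolynomial
    (f := algebraMap K B) (by rw [RingHom.isStandardSmooth_algebraMap]; infer_instance)
  let _ : Algebra (MvPolynomial (Fin n) K) B := g.toAlgebra
  have : Algebra.Etale (MvPolynomial (Fin n) K) B := hg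
  exact isReduced_of_etale_isDomain (MvPolynomial (Fin n) K) B

variable {p : ℕ} [hp : Fact p.Prime] {k : Type u} [Field k] [CharP k p]
  {A : Type u} [CommRing A] [Algebra k A]

instance : Field (Frob p k k) := inferInstanceAs (Field k)

/-- The composition `A' → A → A'` of the relative Frobenius with `a ↦ 1 ⊗ a` is the `p`-th power
map. -/
theorem one_tmul_relFrob (t : Twist p k A) : (1 ⊗ₜ[k] relFrob p k A t : Twist p k A) = t ^ p := by
  have h0 : (p : Twist p k A) = 0 := natCast_eq_zero_of_algebra k p _
  induction t using TensorProduct.induction_on with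
  | zero => simp [hp.out.ne_zero]
  | add s t hs ht =>
    rw [map_add, TensorProduct.tmul_add, hs, ht, commute_add_pow_prime h0 (Commute.all s t)]
  | tmul c a =>
    rw [Algebra.TensorProduct.tmul_pow, show relFrob p k A (c ⊗ₜ[k] a)
      = (show k from c) • a ^ p from (relFrob_tmul p k A c a).trans (Algebra.smul_def _ _).symm,
      ← TensorProduct.smul_tmul]
    congr 1
    change algebraMap k (Frob p k k) c * 1 = _
    rw [mul_one]
    rfl

namespace Coordinates

variable {n : ℕ} (X : Coordinates k A n)
include X

/-- The relative Frobenius is injective since the twist is reduced: by `one_tmul_relFrob` the `p`-th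
power of an element of the kernel is `0`. -/
theorem relFrob_injective [Algebra.Smooth k A] : Function.Injective (relFrob p k A) := by
  have : Algebra.IsStandardSmooth k A := .of_basis_kaehlerDifferential X.basis (by
    rintro _ ⟨i, rfl⟩
    exact ⟨X.x i, (X.basis_apply i).symm⟩)
  have : IsReduced (Twist p k A) := isReduced_of_isStandardSmooth (Frob p k k) (Twist p k A)
  rw [injective_iff_map_eq_zero]
  intro t ht
  have h := one_tmul_relFrob (p := p) t
  rw [ht, TensorProduct.tmul_zero] at h
  exact eq_zero_of_pow_eq_zero h.symm

/-- The subalgebra generated by the image of the relative Frobenius and by the coordinates `xᵢ`,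
`i < m`. -/
def frobAdjoin (p : ℕ) [Fact p.Prime] [CharP k p] (m : ℕ) : Subalgebra k A :=
  Algebra.adjoin k (Set.range (relFrob p k A) ∪ X.x '' {i | i.1 < m})

theorem relFrob_mem_frobAdjoin (m : ℕ) (t : Twist p k A) :
    relFrob p k A t ∈ X.frobAdjoin p m :=
  Algebra.subset_adjoin (.inl ⟨t, rfl⟩)

theorem pow_mem_frobAdjoin (m : ℕ) (a : A) : a ^ p ∈ X.frobAdjoin p m := by
  have := X.relFrob_mem_frobAdjoin (p := p) m ((1 : Frob p k k) ⊗ₜ a)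
  rwa [show relFrob p k A ((1 : Frob p k k) ⊗ₜ a) = a ^ p by
    refine (relFrob_tmul p k A 1 a).trans ?_
    rw [map_one, one_mul]] at this

/-- An algebra with coordinates is generated by the coordinates over the image of the relative
Frobenius: it is unramified and purely inseparable over the subalgebra so generated. -/
theorem frobAdjoin_eq_top [Algebra.FiniteType k A] : X.frobAdjoin p n = ⊤ := by
  let C := X.frobAdjoin p n
  have hx : ∀ i, KaehlerDifferential.D C A (X.x i) = 0 := fun i =>
    (KaehlerDifferential.D C A).map_algebraMap
      (⟨X.x i, Algebra.subset_adjoin (.inr ⟨i, i.2, rfl⟩)⟩ : C)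
  have hD : ∀ a, KaehlerDifferential.D C A a = 0 := fun a => by
    have := X.derivation_apply ((KaehlerDifferential.D C A).restrictScalars k) a
    refine this.trans (Finset.sum_eq_zero fun i _ => ?_)
    change X.d i a • KaehlerDifferential.D C A (X.x i) = 0
    rw [hx, smul_zero]
  have h1 : Subsingleton Ω[A⁄C] := by
    rw [← Submodule.subsingleton_iff A, ← subsingleton_iff_bot_eq_top,
      ← KaehlerDifferential.span_range_derivation, eq_comm, Submodule.span_eq_bot]
    rintro _ ⟨a, rfl⟩
    exact hD a
  have h2 : Algebra.FiniteType C A := Algebra.FiniteType.of_restrictScalars_finiteType k C A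
  have h3 : Algebra.IsIntegral C A := ⟨fun a =>
    IsIntegral.of_pow hp.out.pos
      (isIntegral_algebraMap (x := (⟨a ^ p, X.pow_mem_frobAdjoin n a⟩ : C)))⟩
  have h4 : Module.Finite C A := Algebra.IsIntegral.finite
  -- The kernel of `A ⊗ A → A` is generated by an idempotent, as `Ω = 0`, and it is nil, as `a ^ p`
  -- lies in `C`; hence it is zero.
  have h5 : ∀ a : A, 1 ⊗ₜ[C] a = a ⊗ₜ[C] 1 := by
    obtain ⟨e, he, hI⟩ := (Ideal.isIdempotentElem_iff_of_fg _ (KaehlerDifferential.ideal_fg C A)).mp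
      ((Ideal.cotangent_subsingleton_iff _).mp (inferInstanceAs (Subsingleton Ω[A⁄C])))
    have h0 : (p : A ⊗[C] A) = 0 := natCast_eq_zero_of_algebra k p _
    have hnil : ∀ a : A, IsNilpotent ((1 : A) ⊗ₜ[C] a - a ⊗ₜ[C] 1) := fun a => ⟨p, by
      rw [commute_sub_pow_prime h0 (Commute.all _ _), Algebra.TensorProduct.tmul_pow,
        Algebra.TensorProduct.tmul_pow, one_pow, sub_eq_zero]
      have : a ^ p = (⟨a ^ p, X.pow_mem_frobAdjoin n a⟩ : C) • (1 : A) := by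
        rw [Algebra.smul_def, mul_one]; rfl
      rw [this, ← TensorProduct.smul_tmul]⟩
    have hle : KaehlerDifferential.ideal C A ≤ nilradical (A ⊗[C] A) := by
      rw [← KaehlerDifferential.span_range_eq_ideal, Ideal.span_le]
      rintro _ ⟨a, rfl⟩
      exact hnil a
    have he0 : e = 0 := by
      have : e ∈ nilradical (A ⊗[C] A) := hle (by rw [hI]; exact Ideal.mem_span_singleton_self e)
      obtain ⟨m, hm⟩ := this
      rcases Nat.eq_zero_or_pos m with rfl | hm0
      · rw [pow_zero] at hm
        rw [← mul_one e, hm, mul_zero]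
      · rw [← he.pow_eq hm0.ne', hm]
    intro a
    have : (1 : A) ⊗ₜ[C] a - a ⊗ₜ[C] 1 ∈ KaehlerDifferential.ideal C A :=
      KaehlerDifferential.one_smul_sub_smul_one_mem_ideal C a
    rw [hI, he0] at this
    simpa [sub_eq_zero] using this
  -- A finite epimorphism is surjective.
  have h6 := Algebra.isEpi_iff_surjective_algebraMap_of_finite.mp
    ((Algebra.isEpi_iff_forall_one_tmul_eq C A).mpr h5)
  rw [eq_top_iff]
  intro a _
  obtain ⟨c, rfl⟩ := h6 a
  exact c.2

theorem d_eq_zero_of_mem_frobAdjoin {i : Fin n} {a : A} (ha : a ∈ X.frobAdjoin p i) :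
    X.d i a = 0 := by
  refine Algebra.adjoin_induction (p := fun a _ => X.d i a = 0) ?_ ?_ ?_ ?_ ha
  · rintro _ (⟨t, rfl⟩ | ⟨j, hj, rfl⟩)
    · exact derivation_relFrob_eq_zero _ t
    · rw [X.d_x, if_neg]
      rintro rfl
      exact lt_irrefl i.1 hj
  · exact fun c => Derivation.map_algebraMap _ c
  · intro a b _ _ ha hb
    rw [map_add, ha, hb, add_zero]
  · intro a b _ _ ha hb
    rw [Derivation.leibniz, ha, hb, smul_zero, smul_zero, add_zero]

/-- The partial derivative `∂ᵢ` as a derivation over a subalgebra of its constants. -/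
def dOver {C : Subalgebra k A} {i : Fin n} (hC : ∀ c ∈ C, X.d i c = 0) : Derivation C A A :=
  Derivation.mk'
    { toFun := X.d i
      map_add' := map_add _
      map_smul' := fun c a => by
        rw [Algebra.smul_def, Derivation.leibniz]
        change c.1 • X.d i a + a • X.d i c.1 = c.1 • X.d i a
        rw [hC c.1 c.2, smul_zero, add_zero] }
    (X.d i).leibniz

open Polynomial in
theorem d_aeval {C : Subalgebra k A} {i : Fin n} (hC : ∀ c ∈ C, X.d i c = 0) (q : C[X]) :
    X.d i (aeval (X.x i) q) = aeval (X.x i) (derivative q) := by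
  refine ((X.dOver hC).map_aeval q (X.x i)).trans ?_
  change _ • X.d i (X.x i) = _
  rw [X.d_x, if_pos rfl, smul_eq_mul, mul_one]

omit hp X in
open Polynomial in
theorem eq_C_of_derivative_eq_zero {C : Subalgebra k A} {q : C[X]} (hq : q.natDegree < p)
    (h : derivative q = 0) : q = Polynomial.C (q.coeff 0) := by
  refine eq_C_of_natDegree_eq_zero ?_
  by_contra h0
  have h1 := congrArg (fun r => r.coeff (q.natDegree - 1)) h
  simp only [coeff_derivative, coeff_zero] at h1
  rw [← Nat.cast_add_one, Nat.sub_add_cancel (Nat.pos_of_ne_zero h0)] at h1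
  have h2 : (q.natDegree : k) ≠ 0 := by
    rw [Ne, CharP.cast_eq_zero_iff k p]
    exact Nat.not_dvd_of_pos_of_lt (Nat.pos_of_ne_zero h0) hq
  have h3 : IsUnit (q.natDegree : C) := by
    rw [← map_natCast (algebraMap k C)]
    exact (isUnit_iff_ne_zero.mpr h2).map _
  have h4 : q = 0 := leadingCoeff_eq_zero.mp (h3.mul_left_eq_zero.mp h1)
  exact h0 (by rw [h4, natDegree_zero])

omit hp in
open Polynomial in
/-- Over the constants of `∂ᵢ`, the powers `xᵢ ^ m` with `m < p` are linearly independent. -/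
theorem eq_zero_of_aeval_x {C : Subalgebra k A} {i : Fin n} (hC : ∀ c ∈ C, X.d i c = 0) {q : C[X]}
    (hq : q.natDegree < p) (h0 : aeval (X.x i) q = 0) : q = 0 := by
  induction hm : q.natDegree using Nat.strong_induction_on generalizing q with
  | _ m ih =>
    have h1 : derivative q = 0 := by
      by_cases hq0 : q.natDegree = 0
      · exact derivative_of_natDegree_zero hq0
      · exact ih _ (hm ▸ natDegree_derivative_lt hq0)
          ((natDegree_derivative_lt hq0).trans hq) (by rw [← X.d_aeval hC, h0, map_zero]) rfl
    have h2 := eq_C_of_derivative_eq_zero hq h1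
    rw [h2, aeval_C] at h0
    rw [h2, Subtype.val_injective (h0.trans C.coe_zero.symm), map_zero]

open Polynomial in
/-- An element of `C[xᵢ]`, where `C` consists of constants of `∂ᵢ` and contains `xᵢ ^ p`, is a
polynomial in `xᵢ` of degree less than `p`; if `∂ᵢ` kills it, that polynomial is constant. -/
theorem mem_frobAdjoin_of_d_eq_zero {i : Fin n} {a : A} (ha : a ∈ X.frobAdjoin p (i + 1))
    (h : X.d i a = 0) : a ∈ X.frobAdjoin p i := by
  have hC : ∀ c ∈ X.frobAdjoin p i, X.d i c = 0 := fun c hc => X.d_eq_zero_of_mem_frobAdjoin hc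
  have h1 : X.frobAdjoin p (i + 1)
      = (Algebra.adjoin (X.frobAdjoin p i) {X.x i}).restrictScalars k := by
    rw [frobAdjoin, frobAdjoin, ← Algebra.adjoin_union_eq_adjoin_adjoin, Set.union_assoc,
      Set.union_singleton, ← Set.image_insert_eq]
    congr 3
    ext j
    simp only [Set.mem_ofPred_eq, Set.mem_insert_iff, Fin.ext_iff]
    omega
  rw [h1] at ha
  have ha' : a ∈ Algebra.adjoin (X.frobAdjoin p i) {X.x i} := ha
  rw [Algebra.adjoin_singleton_eq_range_aeval] at ha'
  obtain ⟨q₀, rfl⟩ := ha'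
  let b : X.frobAdjoin p i := ⟨X.x i ^ p, X.pow_mem_frobAdjoin i _⟩
  have hmonic : (Polynomial.X ^ p - Polynomial.C b).Monic :=
    monic_X_pow_sub_C b hp.out.ne_zero
  have hroot : aeval (X.x i) (Polynomial.X ^ p - Polynomial.C b) = 0 := by
    rw [map_sub, map_pow, aeval_X, aeval_C]
    exact sub_self _
  have hdeg : (q₀ %ₘ (Polynomial.X ^ p - Polynomial.C b)).natDegree < p := by
    cases subsingleton_or_nontrivial (X.frobAdjoin p i)
    · rw [Subsingleton.elim (q₀ %ₘ _) 0, natDegree_zero]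
      exact hp.out.pos
    · have hd : (Polynomial.X ^ p - Polynomial.C b).natDegree = p := natDegree_X_pow_sub_C
      conv_rhs => rw [← hd]
      refine natDegree_modByMonic_lt _ hmonic fun h1 => ?_
      rw [h1, natDegree_one] at hd
      exact hp.out.ne_zero hd.symm
  have heq : aeval (X.x i) (q₀ %ₘ (Polynomial.X ^ p - Polynomial.C b)) = aeval (X.x i) q₀ :=
    aeval_modByMonic_eq_self_of_root hroot
  have hder := X.d_aeval hC (q₀ %ₘ (Polynomial.X ^ p - Polynomial.C b))
  rw [heq] at hder
  have h2 := eq_C_of_derivative_eq_zero hdeg (X.eq_zero_of_aeval_x hC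
    (lt_of_le_of_lt (natDegree_derivative_le _) (lt_of_le_of_lt (Nat.sub_le _ _) hdeg))
    (hder.symm.trans h))
  change aeval (X.x i) q₀ ∈ _
  rw [← heq, h2, aeval_C]
  exact Subtype.property _

/-- A function is killed by all derivations only if it comes from the Frobenius twist. -/
theorem exists_relFrob_eq [Algebra.FiniteType k A] {a : A} (h : ∀ i, X.d i a = 0) :
    ∃ t : Twist p k A, relFrob p k A t = a := by
  -- Starting from all of `A`, the coordinates are removed one after the other.
  have h1 : ∀ m ≤ n, a ∈ X.frobAdjoin p (n - m) := fun m hm => by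
    induction m with
    | zero => rw [Nat.sub_zero, X.frobAdjoin_eq_top]; trivial
    | succ m ih =>
      have := ih (by omega)
      rw [show n - m = n - (m + 1) + 1 by omega] at this
      exact X.mem_frobAdjoin_of_d_eq_zero (i := ⟨n - (m + 1), by omega⟩) this (h _)
  have h2 := h1 n le_rfl
  rw [Nat.sub_self] at h2
  refine Algebra.adjoin_induction (p := fun a _ => ∃ t : Twist p k A, relFrob p k A t = a)
    ?_ ?_ ?_ ?_ h2
  · rintro _ (⟨t, rfl⟩ | ⟨j, hj, rfl⟩)
    · exact ⟨t, rfl⟩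
    · exact absurd hj (Nat.not_lt_zero _)
  · exact fun c => ⟨(show Frob p k k from c) ⊗ₜ 1, (relFrob_tmul p k A c 1).trans (by simp)⟩
  · rintro _ _ _ _ ⟨s, rfl⟩ ⟨t, rfl⟩
    exact ⟨s + t, map_add _ _ _⟩
  · rintro _ _ _ _ ⟨s, rfl⟩ ⟨t, rfl⟩
    exact ⟨s * t, map_mul _ _ _⟩

end Coordinates

end RelFrob

/-! ### Closed `1`-forms and the Cartier operator of a smooth algebra -/

section Closed

variable {k : Type u} [Field k] {A : Type u} [CommRing A] [Algebra k A]

theorem kaehler_induction {motive : Ω[A⁄k] → Prop} (ω : Ω[A⁄k])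
    (smul_D : ∀ a b : A, motive (a • KaehlerDifferential.D k A b))
    (add : ∀ ω η, motive ω → motive η → motive (ω + η)) : motive ω := by
  have hω : ω ∈ Submodule.span A (Set.range (KaehlerDifferential.D k A)) := by
    rw [KaehlerDifferential.span_range_derivation]; trivial
  induction hω using Submodule.closure_induction with
  | zero => simpa using smul_D 0 0
  | add x y _ _ hx hy => exact add _ _ hx hy
  | smul_mem a x hx => obtain ⟨b, rfl⟩ := hx; exact smul_D a b

/-- The evaluation of `2`-forms on a pair of vector fields. -/
def evalTwo (x y : Derivation k A A) : ExteriorAlgebra A Ω[A⁄k] →ₗ[A] A :=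
  ExteriorAlgebra.liftAlternating fun i =>
    match i with
    | 2 => (Matrix.detRowAlternating (n := Fin 2) (R := A)).compLinearMap
        (LinearMap.pi ![x.liftKaehlerDifferential, y.liftKaehlerDifferential])
    | _ => 0

theorem evalTwo_ι_mul_ι (x y : Derivation k A A) (ω η : Ω[A⁄k]) :
    evalTwo x y (ExteriorAlgebra.ι A ω * ExteriorAlgebra.ι A η)
      = x.liftKaehlerDifferential ω * y.liftKaehlerDifferential η
        - y.liftKaehlerDifferential ω * x.liftKaehlerDifferential η := by
  have : ExteriorAlgebra.ι A ω * ExteriorAlgebra.ι A η = ExteriorAlgebra.ιMulti A 2 ![ω, η] := by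
    simp [ExteriorAlgebra.ιMulti_apply]
  rw [this, evalTwo, ExteriorAlgebra.liftAlternating_apply_ιMulti]
  change Matrix.det (R := A) (n := Fin 2) (Matrix.of fun i =>
    LinearMap.pi ![x.liftKaehlerDifferential, y.liftKaehlerDifferential] (![ω, η] i)) = _
  rw [Matrix.det_fin_two]
  simp

/-- Cartan's formula `dω(x, y) = x(ω(y)) - y(ω(x)) - ω([x, y])`. -/
theorem evalTwo_extDeriv (x y : Derivation k A A) (ω : Ω[A⁄k]) :
    evalTwo x y (extDeriv k A ω)
      = x (y.liftKaehlerDifferential ω) - y (x.liftKaehlerDifferential ω)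
        - ⁅x, y⁆.liftKaehlerDifferential ω := by
  induction ω using kaehler_induction with
  | smul_D a b =>
    rw [extDeriv_smul_D, evalTwo_ι_mul_ι]
    simp only [map_smul, Derivation.liftKaehlerDifferential_comp_D, smul_eq_mul,
      Derivation.leibniz, Derivation.commutator_apply]
    ring
  | add ω η hω hη => simp only [map_add, hω, hη]; ring

theorem closed_lie {ω : Ω[A⁄k]} (h : ω ∈ closedForms k A) (x y : Derivation k A A) :
    ⁅x, y⁆.liftKaehlerDifferential ω
      = x (y.liftKaehlerDifferential ω) - y (x.liftKaehlerDifferential ω) := by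
  have h1 := evalTwo_extDeriv x y ω
  rw [show extDeriv k A ω = 0 from h, map_zero] at h1
  exact (sub_eq_zero.mp h1.symm).symm

theorem D_mem_closedForms (a : A) : KaehlerDifferential.D k A a ∈ closedForms k A := by
  have := extDeriv_smul_D k A 1 a
  rw [one_smul, Derivation.map_one_eq_zero, map_zero, zero_mul] at this
  exact this

/-- A form `∑ⱼ aⱼ dxⱼ` with `∂ᵢ aⱼ = ∂ⱼ aᵢ` is closed. -/
theorem Coordinates.mem_closedForms {n : ℕ} (X : Coordinates k A n) {ω : Ω[A⁄k]}
    (h : ∀ i j, X.d i ((X.d j).liftKaehlerDifferential ω)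
      = X.d j ((X.d i).liftKaehlerDifferential ω)) : ω ∈ closedForms k A := by
  let e : Fin n → ExteriorAlgebra A Ω[A⁄k] := fun i =>
    ExteriorAlgebra.ι A (KaehlerDifferential.D k A (X.x i))
  let a : Fin n → A := fun j => (X.d j).liftKaehlerDifferential ω
  have h1 : extDeriv k A ω = ∑ s : Fin n × Fin n, X.d s.1 (a s.2) • (e s.1 * e s.2) := by
    conv_lhs => rw [X.form_eq ω]
    rw [map_sum, Fintype.sum_prod_type_right]
    refine Finset.sum_congr rfl fun j _ => ?_
    rw [extDeriv_smul_D, X.D_eq, map_sum, Finset.sum_mul]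
    exact Finset.sum_congr rfl fun i _ => by rw [map_smul, smul_mul_assoc]
  change extDeriv k A ω = 0
  rw [h1]
  -- The terms of index `(i, j)` and `(j, i)` cancel.
  refine Finset.sum_involution (fun s _ => s.swap) ?_ ?_ (fun _ _ => Finset.mem_univ _)
    (fun s _ => s.swap_swap)
  · rintro ⟨i, j⟩ -
    change X.d i (a j) • (e i * e j) + X.d j (a i) • (e j * e i) = 0
    rw [h i j, ← smul_add, ExteriorAlgebra.ι_add_mul_swap, smul_zero]
  · rintro ⟨i, j⟩ - hne heq
    obtain rfl : j = i := congrArg Prod.fst heq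
    refine hne ?_
    change X.d j (a j) • (e j * e j) = 0
    rw [ExteriorAlgebra.ι_sq_zero, smul_zero]

theorem kaehlerMapAlg_eq_map {B : Type u} [CommRing B] [Algebra k B] [Algebra A B]
    [IsScalarTower k A B] (φ : A →ₐ[k] B) (hφ : ∀ a, φ a = algebraMap A B a) (ω : Ω[A⁄k]) :
    kaehlerMapAlg φ ω = KaehlerDifferential.map k k A B ω := by
  induction ω using kaehler_induction with
  | smul_D a b =>
    rw [kaehlerMapAlg_smul_D, map_smul, KaehlerDifferential.map_D, hφ, hφ, algebraMap_smul]
  | add ω η hω hη => rw [map_add, map_add, hω, hη]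

theorem kaehlerMapAlg_smul {B : Type u} [CommRing B] [Algebra k B] (φ : A →ₐ[k] B) (a : A)
    (ω : Ω[A⁄k]) : kaehlerMapAlg φ (a • ω) = φ a • kaehlerMapAlg φ ω :=
  kaehlerMap_smul _ _ _ a ω

theorem kaehlerMapAlg_D {B : Type u} [CommRing B] [Algebra k B] (φ : A →ₐ[k] B) (a : A) :
    kaehlerMapAlg φ (KaehlerDifferential.D k A a) = KaehlerDifferential.D k B (φ a) :=
  kaehlerMap_D _ _ _ a

/-- Pull-back of forms is compatible with vector fields related by `φ`. -/
theorem lift_kaehlerMapAlg {B : Type u} [CommRing B] [Algebra k B] (φ : A →ₐ[k] B)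
    (x : Derivation k A A) (y : Derivation k B B) (h : ∀ a, y (φ a) = φ (x a)) (ω : Ω[A⁄k]) :
    y.liftKaehlerDifferential (kaehlerMapAlg φ ω) = φ (x.liftKaehlerDifferential ω) := by
  induction ω using kaehler_induction with
  | smul_D a b =>
    rw [kaehlerMapAlg_smul_D, map_smul, map_smul, Derivation.liftKaehlerDifferential_comp_D,
      Derivation.liftKaehlerDifferential_comp_D, smul_eq_mul, smul_eq_mul, map_mul, h]
  | add ω η hω hη => simp only [map_add, hω, hη]

/-- A form that vanishes on a principal open subset is killed by a power of its equation. -/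
theorem exists_pow_smul_eq_zero {B : Type u} [CommRing B] [Algebra k B] [Algebra A B]
    [IsScalarTower k A B] (f : A) [IsLocalization.Away f B] (φ : A →ₐ[k] B)
    (hφ : ∀ a, φ a = algebraMap A B a) {ω : Ω[A⁄k]} (h : kaehlerMapAlg φ ω = 0) :
    ∃ N : ℕ, f ^ N • ω = 0 := by
  rw [kaehlerMapAlg_eq_map φ hφ] at h
  obtain ⟨⟨_, N, rfl⟩, hN⟩ := (IsLocalizedModule.eq_zero_iff (Submonoid.powers f)
    (KaehlerDifferential.map k k A B)).mp h
  exact ⟨N, hN⟩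

end Closed

section TwistForms

variable {p : ℕ} [hp : Fact p.Prime] {k : Type u} [Field k] [CharP k p]
  {A : Type u} [CommRing A] [Algebra k A]

theorem relFrob_one_tmul (a : A) : relFrob p k A (1 ⊗ₜ a) = a ^ p :=
  (relFrob_tmul p k A 1 a).trans (by rw [map_one, one_mul])

theorem twistPairing_add (x : Derivation k A A) (γ δ : TwistForms p k A) :
    twistPairing p x (γ + δ) = twistPairing p x γ + twistPairing p x δ := by
  simp only [twistPairing, map_add]

theorem twistPairing_sub (x : Derivation k A A) (γ δ : TwistForms p k A) :
    twistPairing p x (γ - δ) = twistPairing p x γ - twistPairing p x δ := by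
  simp only [twistPairing, map_sub]

theorem twistPairing_zero (x : Derivation k A A) : twistPairing p x (0 : TwistForms p k A) = 0 := by
  simp only [twistPairing, map_zero]

theorem twistPairing_smul (x : Derivation k A A) (t : Twist p k A) (γ : TwistForms p k A) :
    twistPairing p x (t • γ) = relFrob p k A t * twistPairing p x γ := by
  simp only [twistPairing, map_smul, smul_eq_mul, map_mul]

theorem twistDerivation_tmul (x : Derivation k A A) (c : Frob p k k) (a : A) :
    twistDerivation p x (c ⊗ₜ a) = c ⊗ₜ x a := rfl

theorem twistPairing_D (x : Derivation k A A) (t : Twist p k A) :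
    twistPairing p x (KaehlerDifferential.D (Frob p k k) (Twist p k A) t)
      = relFrob p k A (twistDerivation p x t) := by
  rw [twistPairing, Derivation.liftKaehlerDifferential_comp_D]

theorem twistPairing_D_one_tmul (x : Derivation k A A) (a : A) :
    twistPairing p x (KaehlerDifferential.D (Frob p k k) (Twist p k A) (1 ⊗ₜ a)) = x a ^ p := by
  rw [twistPairing_D, twistDerivation_tmul, relFrob_one_tmul]

/-- Forms on the twist are generated by the `d(1 ⊗ a)`. -/
theorem twistForms_induction {motive : TwistForms p k A → Prop} (γ : TwistForms p k A)
    (smul_D : ∀ (t : Twist p k A) (a : A),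
      motive (t • KaehlerDifferential.D (Frob p k k) (Twist p k A) (1 ⊗ₜ a)))
    (add : ∀ γ δ, motive γ → motive δ → motive (γ + δ)) : motive γ := by
  induction γ using kaehler_induction with
  | smul_D s t =>
    induction t using TensorProduct.induction_on with
    | zero => simpa using smul_D 0 0
    | add t t' ht ht' => rw [map_add, smul_add]; exact add _ _ ht ht'
    | tmul c a =>
      have : (c ⊗ₜ[k] a : Twist p k A) = c • (1 ⊗ₜ a) := by
        rw [TensorProduct.smul_tmul', smul_eq_mul, mul_one]
      rw [this, Derivation.map_smul, ← algebraMap_smul (Twist p k A) c, smul_smul]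
      exact smul_D _ _
  | add γ δ hγ hδ => exact add _ _ hγ hδ

theorem relFrob_twistMap {B : Type u} [CommRing B] [Algebra k B] (φ : A →ₐ[k] B)
    (t : Twist p k A) : relFrob p k B (twistMap p k φ t) = φ (relFrob p k A t) := by
  induction t using TensorProduct.induction_on with
  | zero => simp
  | add s t hs ht => simp only [map_add, hs, ht]
  | tmul c a =>
    refine (relFrob_tmul p k B c (φ a)).trans ?_
    refine Eq.trans ?_ (congrArg φ (relFrob_tmul p k A c a)).symm
    change algebraMap k B (show k from c) * φ a ^ p = φ (algebraMap k A (show k from c) * a ^ p)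
    rw [map_mul, map_pow, AlgHom.commutes]

theorem twistMap_tmul {B : Type u} [CommRing B] [Algebra k B] (φ : A →ₐ[k] B) (c : Frob p k k)
    (a : A) : twistMap p k φ (c ⊗ₜ a) = c ⊗ₜ φ a := rfl

theorem twistPairing_map {B : Type u} [CommRing B] [Algebra k B] (φ : A →ₐ[k] B)
    (x : Derivation k A A) (y : Derivation k B B) (h : ∀ a, y (φ a) = φ (x a))
    (γ : TwistForms p k A) :
    twistPairing p y (kaehlerMapAlg (twistMap p k φ) γ) = φ (twistPairing p x γ) := by
  induction γ using twistForms_induction with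
  | smul_D t a =>
    rw [kaehlerMapAlg_smul_D, twistPairing_smul, twistPairing_smul, twistMap_tmul,
      twistPairing_D_one_tmul, twistPairing_D_one_tmul, relFrob_twistMap, h, map_mul, map_pow]
  | add γ δ hγ hδ => simp only [map_add, twistPairing_add, hγ, hδ]

theorem twistPairing_twistForm (x : Derivation k A A) (ω : Ω[A⁄k]) :
    twistPairing p x (twistForm p k A ω) = (x.liftKaehlerDifferential ω) ^ p := by
  have h0 : (p : A) = 0 := natCast_eq_zero_of_algebra k p A
  induction ω using kaehler_induction with
  | smul_D a b =>
    rw [twistForm_smul_D, twistPairing_smul, twistPairing_D_one_tmul, relFrob_one_tmul, map_smul,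
      Derivation.liftKaehlerDifferential_comp_D, smul_eq_mul, mul_pow]
  | add ω η hω hη =>
    rw [map_add, twistPairing_add, hω, hη, map_add, commute_add_pow_prime h0 (Commute.all _ _)]

theorem twistPairing_add_left (x y : Derivation k A A) (γ : TwistForms p k A) :
    twistPairing p (x + y) γ = twistPairing p x γ + twistPairing p y γ := by
  have h0 : (p : A) = 0 := natCast_eq_zero_of_algebra k p A
  induction γ using twistForms_induction with
  | smul_D t a =>
    simp only [twistPairing_smul, twistPairing_D_one_tmul, Derivation.add_apply]
    rw [commute_add_pow_prime h0 (Commute.all _ _), mul_add]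
  | add γ δ hγ hδ => rw [twistPairing_add, hγ, hδ, twistPairing_add, twistPairing_add]; ring

theorem twistPairing_smul_left (f : A) (x : Derivation k A A) (γ : TwistForms p k A) :
    twistPairing p (f • x) γ = f ^ p * twistPairing p x γ := by
  induction γ using twistForms_induction with
  | smul_D t a =>
    simp only [twistPairing_smul, twistPairing_D_one_tmul, Derivation.smul_apply, smul_eq_mul]
    ring
  | add γ δ hγ hδ => rw [twistPairing_add, hγ, hδ, twistPairing_add]; ring

theorem derivation_twistPairing (x y : Derivation k A A) (γ : TwistForms p k A) :
    x (twistPairing p y γ) = 0 :=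
  derivation_relFrob_eq_zero x _

namespace Coordinates

variable {n : ℕ} (X : Coordinates k A n)

theorem D_one_tmul (a : A) : KaehlerDifferential.D (Frob p k k) (Twist p k A) (1 ⊗ₜ a)
    = ∑ i, (1 ⊗ₜ[k] X.d i a : Twist p k A) •
      KaehlerDifferential.D (Frob p k k) (Twist p k A) (1 ⊗ₜ X.x i) := by
  have := congrArg (twistForm p k A) (X.D_eq a)
  rw [map_sum] at this
  simp only [twistForm_smul_D] at this
  refine Eq.trans ?_ this
  have h1 := twistForm_smul_D p k A 1 a
  rw [one_smul] at h1
  rw [h1]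
  exact (one_smul (Twist p k A) _).symm

theorem exists_twistForm_eq (γ : TwistForms p k A) : ∃ t : Fin n → Twist p k A,
    γ = ∑ i, t i • KaehlerDifferential.D (Frob p k k) (Twist p k A) (1 ⊗ₜ X.x i) := by
  induction γ using twistForms_induction with
  | smul_D t a =>
    refine ⟨fun i => t * (1 ⊗ₜ[k] X.d i a), ?_⟩
    rw [X.D_one_tmul, Finset.smul_sum]
    exact Finset.sum_congr rfl fun i _ => by rw [smul_smul]
  | add γ δ hγ hδ =>
    obtain ⟨s, hs⟩ := hγ
    obtain ⟨t, ht⟩ := hδ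
    refine ⟨s + t, ?_⟩
    rw [hs, ht, ← Finset.sum_add_distrib]
    exact Finset.sum_congr rfl fun i _ => (add_smul _ _ _).symm

theorem twistPairing_sum (i : Fin n) (t : Fin n → Twist p k A) :
    twistPairing p (X.d i)
      (∑ j, t j • KaehlerDifferential.D (Frob p k k) (Twist p k A) (1 ⊗ₜ X.x j))
      = relFrob p k A (t i) := by
  have : ∀ s : Finset (Fin n), twistPairing p (X.d i)
      (∑ j ∈ s, t j • KaehlerDifferential.D (Frob p k k) (Twist p k A) (1 ⊗ₜ X.x j))
      = ∑ j ∈ s, relFrob p k A (t j) * (X.d i (X.x j)) ^ p := fun s => by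
    induction s using Finset.induction_on with
    | empty => simp [twistPairing_zero]
    | insert j s hj ih =>
      rw [Finset.sum_insert hj, Finset.sum_insert hj, twistPairing_add, ih, twistPairing_smul,
        twistPairing_D_one_tmul]
  rw [this, Finset.sum_eq_single i]
  · rw [X.d_x, if_pos rfl, one_pow, mul_one]
  · intro j _ hj
    rw [X.d_x, if_neg hj.symm, zero_pow hp.out.ne_zero, mul_zero]
  · exact fun h => absurd (Finset.mem_univ i) h

/-- Forms on the twist are determined by their values on the coordinate vector fields, because the
relative Frobenius is injective. -/
theorem twistForm_ext [Algebra.Smooth k A] {γ δ : TwistForms p k A}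
    (h : ∀ i, twistPairing p (X.d i) γ = twistPairing p (X.d i) δ) : γ = δ := by
  obtain ⟨s, rfl⟩ := X.exists_twistForm_eq γ
  obtain ⟨t, rfl⟩ := X.exists_twistForm_eq δ
  refine Finset.sum_congr rfl fun i _ => ?_
  have h1 : relFrob p k A (s i) = relFrob p k A (t i) := by
    simpa only [twistPairing_sum] using h i
  rw [X.relFrob_injective (p := p) h1]

end Coordinates

/-- The twist of a localization at `f` is the localization of the twist at `1 ⊗ f`. -/
theorem isLocalization_away_twist {B : Type u} [CommRing B] [Algebra k B] [Algebra A B]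
    [IsScalarTower k A B] (f : A) [IsLocalization.Away f B] (φ : A →ₐ[k] B)
    (hφ : ∀ a, φ a = algebraMap A B a) :
    letI : Algebra (Twist p k A) (Twist p k B) := (twistMap p k φ).toRingHom.toAlgebra
    IsLocalization.Away (1 ⊗ₜ[k] f : Twist p k A) (Twist p k B) := by
  let _ : Algebra (Twist p k A) (Twist p k B) := (twistMap p k φ).toRingHom.toAlgebra
  have _ : IsScalarTower (Frob p k k) (Twist p k A) (Twist p k B) :=
    IsScalarTower.of_algebraMap_eq' (twistMap p k φ).comp_algebraMap.symm
  have h1 := IsLocalization.tensorProduct_tensorProduct_right k (Frob p k k)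
    (Submonoid.powers f) B (RingHom.ext fun a => by
      change (1 ⊗ₜ[k] φ a : Twist p k B) = 1 ⊗ₜ[k] algebraMap A B a
      rw [hφ])
  rw [Submonoid.map_powers] at h1
  exact h1

/-- A form on the twist that vanishes on a principal open subset is killed by a power of its
equation. -/
theorem exists_pow_smul_twistForm_eq_zero {B : Type u} [CommRing B] [Algebra k B] [Algebra A B]
    [IsScalarTower k A B] (f : A) [IsLocalization.Away f B] (φ : A →ₐ[k] B)
    (hφ : ∀ a, φ a = algebraMap A B a) {γ : TwistForms p k A}
    (h : kaehlerMapAlg (twistMap p k φ) γ = 0) :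
    ∃ N : ℕ, (1 ⊗ₜ[k] f : Twist p k A) ^ N • γ = 0 := by
  let _ : Algebra (Twist p k A) (Twist p k B) := (twistMap p k φ).toRingHom.toAlgebra
  have _ : IsScalarTower (Frob p k k) (Twist p k A) (Twist p k B) :=
    IsScalarTower.of_algebraMap_eq' (twistMap p k φ).comp_algebraMap.symm
  have : IsLocalization.Away (1 ⊗ₜ[k] f : Twist p k A) (Twist p k B) :=
    isLocalization_away_twist f φ hφ
  exact exists_pow_smul_eq_zero (1 ⊗ₜ[k] f : Twist p k A) (twistMap p k φ) (fun _ => rfl) h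

end TwistForms

section Cartier

variable (p : ℕ) [hp : Fact p.Prime] (k : Type u) [Field k] [CharP k p]
  (A : Type u) [CommRing A] [Algebra k A]

/-- The graph of the Cartier operator: the pairs `(α, γ)` of a `1`-form on `A` and a `1`-form on its
Frobenius twist generated by the pairs `(dg, 0)` and `(t f ^ (p - 1) df, t df')`. -/
def cartierGraph : AddSubgroup (Ω[A⁄k] × TwistForms p k A) :=
  AddSubgroup.closure
    ({z | ∃ g, z = (KaehlerDifferential.D k A g, 0)} ∪
      {z | ∃ (t : Twist p k A) (f : A),
        z = (relFrob p k A t • f ^ (p - 1) • KaehlerDifferential.D k A f,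
          t • KaehlerDifferential.D (Frob p k k) (Twist p k A) (1 ⊗ₜ f))})

variable {p k A}

theorem D_mem_cartierGraph (g : A) :
    (KaehlerDifferential.D k A g, (0 : TwistForms p k A)) ∈ cartierGraph p k A :=
  AddSubgroup.subset_closure (.inl ⟨g, rfl⟩)

theorem pow_smul_D_mem_cartierGraph (t : Twist p k A) (f : A) :
    (relFrob p k A t • f ^ (p - 1) • KaehlerDifferential.D k A f,
      t • KaehlerDifferential.D (Frob p k k) (Twist p k A) (1 ⊗ₜ f)) ∈ cartierGraph p k A :=
  AddSubgroup.subset_closure (.inr ⟨t, f, rfl⟩)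

theorem cartierGraph_induction
    {motive : ∀ (α : Ω[A⁄k]) (γ : TwistForms p k A), (α, γ) ∈ cartierGraph p k A → Prop}
    {α : Ω[A⁄k]} {γ : TwistForms p k A} (h : (α, γ) ∈ cartierGraph p k A)
    (exact : ∀ g, motive (KaehlerDifferential.D k A g) 0 (D_mem_cartierGraph g))
    (pow : ∀ (t : Twist p k A) (f : A),
      motive (relFrob p k A t • f ^ (p - 1) • KaehlerDifferential.D k A f)
        (t • KaehlerDifferential.D (Frob p k k) (Twist p k A) (1 ⊗ₜ f))
        (pow_smul_D_mem_cartierGraph t f))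
    (add : ∀ α α' γ γ' h h', motive α γ h → motive α' γ' h' →
      motive (α + α') (γ + γ') (add_mem h h'))
    (neg : ∀ α γ h, motive α γ h → motive (-α) (-γ) (neg_mem h)) : motive α γ h := by
  have key : ∀ (z : Ω[A⁄k] × TwistForms p k A) (hz : z ∈ cartierGraph p k A),
      motive z.1 z.2 hz := fun z hz => by
    unfold cartierGraph at hz
    induction hz using AddSubgroup.closure_induction with
    | mem z hz =>
      obtain ⟨g, rfl⟩ | ⟨t, f, rfl⟩ := hz
      exacts [exact g, pow t f]
    | zero =>
      have := exact 0
      simp only [map_zero] at this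
      exact this
    | add x y _ _ hx hy => exact add _ _ _ _ _ _ hx hy
    | neg x _ hx => exact neg _ _ _ hx
  exact key _ h

theorem closed_of_mem_cartierGraph {α : Ω[A⁄k]} {γ : TwistForms p k A}
    (h : (α, γ) ∈ cartierGraph p k A) : α ∈ closedForms k A := by
  induction h using cartierGraph_induction with
  | exact g => exact D_mem_closedForms g
  | pow t f =>
    change extDeriv k A _ = 0
    rw [smul_smul, extDeriv_smul_D, Derivation.leibniz,
      derivation_relFrob_eq_zero (KaehlerDifferential.D k A) t, smul_zero, add_zero,
      Derivation.leibniz_pow, ← Nat.cast_smul_eq_nsmul A, smul_smul, smul_smul, map_smul,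
      smul_mul_assoc, ExteriorAlgebra.ι_sq_zero, smul_zero]
  | add α α' γ γ' _ _ h h' => exact add_mem h h'
  | neg α γ _ h => exact neg_mem h

/-- The Cartier operator `C` satisfies `C(α)(x') = α(x ^ p) - x ^ (p - 1) (α(x))`. -/
theorem twistPairing_of_mem_cartierGraph {α : Ω[A⁄k]} {γ : TwistForms p k A}
    (h : (α, γ) ∈ cartierGraph p k A) (x : Derivation k A A) :
    twistPairing p x γ = (powDerivation p x).liftKaehlerDifferential α
      - x^[p - 1] (x.liftKaehlerDifferential α) := by
  have hx : ∀ a b : A, x^[p - 1] (a + b) = x^[p - 1] a + x^[p - 1] b := fun a b =>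
    iterate_map_add x _ a b
  induction h using cartierGraph_induction with
  | exact g =>
    rw [twistPairing_zero, Derivation.liftKaehlerDifferential_comp_D,
      Derivation.liftKaehlerDifferential_comp_D, powDerivation_apply, ← Function.iterate_succ_apply,
      Nat.succ_eq_add_one, Nat.sub_add_cancel hp.out.one_le, sub_self]
  | pow t f =>
    simp only [map_smul, Derivation.liftKaehlerDifferential_comp_D, smul_eq_mul,
      powDerivation_apply]
    rw [iterate_mul_of_apply_eq_zero x (derivation_relFrob_eq_zero x t), ← iterate_pow_pred_mul,
      twistPairing_smul, twistPairing_D_one_tmul]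
    ring
  | add α α' γ γ' _ _ h h' => rw [twistPairing_add, h, h', map_add, map_add, hx]; ring
  | neg α γ _ h =>
    have := twistPairing_add x γ (-γ)
    rw [add_neg_cancel, twistPairing_zero, h] at this
    rw [map_neg, map_neg, iterate_map_neg]
    linear_combination -this

theorem map_mem_cartierGraph {B : Type u} [CommRing B] [Algebra k B] (φ : A →ₐ[k] B) {α : Ω[A⁄k]}
    {γ : TwistForms p k A} (h : (α, γ) ∈ cartierGraph p k A) :
    (kaehlerMapAlg φ α, kaehlerMapAlg (twistMap p k φ) γ) ∈ cartierGraph p k B := by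
  induction h using cartierGraph_induction with
  | exact g => rw [kaehlerMapAlg_D, map_zero]; exact D_mem_cartierGraph _
  | pow t f =>
    rw [kaehlerMapAlg_smul, kaehlerMapAlg_smul, kaehlerMapAlg_D, kaehlerMapAlg_smul_D,
      ← relFrob_twistMap, map_pow]
    exact pow_smul_D_mem_cartierGraph _ _
  | add α α' γ γ' _ _ h h' => rw [map_add, map_add]; exact add_mem h h'
  | neg α γ _ h => rw [map_neg, map_neg]; exact neg_mem h

theorem smul_mem_cartierGraph (s : Twist p k A) {α : Ω[A⁄k]} {γ : TwistForms p k A}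
    (h : (α, γ) ∈ cartierGraph p k A) :
    (relFrob p k A s • α, s • γ) ∈ cartierGraph p k A := by
  induction h using cartierGraph_induction with
  | exact g =>
    have e : KaehlerDifferential.D k A (relFrob p k A s * g)
        = relFrob p k A s • KaehlerDifferential.D k A g := by
      rw [Derivation.leibniz, derivation_relFrob_eq_zero (KaehlerDifferential.D k A) s, smul_zero,
        add_zero]
    have e' : s • (0 : TwistForms p k A) = 0 := smul_zero s
    rw [e', ← e]
    exact D_mem_cartierGraph _
  | pow t f =>
    have e : relFrob p k A s • relFrob p k A t • f ^ (p - 1) • KaehlerDifferential.D k A f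
        = relFrob p k A (s * t) • f ^ (p - 1) • KaehlerDifferential.D k A f := by
      rw [map_mul, mul_smul]
    have e' : s • t • KaehlerDifferential.D (Frob p k k) (Twist p k A) (1 ⊗ₜ f)
        = (s * t) • KaehlerDifferential.D (Frob p k k) (Twist p k A) (1 ⊗ₜ f) := smul_smul _ _ _
    rw [e, e']
    exact pow_smul_D_mem_cartierGraph _ _
  | add α α' γ γ' _ _ h h' => rw [smul_add, smul_add]; exact add_mem h h'
  | neg α γ _ h => rw [smul_neg, smul_neg]; exact neg_mem h

/-- In the presence of coordinates every closed form `α` is a combination of the `xᵢ ^ (p - 1) dxᵢ`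
up to an exact form: the coefficients are the constants `- ∂ᵢ ^ (p - 1) (α(∂ᵢ))`. -/
theorem Coordinates.exists_mem_cartierGraph {n : ℕ} (X : Coordinates k A n)
    [Algebra.FiniteType k A] {α : Ω[A⁄k]} (hα : α ∈ closedForms k A) :
    ∃ γ, (α, γ) ∈ cartierGraph p k A := by
  have hlie : ∀ i j, ⁅X.d i, X.d j⁆ = 0 := fun i j => Derivation.ext fun a => by
    rw [Derivation.commutator_apply, X.d_comm, sub_self]; rfl
  have hpow : ∀ i, powDerivation p (X.d i) = 0 := fun i => Derivation.ext fun a => by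
    rw [powDerivation_apply, X.d_iterate_prime]; rfl
  have hzero : ∀ ω : Ω[A⁄k], (0 : Derivation k A A).liftKaehlerDifferential ω = 0 := fun ω => by
    induction ω using kaehler_induction with
    | smul_D a b => simp
    | add ω η h h' => rw [map_add, h, h', add_zero]
  have hclosed : ∀ {ω : Ω[A⁄k]}, ω ∈ closedForms k A → ∀ i j,
      X.d i ((X.d j).liftKaehlerDifferential ω) = X.d j ((X.d i).liftKaehlerDifferential ω) := by
    intro ω hω i j
    have := closed_lie hω (X.d i) (X.d j)
    rw [hlie, hzero] at this
    exact (sub_eq_zero.mp this.symm)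
  -- The coefficients `-∂ᵢ ^ (p - 1) (α(∂ᵢ))` are killed by all derivations.
  have hc : ∀ i, ∃ t : Twist p k A,
      relFrob p k A t = -(X.d i)^[p - 1] ((X.d i).liftKaehlerDifferential α) := fun i => by
    refine X.exists_relFrob_eq fun j => ?_
    have hcomm : Function.Commute (X.d j) (X.d i) := fun a => X.d_comm j i a
    rw [map_neg, neg_eq_zero, hcomm.iterate_right (p - 1), hclosed hα,
      ← Function.iterate_succ_apply, Nat.succ_eq_add_one, Nat.sub_add_cancel hp.out.one_le,
      X.d_iterate_prime]
  choose t ht using hc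
  have h1 : (∑ i, relFrob p k A (t i) • X.x i ^ (p - 1) • KaehlerDifferential.D k A (X.x i),
      ∑ i, t i • KaehlerDifferential.D (Frob p k k) (Twist p k A) (1 ⊗ₜ X.x i))
      ∈ cartierGraph p k A := by
    have := AddSubgroup.sum_mem (cartierGraph p k A) (t := Finset.univ)
      fun i _ => pow_smul_D_mem_cartierGraph (t i) (X.x i)
    convert this using 1
    refine Prod.ext ?_ ?_
    · rw [Prod.fst_sum]
    · rw [Prod.snd_sum]
  generalize hα₁ : (∑ i, relFrob p k A (t i) • X.x i ^ (p - 1) •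
    KaehlerDifferential.D k A (X.x i)) = α₁ at h1
  -- After the subtraction of `α₁` the criterion for exactness is satisfied.
  have h2 : ∀ i, (X.d i)^[p - 1] ((X.d i).liftKaehlerDifferential (α - α₁)) = 0 := fun i => by
    have := twistPairing_of_mem_cartierGraph h1 (X.d i)
    rw [X.twistPairing_sum, hpow, hzero, ht, zero_sub, neg_inj] at this
    rw [map_sub, iterate_map_sub, this, sub_self]
  have h3 : α - α₁ ∈ closedForms k A := sub_mem hα (closed_of_mem_cartierGraph h1)
  obtain ⟨f, hf⟩ := exists_primitive (p := p) X.d_x X.d_comm X.d_iterate_prime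
    (fun i => (X.d i).liftKaehlerDifferential (α - α₁)) (hclosed h3 · ·) h2
  refine ⟨0 + ∑ i, t i • KaehlerDifferential.D (Frob p k k) (Twist p k A) (1 ⊗ₜ X.x i), ?_⟩
  have h4 : α - α₁ = KaehlerDifferential.D k A f := X.form_ext fun i => by
    rw [Derivation.liftKaehlerDifferential_comp_D, hf]
  rw [← sub_add_cancel α α₁, h4]
  exact add_mem (D_mem_cartierGraph f) h1

/-- Clearing denominators in the graph of the Cartier operator of a localization. -/
theorem exists_pow_smul_mem_cartierGraph {B : Type u} [CommRing B] [Algebra k B] [Algebra A B]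
    [IsScalarTower k A B] (f : A) [IsLocalization.Away f B] (φ : A →ₐ[k] B)
    (hφ : ∀ a, φ a = algebraMap A B a) {β : Ω[B⁄k]} {δ : TwistForms p k B}
    (h : (β, δ) ∈ cartierGraph p k B) :
    ∃ N : ℕ, ∃ z ∈ cartierGraph p k A, kaehlerMapAlg φ z.1 = φ f ^ (p * N) • β := by
  have hsurj : ∀ b : B, ∃ (m : ℕ) (a : A), b * φ f ^ m = φ a := fun b => by
    simp only [hφ]
    exact IsLocalization.Away.surj f b
  have hconst : ∀ {C : Type u} [CommRing C] [Algebra k C] (c : C) (m : ℕ) (ω : C),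
      KaehlerDifferential.D k C (c ^ (p * m) * ω) = c ^ (p * m) • KaehlerDifferential.D k C ω := by
    intro C _ _ c m ω
    have : c ^ (p * m) = relFrob p k C (1 ⊗ₜ (c ^ m)) := by
      rw [relFrob_one_tmul, ← pow_mul, mul_comm]
    rw [this, Derivation.leibniz, derivation_relFrob_eq_zero (KaehlerDifferential.D k C), smul_zero,
      add_zero]
  -- A suitable power of `f` with exponent divisible by `p` clears the denominator of `b`.
  have hsurj' : ∀ b : B, ∃ (m : ℕ) (a : A), φ f ^ (p * m) * b = φ a := fun b => by
    obtain ⟨m, a, h⟩ := hsurj b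
    refine ⟨m, f ^ ((p - 1) * m) * a, ?_⟩
    rw [map_mul, map_pow, ← h, mul_left_comm, ← pow_add, ← Nat.succ_mul, Nat.succ_eq_add_one,
      Nat.sub_add_cancel hp.out.one_le, mul_comm]
  induction h using cartierGraph_induction with
  | exact g =>
    obtain ⟨m, a, h⟩ := hsurj' g
    refine ⟨m, _, D_mem_cartierGraph a, ?_⟩
    rw [kaehlerMapAlg_D, ← h, hconst]
  | pow t g =>
    obtain ⟨m, a, h⟩ := hsurj' g
    let _ : Algebra (Twist p k A) (Twist p k B) := (twistMap p k φ).toRingHom.toAlgebra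
    have := isLocalization_away_twist (p := p) f φ hφ
    obtain ⟨l, s, hs⟩ := IsLocalization.Away.surj (1 ⊗ₜ[k] f : Twist p k A) t
    replace hs : t * twistMap p k φ (1 ⊗ₜ f) ^ l = twistMap p k φ s := hs
    refine ⟨l + p * m, _, pow_smul_D_mem_cartierGraph s a, ?_⟩
    rw [kaehlerMapAlg_smul, kaehlerMapAlg_smul, kaehlerMapAlg_D, ← relFrob_twistMap, ← hs, map_mul,
      map_pow, twistMap_tmul, relFrob_one_tmul, map_pow, ← h, hconst, smul_smul, smul_smul,
      smul_smul, smul_smul]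
    congr 1
    have h1 : φ f ^ (p * (l + p * m))
        = (φ f ^ p) ^ l * ((φ f ^ (p * m)) ^ (p - 1) * φ f ^ (p * m)) := by
      rw [pow_sub_one_mul hp.out.ne_zero]
      ring
    rw [h1, mul_pow]
    ring
  | add β β' δ δ' _ _ h h' =>
    obtain ⟨N, z, hz, e⟩ := h
    obtain ⟨N', z', hz', e'⟩ := h'
    let u : Twist p k A := 1 ⊗ₜ f
    have hu : ∀ n, φ (relFrob p k A (u ^ n)) = φ f ^ (p * n) := fun n => by
      rw [map_pow, relFrob_one_tmul, map_pow, map_pow, pow_mul]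
    refine ⟨N + N', (relFrob p k A (u ^ N') • z.1, u ^ N' • z.2)
      + (relFrob p k A (u ^ N) • z'.1, u ^ N • z'.2),
      add_mem (smul_mem_cartierGraph _ hz) (smul_mem_cartierGraph _ hz'), ?_⟩
    rw [Prod.mk_add_mk, map_add, kaehlerMapAlg_smul, kaehlerMapAlg_smul, e, e', hu, hu, smul_smul,
      smul_smul, smul_add]
    congr 2 <;> ring
  | neg β δ _ h =>
    obtain ⟨N, z, hz, e⟩ := h
    exact ⟨N, -z, neg_mem hz, by rw [Prod.fst_neg, map_neg, e, smul_neg]⟩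

/-- An ideal of `A'` which contains a power of `1 ⊗ f` for every `f` in a set which generates the
unit ideal of `A` is the unit ideal. -/
theorem twistIdeal_eq_top {s : Set A} (hs : Ideal.span s = ⊤) (J : Ideal (Twist p k A))
    (h : ∀ f ∈ s, ∃ N : ℕ, (1 ⊗ₜ[k] f : Twist p k A) ^ N ∈ J) : J = ⊤ := by
  let ι : A →+* Twist p k A :=
    (Algebra.TensorProduct.includeRight : A →ₐ[k] Twist p k A).toRingHom
  rw [← Ideal.radical_eq_top, eq_top_iff, ← Ideal.map_top ι, ← hs, Ideal.map_span, Ideal.span_le]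
  rintro _ ⟨f, hf, rfl⟩
  exact h f hf

/-- On a smooth algebra the Cartier operator is defined on all closed forms. -/
theorem exists_mem_cartierGraph [Algebra.Smooth k A] {α : Ω[A⁄k]} (hα : α ∈ closedForms k A) :
    ∃ γ, (α, γ) ∈ cartierGraph p k A := by
  obtain ⟨s, hs, hstd⟩ := Algebra.Smooth.exists_span_eq_top_isStandardSmooth k A
  -- The multipliers `t` for which `t α` lies in the domain of the operator form an ideal, which
  -- contains powers of the equations of principal open subsets with coordinates.
  let J : Ideal (Twist p k A) :=
    { carrier := {t | ∃ γ, (relFrob p k A t • α, γ) ∈ cartierGraph p k A}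
      zero_mem' := ⟨0, by rw [map_zero, zero_smul]; exact zero_mem _⟩
      add_mem' := by
        rintro t t' ⟨γ, h⟩ ⟨γ', h'⟩
        exact ⟨γ + γ', by rw [map_add, add_smul]; exact add_mem h h'⟩
      smul_mem' := by
        rintro c t ⟨γ, h⟩
        exact ⟨c • γ, by rw [smul_eq_mul, map_mul, mul_smul]; exact smul_mem_cartierGraph c h⟩ }
  have hJ : J = ⊤ := twistIdeal_eq_top hs J fun f hf => by
    have := hstd f hf
    obtain ⟨n, ⟨X⟩⟩ := Coordinates.exists_of_isStandardSmooth (k := k) (A := Localization.Away f)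
    let φ : A →ₐ[k] Localization.Away f := IsScalarTower.toAlgHom k A _
    obtain ⟨δ, hδ⟩ := X.exists_mem_cartierGraph (p := p) (closedForms_map φ hα)
    obtain ⟨N, z, hz, e⟩ := exists_pow_smul_mem_cartierGraph f φ (fun _ => rfl) hδ
    rw [← map_pow, ← kaehlerMapAlg_smul, ← sub_eq_zero, ← map_sub] at e
    obtain ⟨M, hM⟩ := exists_pow_smul_eq_zero f φ (fun _ => rfl) e
    rw [smul_sub, sub_eq_zero, smul_smul] at hM
    refine ⟨N + M, (1 ⊗ₜ[k] f : Twist p k A) ^ M • z.2, ?_⟩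
    have := smul_mem_cartierGraph ((1 ⊗ₜ[k] f : Twist p k A) ^ M) hz
    convert this using 2
    rw [map_pow, map_pow, relFrob_one_tmul, ← pow_mul, ← pow_mul]
    obtain ⟨q, hq⟩ : ∃ q, p * M = q + M := ⟨(p - 1) * M, by
      rw [← Nat.succ_mul, Nat.succ_eq_add_one, Nat.sub_add_cancel hp.out.one_le]⟩
    rw [hq, pow_add f q, mul_smul, hM, smul_smul, mul_add, hq]
    congr 1
    ring
  obtain ⟨γ, hγ⟩ := (Ideal.eq_top_iff_one J).mp hJ
  exact ⟨γ, by rwa [map_one, one_smul] at hγ⟩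

/-- On a smooth algebra the Cartier operator is single-valued. -/
theorem eq_zero_of_mem_cartierGraph [Algebra.Smooth k A] {γ : TwistForms p k A}
    (h : (0, γ) ∈ cartierGraph p k A) : γ = 0 := by
  obtain ⟨s, hs, hstd⟩ := Algebra.Smooth.exists_span_eq_top_isStandardSmooth k A
  let J : Ideal (Twist p k A) :=
    { carrier := {t | t • γ = 0}
      zero_mem' := zero_smul _ _
      add_mem' := fun {t t'} h h' => by
        rw [Set.mem_ofPred_eq] at h h' ⊢; rw [add_smul, h, h', add_zero]
      smul_mem' := fun c t h => by
        rw [Set.mem_ofPred_eq] at h ⊢; rw [smul_eq_mul, mul_smul, h, smul_zero] }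
  have hJ : J = ⊤ := twistIdeal_eq_top hs J fun f hf => by
    have := hstd f hf
    obtain ⟨n, ⟨X⟩⟩ := Coordinates.exists_of_isStandardSmooth (k := k) (A := Localization.Away f)
    let φ : A →ₐ[k] Localization.Away f := IsScalarTower.toAlgHom k A _
    -- In the presence of coordinates the value of the operator is determined by its pairings with
    -- vector fields.
    refine exists_pow_smul_twistForm_eq_zero f φ (fun _ => rfl) (X.twistForm_ext fun i => ?_)
    have h1 := map_mem_cartierGraph φ h
    rw [map_zero] at h1
    rw [twistPairing_of_mem_cartierGraph h1, twistPairing_zero, map_zero, map_zero,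
      iterate_map_zero', sub_zero]
  have h1 : (1 : Twist p k A) • γ = 0 := (Ideal.eq_top_iff_one J).mp hJ
  rwa [one_smul] at h1

end Cartier

/-! ### Gluing over affine open subsets -/

section Gluing

variable {Z : Scheme.{u}}

/-- A family `P` of affine open subsets of `U` which covers `U` and contains all affine open subsets
of its members. -/
structure AffineCover (U : Z.Opens) (P : Z.affineOpens → Prop) : Prop where
  le : ∀ {V}, P V → V.1 ≤ U
  mono : ∀ {V W : Z.affineOpens}, P V → W.1 ≤ V.1 → P W
  exists_mem : ∀ z ∈ U, ∃ V, P V ∧ z ∈ V.1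

theorem exists_affine_le {U : Z.Opens} {z : Z} (hz : z ∈ U) :
    ∃ V : Z.affineOpens, z ∈ V.1 ∧ V.1 ≤ U := by
  obtain ⟨V, hV, hzV, h⟩ := exists_isAffineOpen_mem_and_subset hz
  exact ⟨⟨V, hV⟩, hzV, h⟩

theorem affineCover_self (U : Z.Opens) : AffineCover U fun V => V.1 ≤ U where
  le h := h
  mono h h' := h'.trans h
  exists_mem z hz := by
    obtain ⟨V, h, h'⟩ := exists_affine_le hz
    exact ⟨V, h', h⟩

/-- The affine open subsets of the members of an open cover. -/
theorem affineCover_of_cover {U : Z.Opens} {ι : Type*} (W : ι → Z.Opens)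
    (h : ∀ z ∈ U, ∃ i, z ∈ W i) : AffineCover U fun V => V.1 ≤ U ∧ ∃ i, V.1 ≤ W i where
  le h := h.1
  mono := fun ⟨h, i, hi⟩ h' => ⟨h'.trans h, i, h'.trans hi⟩
  exists_mem z hz := by
    obtain ⟨i, hi⟩ := h z hz
    obtain ⟨V, h, h'⟩ := exists_affine_le (show z ∈ U ⊓ W i from ⟨hz, hi⟩)
    exact ⟨V, ⟨h'.trans inf_le_left, i, h'.trans inf_le_right⟩, h⟩

theorem AffineCover.inf {U U' : Z.Opens} {P : Z.affineOpens → Prop} (h : AffineCover U P)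
    (hU : U' ≤ U) : AffineCover U' fun V => P V ∧ V.1 ≤ U' where
  le h := h.2
  mono := fun ⟨h1, h2⟩ h' => ⟨h.mono h1 h', h'.trans h2⟩
  exists_mem z hz := by
    obtain ⟨W, hW, hzW⟩ := h.exists_mem z (hU hz)
    obtain ⟨V, hz', h'⟩ := exists_affine_le (show z ∈ W.1 ⊓ U' from ⟨hzW, hz⟩)
    exact ⟨V, ⟨h.mono hW (h'.trans inf_le_left), h'.trans inf_le_right⟩, hz'⟩

universe v

/-- Sections over the members of an affine cover which are compatible with restriction can be glued:
the intersection of two members is covered by affine open subsets, which are again members. -/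
theorem AffineCover.existsUnique_glue {C : Type*} [Category.{v} C] {FC : C → C → Type*}
    {CC : C → Type u} [∀ X Y, FunLike (FC X Y) (CC X) (CC Y)] [ConcreteCategory C FC]
    [Limits.HasLimitsOfSize.{u, u} C] [(forget C).ReflectsIsomorphisms]
    [Limits.PreservesLimitsOfSize.{u, u} (forget C)]
    (F : TopCat.Sheaf C Z) {U : Z.Opens} {P : Z.affineOpens → Prop} (h : AffineCover U P)
    (s : ∀ V : {V // P V}, ToType (F.1.obj (op V.1.1)))
    (hs : ∀ (V W : {V // P V}) (h : W.1.1 ≤ V.1.1), F.1.map (homOfLE h).op (s V) = s W) :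
    ∃! t : ToType (F.1.obj (op U)), ∀ V : {V // P V},
      F.1.map (homOfLE (h.le V.2)).op t = s V := by
  refine F.existsUnique_gluing' (fun V : {V // P V} => V.1.1) U (fun V => homOfLE (h.le V.2))
    ?_ s ?_
  · intro z hz
    obtain ⟨V, hV, hz⟩ := h.exists_mem z hz
    exact Opens.mem_iSup.mpr ⟨⟨V, hV⟩, hz⟩
  · intro V V'
    refine F.eq_of_locally_eq' (fun W : {W : Z.affineOpens // W.1 ≤ V.1.1 ⊓ V'.1.1} => W.1.1) _
      (fun W => homOfLE W.2) ?_ _ _ ?_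
    · intro z hz
      obtain ⟨W, hzW, hW⟩ := exists_affine_le hz
      exact Opens.mem_iSup.mpr ⟨⟨W, hW⟩, hzW⟩
    · intro W
      rw [← ConcreteCategory.comp_apply, ← ConcreteCategory.comp_apply, ← F.1.map_comp,
        ← F.1.map_comp]
      exact (hs V ⟨W.1, h.mono V.2 (W.2.trans inf_le_left)⟩ (W.2.trans inf_le_left)).trans
        (hs V' ⟨W.1, h.mono V.2 (W.2.trans inf_le_left)⟩ (W.2.trans inf_le_right)).symm

variable (k : Type u) [Field k] [Z.Over (Spec (.of k))] {U : Z.Opens} {P : Z.affineOpens → Prop}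

theorem AffineCover.existsUnique_res (h : AffineCover U P) (s : ∀ V : {V // P V}, Γ(Z, V.1.1))
    (hs : ∀ (V W : {V // P V}) (h : W.1.1 ≤ V.1.1), res k h (s V) = s W) :
    ∃! t : Γ(Z, U), ∀ V : {V // P V}, res k (h.le V.2) t = s V :=
  h.existsUnique_glue Z.sheaf s hs

theorem AffineCover.ext_res (h : AffineCover U P) {f g : Γ(Z, U)}
    (hfg : ∀ (V : Z.affineOpens) (hV : P V), res k (h.le hV) f = res k (h.le hV) g) : f = g := by
  obtain ⟨t, -, ht⟩ := h.existsUnique_res k (fun V => res k (h.le V.2) g)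
    (fun V W h' => res_res k _ _ g)
  rw [ht f fun V => hfg V.1 V.2, ht g fun V => rfl]

theorem AffineCover.existsUnique_resM (M : Z.Modules) (h : AffineCover U P)
    (s : ∀ V : {V // P V}, Γ(M, V.1.1))
    (hs : ∀ (V W : {V // P V}) (h : W.1.1 ≤ V.1.1), resM M h (s V) = s W) :
    ∃! t : Γ(M, U), ∀ V : {V // P V}, resM M (h.le V.2) t = s V :=
  h.existsUnique_glue ⟨M.presheaf, M.isSheaf⟩ s hs

theorem resM_resM (M : Z.Modules) {U V W : Z.Opens} (h : V ≤ U) (h' : W ≤ V) (s : Γ(M, U)) :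
    resM M h' (resM M h s) = resM M (h'.trans h) s := by
  simp only [resM]
  rw [← AddCommGrpCat.comp_apply, ← M.presheaf.map_comp]
  rfl

theorem resM_refl (M : Z.Modules) {U : Z.Opens} (s : Γ(M, U)) : resM M le_rfl s = s := by
  simp only [resM]
  rw [show (homOfLE (le_refl U)).op = 𝟙 (op U) from rfl, M.presheaf.map_id]; rfl

theorem resM_smul (M : Z.Modules) {U V : Z.Opens} (h : V ≤ U) (f : Γ(Z, U)) (s : Γ(M, U)) :
    resM M h (f • s) = res k h f • resM M h s :=
  Scheme.Modules.map_smul M (homOfLE h) f s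

theorem AffineCover.ext_resM (M : Z.Modules) (h : AffineCover U P) {s t : Γ(M, U)}
    (hst : ∀ (V : Z.affineOpens) (hV : P V), resM M (h.le hV) s = resM M (h.le hV) t) : s = t := by
  obtain ⟨r, -, hr⟩ := h.existsUnique_resM M (fun V => resM M (h.le V.2) t)
    (fun V W h' => resM_resM M _ _ t)
  rw [hr s fun V => hst V.1 V.2, hr t fun V => rfl]

end Gluing

section VectorFields

variable {k : Type u} [Field k] {Z : Scheme.{u}} [Z.Over (Spec (.of k))] {U V W : Z.Opens}

namespace VectorFields

theorem res_der (h : V ≤ U) (x : VectorFields k U) (f : Γ(Z, U)) :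
    res k h (der x f) = der (restrict h x) (res k h f) := x.2 ⟨U, le_rfl⟩ ⟨V, h⟩ h f

theorem restrict_restrict (h : V ≤ U) (h' : W ≤ V) (x : VectorFields k U) :
    restrict h' (restrict h x) = restrict (h'.trans h) x := rfl

theorem restrict_refl (x : VectorFields k U) : restrict le_rfl x = x := rfl

theorem ext_der {x y : VectorFields k U}
    (h : ∀ (V : Z.Opens) (hV : V ≤ U), der (restrict hV x) = der (restrict hV y)) : x = y :=
  Subtype.ext (funext fun V => h V.1 V.2)

theorem restrict_smul (h : V ≤ U) (f : Γ(Z, U)) (x : VectorFields k U) :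
    restrict h (f • x) = res k h f • restrict h x :=
  Subtype.ext (funext fun W => by
    change res k (W.2.trans h) f • x.1 ⟨W.1, W.2.trans h⟩
      = res k W.2 (res k h f) • x.1 ⟨W.1, W.2.trans h⟩
    rw [res_res])

theorem restrict_pPow (p : ℕ) [Fact p.Prime] [CharP k p] (h : V ≤ U) (x : VectorFields k U) :
    restrict h (pPow p x) = pPow p (restrict h x) := rfl

theorem restrict_sum {ι : Type*} (s : Finset ι) (h : V ≤ U) (x : ι → VectorFields k U) :
    restrict h (∑ i ∈ s, x i) = ∑ i ∈ s, restrict h (x i) :=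
  map_sum (AddMonoidHom.mk' (restrict h) fun _ _ => rfl) x s

@[simp] theorem der_add (x y : VectorFields k U) : der (x + y) = der x + der y := rfl

@[simp] theorem der_zero : der (0 : VectorFields k U) = 0 := rfl

theorem der_lie (x y : VectorFields k U) : der ⁅x, y⁆ = ⁅der x, der y⁆ := rfl

theorem der_pPow (p : ℕ) [Fact p.Prime] [CharP k p] (x : VectorFields k U) :
    der (pPow p x) = powDerivation p (der x) := rfl

theorem der_smul (f : Γ(Z, U)) (x : VectorFields k U) : der (f • x) = f • der x := by
  change res k le_rfl f • der x = _
  rw [res_refl]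

theorem der_sum {ι : Type*} (s : Finset ι) (x : ι → VectorFields k U) :
    der (∑ i ∈ s, x i) = ∑ i ∈ s, der (x i) :=
  map_sum (AddMonoidHom.mk' (der (k := k) (U := U)) fun _ _ => rfl) x s

end VectorFields

/-- Vector fields agree if they induce the same derivations of the functions on the members of an
affine cover. -/
theorem AffineCover.ext_vectorFields {P : Z.affineOpens → Prop} (h : AffineCover U P)
    {x y : VectorFields k U}
    (hxy : ∀ (V : Z.affineOpens) (hV : P V), VectorFields.der (VectorFields.restrict (h.le hV) x)
      = VectorFields.der (VectorFields.restrict (h.le hV) y)) : x = y := by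
  refine VectorFields.ext_der fun V hV => Derivation.ext fun f => ?_
  refine (h.inf hV).ext_res k fun W hW => ?_
  rw [VectorFields.res_der, VectorFields.res_der]
  exact DFunLike.congr_fun (hxy W hW.1) _

/-- Vector fields can be glued from derivations of the functions on the members of an affine
cover. -/
theorem AffineCover.exists_vectorField {P : Z.affineOpens → Prop} (h : AffineCover U P)
    (D : ∀ V : {V // P V}, Derivation k Γ(Z, V.1.1) Γ(Z, V.1.1))
    (hD : ∀ (V W : {V // P V}) (h : W.1.1 ≤ V.1.1) (f : Γ(Z, V.1.1)),
      res k h (D V f) = D W (res k h f)) :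
    ∃ x : VectorFields k U, ∀ V : {V // P V},
      VectorFields.der (VectorFields.restrict (h.le V.2) x) = D V := by
  have key : ∀ (V : {V : Z.Opens // V ≤ U}) (f : Γ(Z, V.1)), ∃ g : Γ(Z, V.1),
      ∀ (W : {W // P W}) (hW : W.1.1 ≤ V.1), res k hW g = D W (res k hW f) := by
    intro V f
    obtain ⟨g, hg, -⟩ := (h.inf V.2).existsUnique_res k
      (fun W => D ⟨W.1, W.2.1⟩ (res k W.2.2 f))
      (fun W W' hW => by rw [hD ⟨W.1, W.2.1⟩ ⟨W'.1, W'.2.1⟩ hW, res_res])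
    exact ⟨g, fun W hW => hg ⟨W.1, W.2, hW⟩⟩
  choose g hg using key
  have hext : ∀ (V : {V : Z.Opens // V ≤ U}) (a b : Γ(Z, V.1)),
      (∀ (W : {W // P W}) (hW : W.1.1 ≤ V.1), res k hW a = res k hW b) → a = b :=
    fun V a b hab => (h.inf V.2).ext_res k fun W hW => hab ⟨W, hW.1⟩ hW.2
  let E : ∀ V : {V : Z.Opens // V ≤ U}, Derivation k Γ(Z, V.1) Γ(Z, V.1) := fun V =>
    Derivation.mk'
      { toFun := g V
        map_add' := fun a b => hext V _ _ fun W hW => by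
          simp only [map_add, hg]
        map_smul' := fun c a => hext V _ _ fun W hW => by
          simp only [RingHom.id_apply, map_smul, hg, Derivation.map_smul] }
      (fun a b => hext V _ _ fun W hW => by
        change res k hW (g V (a * b)) = res k hW (a * g V b + b * g V a)
        simp only [map_mul, map_add, hg, Derivation.leibniz, smul_eq_mul])
  refine ⟨⟨E, fun V V' hV f => hext V' _ _ fun W hW => ?_⟩, fun V => Derivation.ext fun f => ?_⟩
  · change res k hW (res k hV (g V f)) = res k hW (g V' (res k hV f))
    rw [res_res, hg, hg, res_res]
  · change g ⟨V.1.1, _⟩ f = D V f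
    have := hg ⟨V.1.1, h.le V.2⟩ f V le_rfl
    rwa [res_refl, res_refl] at this

end VectorFields

/-! ### Coordinate charts of a smooth scheme -/

section Charts

variable {k : Type u} [Field k] {Z : Scheme.{u}} [Z.Over (Spec (.of k))]

theorem smooth_sections [Smooth (Z ↘ Spec (.of k))] {V : Z.Opens} (hV : IsAffineOpen V) :
    Algebra.Smooth k Γ(Z, V) := by
  have h1 : ((Z ↘ Spec (.of k)).appLE ⊤ V le_top).hom.Smooth :=
    Scheme.Hom.smooth_appLE _ (isAffineOpen_top _) hV le_top
  have h2 := RingHom.Smooth.respectsIso.2 _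
    (Scheme.ΓSpecIso (.of k)).symm.commRingCatIsoToRingEquiv h1
  exact h2

/-- Restriction of functions from an affine open subset to a smaller one is formally étale, because
an open immersion is étale. -/
theorem formallyEtale_res {U V : Z.Opens} (hU : IsAffineOpen U) (hV : IsAffineOpen V)
    (h : V ≤ U) : (res k h : Γ(Z, U) →ₐ[k] Γ(Z, V)).toRingHom.FormallyEtale := by
  have h1 : ((𝟙 Z : Z ⟶ Z).appLE U V h).hom.Etale := Scheme.Hom.etale_appLE (𝟙 Z) hU hV h
  have h2 : (𝟙 Z : Z ⟶ Z).appLE U V h = Z.presheaf.map (homOfLE h).op := by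
    simp only [Scheme.Hom.appLE, Scheme.Hom.id_app]
    exact Category.id_comp _
  rw [h2] at h1
  exact h1.formallyEtale

theorem derivation_sum_apply {A : Type*} [CommRing A] [Algebra k A] {ι : Type*} (s : Finset ι)
    (D : ι → Derivation k A A) (a : A) : (∑ i ∈ s, D i) a = ∑ i ∈ s, D i a :=
  map_sum (AddMonoidHom.mk' (fun E : Derivation k A A => E a) fun _ _ => rfl) D s

variable (k) in
/-- A coordinate chart: an affine open subset with coordinates on its functions. -/
structure Chart (U : Z.Opens) (n : ℕ) where
  affine : IsAffineOpen U
  /-- The coordinates. -/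
  X : Coordinates k Γ(Z, U) n

namespace Chart

variable {U : Z.Opens} {n : ℕ} (c : Chart k U n)

/-- The coordinates of a chart, restricted to a smaller affine open subset. -/
def coord {V : Z.Opens} (hV : IsAffineOpen V) (h : V ≤ U) : Coordinates k Γ(Z, V) n :=
  letI : Algebra Γ(Z, U) Γ(Z, V) := (res k h).toRingHom.toAlgebra
  haveI : IsScalarTower k Γ(Z, U) Γ(Z, V) :=
    IsScalarTower.of_algebraMap_eq' (res k h).comp_algebraMap.symm
  haveI : Algebra.FormallyEtale Γ(Z, U) Γ(Z, V) := formallyEtale_res c.affine hV h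
  c.X.etale Γ(Z, V)

theorem coord_x {V : Z.Opens} (hV : IsAffineOpen V) (h : V ≤ U) (i : Fin n) :
    (c.coord hV h).x i = res k h (c.X.x i) := rfl

theorem res_coord_d {V W : Z.Opens} (hV : IsAffineOpen V) (hW : IsAffineOpen W) (h : V ≤ U)
    (h' : W ≤ V) (i : Fin n) (f : Γ(Z, V)) :
    res k h' ((c.coord hV h).d i f) = (c.coord hW (h'.trans h)).d i (res k h' f) := by
  let _ : Algebra Γ(Z, V) Γ(Z, W) := (res k h').toRingHom.toAlgebra
  have _ : IsScalarTower k Γ(Z, V) Γ(Z, W) :=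
    IsScalarTower.of_algebraMap_eq' (res k h').comp_algebraMap.symm
  let D : Derivation k Γ(Z, V) Γ(Z, W) :=
    (Algebra.linearMap Γ(Z, V) Γ(Z, W)).compDer ((c.coord hV h).d i)
  let E : Derivation k Γ(Z, V) Γ(Z, W) :=
    ((c.coord hW (h'.trans h)).d i).compAlgebraMap Γ(Z, V)
  have : D = E := (c.coord hV h).derivation_ext fun j => by
    change res k h' ((c.coord hV h).d i ((c.coord hV h).x j))
      = (c.coord hW (h'.trans h)).d i (res k h' ((c.coord hV h).x j))
    have h1 : res k h' ((c.coord hV h).x j) = (c.coord hW (h'.trans h)).x j := by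
      rw [coord_x, coord_x, res_res]
    rw [h1, Coordinates.d_x, Coordinates.d_x]
    split_ifs <;> simp
  exact DFunLike.congr_fun this f

theorem exists_del (i : Fin n) : ∃ x : VectorFields k U, ∀ V : {V : Z.affineOpens // V.1 ≤ U},
    VectorFields.der (VectorFields.restrict V.2 x) = (c.coord V.1.2 V.2).d i :=
  (affineCover_self U).exists_vectorField (fun V => (c.coord V.1.2 V.2).d i)
    fun V W h f => c.res_coord_d V.1.2 W.1.2 V.2 h i f

/-- The coordinate vector fields of a chart. -/
def del (i : Fin n) : VectorFields k U := (c.exists_del i).choose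

theorem der_del {V : Z.Opens} (hV : IsAffineOpen V) (h : V ≤ U) (i : Fin n) :
    VectorFields.der (VectorFields.restrict h (c.del i)) = (c.coord hV h).d i :=
  (c.exists_del i).choose_spec ⟨⟨V, hV⟩, h⟩

/-- Every vector field is a combination of the coordinate vector fields. -/
theorem vectorField_eq {V : Z.Opens} (h : V ≤ U) (y : VectorFields k V) :
    y = ∑ i, VectorFields.der y (res k h (c.X.x i)) • VectorFields.restrict h (c.del i) := by
  refine (affineCover_self V).ext_vectorFields fun W hW => Derivation.ext fun f => ?_
  rw [(c.coord W.2 (hW.trans h)).derivation_apply, VectorFields.restrict_sum, VectorFields.der_sum]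
  simp only [VectorFields.restrict_smul, VectorFields.der_smul, VectorFields.restrict_restrict,
    c.der_del W.2, VectorFields.res_der, res_res]
  rw [derivation_sum_apply]
  refine Finset.sum_congr rfl fun i _ => ?_
  simp only [Derivation.smul_apply, smul_eq_mul]
  rw [mul_comm]
  rfl

theorem vectorField_ext {V : Z.Opens} (h : V ≤ U) {x y : VectorFields k V}
    (hxy : ∀ i, VectorFields.der x (res k h (c.X.x i)) = VectorFields.der y (res k h (c.X.x i))) :
    x = y := by
  rw [c.vectorField_eq h x, c.vectorField_eq h y]
  simp only [hxy]

theorem der_del_x {V : Z.Opens} (h : V ≤ U) (i j : Fin n) :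
    VectorFields.der (VectorFields.restrict h (c.del i)) (res k h (c.X.x j))
      = if i = j then 1 else 0 := by
  rw [← VectorFields.res_der, ← VectorFields.restrict_refl (c.del i), c.der_del c.affine le_rfl]
  have h1 : c.X.x j = (c.coord c.affine le_rfl).x j := by rw [coord_x, res_refl]
  rw [h1, Coordinates.d_x]
  split_ifs <;> simp

theorem del_lie (i j : Fin n) : ⁅c.del i, c.del j⁆ = 0 :=
  c.vectorField_ext le_rfl fun l => by
    rw [VectorFields.der_lie, Derivation.commutator_apply]
    have := c.der_del_x le_rfl i l
    have h' := c.der_del_x le_rfl j l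
    rw [VectorFields.restrict_refl] at this h'
    rw [this, h']
    split_ifs <;> simp

theorem pPow_del (p : ℕ) [hp : Fact p.Prime] [CharP k p] (i : Fin n) :
    VectorFields.pPow p (c.del i) = 0 :=
  c.vectorField_ext le_rfl fun l => by
    rw [VectorFields.der_pPow, powDerivation_apply, ← Nat.sub_add_cancel hp.out.one_le,
      Function.iterate_succ_apply]
    have := c.der_del_x le_rfl i l
    rw [VectorFields.restrict_refl] at this
    rw [this]
    obtain ⟨m, hm⟩ := Nat.exists_eq_add_of_le hp.out.two_le
    rw [show p - 1 = m + 1 by omega, Function.iterate_succ_apply]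
    have h0 : VectorFields.der (c.del i) (if i = l then 1 else 0) = 0 := by
      split_ifs <;> simp
    rw [h0, iterate_map_zero']
    simp

end Chart

/-- Every point has arbitrarily small charts. -/
theorem exists_chart [Smooth (Z ↘ Spec (.of k))] {U : Z.Opens} {z : Z} (hz : z ∈ U) :
    ∃ V : Z.Opens, z ∈ V ∧ V ≤ U ∧ ∃ n, Nonempty (Chart k V n) := by
  obtain ⟨V, hzV, hVU⟩ := exists_affine_le hz
  have := smooth_sections (k := k) V.2
  obtain ⟨s, hs, hstd⟩ := Algebra.Smooth.exists_span_eq_top_isStandardSmooth k Γ(Z, V.1)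
  obtain ⟨⟨f, hf⟩, hzf⟩ : ∃ f : s, z ∈ Z.basicOpen f.1 := by
    have := (V.2.iSup_basicOpen_eq_self_iff).mpr hs
    rw [← this] at hzV
    exact Opens.mem_iSup.mp hzV
  refine ⟨Z.basicOpen f, hzf, (Z.basicOpen_le f).trans hVU, ?_⟩
  have h1 := V.2.isLocalization_basicOpen f
  have := hstd f hf
  obtain ⟨n, ⟨X⟩⟩ := Coordinates.exists_of_isStandardSmooth (k := k)
    (A := Localization.Away f)
  -- The coordinates on `Localization.Away f` are transported to the functions on `D(f)`.
  let e := IsLocalization.algEquiv (Submonoid.powers f) (Localization.Away f)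
    Γ(Z, Z.basicOpen f)
  let _ : Algebra (Localization.Away f) Γ(Z, Z.basicOpen f) := e.toRingHom.toAlgebra
  have _ : IsScalarTower k (Localization.Away f) Γ(Z, Z.basicOpen f) := by
    refine IsScalarTower.of_algebraMap_eq fun c => ?_
    change _ = e (algebraMap k (Localization.Away f) c)
    rw [IsScalarTower.algebraMap_apply k Γ(Z, V.1) (Localization.Away f), e.commutes]
    exact ((res k (Z.basicOpen_le f)).commutes c).symm
  have : Algebra.FormallyEtale (Localization.Away f) Γ(Z, Z.basicOpen f) :=
    Algebra.FormallyEtale.of_equiv (AlgEquiv.ofBijective (Algebra.ofId _ _) e.bijective)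
  exact ⟨n, ⟨⟨V.2.basicOpen f, X.etale _⟩⟩⟩

end Charts

/-! ### The Cartier operator of a smooth scheme and the evaluation of forms on vector fields -/

section CartierOperator

variable (p : ℕ) [hp : Fact p.Prime] {k : Type u} [Field k] [CharP k p]

theorem cartierGraph_unique {A : Type u} [CommRing A] [Algebra k A] [Algebra.Smooth k A]
    {α : Ω[A⁄k]} {γ δ : TwistForms p k A} (h : (α, γ) ∈ cartierGraph p k A)
    (h' : (α, δ) ∈ cartierGraph p k A) : γ = δ := by
  have := sub_mem h h'
  rw [Prod.mk_sub_mk, sub_self] at this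
  exact sub_eq_zero.mp (eq_zero_of_mem_cartierGraph this)

variable (k)

/-- The Cartier operator of a smooth algebra. -/
def cartierHom (A : Type u) [CommRing A] [Algebra k A] [Algebra.Smooth k A] :
    closedForms k A →+ TwistForms p k A :=
  AddMonoidHom.mk' (fun α => (exists_mem_cartierGraph (p := p) α.2).choose) fun α β =>
    cartierGraph_unique p (exists_mem_cartierGraph (p := p) (α + β).2).choose_spec
      (add_mem (exists_mem_cartierGraph (p := p) α.2).choose_spec
        (exists_mem_cartierGraph (p := p) β.2).choose_spec)

theorem cartierHom_mem (A : Type u) [CommRing A] [Algebra k A] [Algebra.Smooth k A]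
    (α : closedForms k A) : (α.1, cartierHom p k A α) ∈ cartierGraph p k A :=
  (exists_mem_cartierGraph (p := p) α.2).choose_spec

variable (Z : Scheme.{u}) [Z.Over (Spec (.of k))] [Smooth (Z ↘ Spec (.of k))]

/-- The Cartier operators of the algebras of functions on affine open subsets are the components of
a Cartier operator. -/
theorem exists_isCartierOperator : ∃ C, IsCartierOperator p k Z C := by
  have hsm : ∀ V : Z.affineOpens, Algebra.Smooth k Γ(Z, V.1) := fun V => smooth_sections V.2
  have key : ∀ (V : Z.affineOpens) (α : closedForms k Γ(Z, V.1)) (γ : TwistForms p k Γ(Z, V.1)),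
      (α.1, γ) ∈ cartierGraph p k Γ(Z, V.1) → cartierHom p k Γ(Z, V.1) α = γ :=
    fun V α γ h => cartierGraph_unique p (cartierHom_mem p k _ _) h
  have mem : ∀ (V : Z.affineOpens) (α : closedForms k Γ(Z, V.1)),
      (α.1, cartierHom p k Γ(Z, V.1) α) ∈ cartierGraph p k Γ(Z, V.1) :=
    fun V α => cartierHom_mem p k _ α
  refine ⟨{ app := fun V => AddCommGrpCat.ofHom
              (show closedForms k Γ(Z, V.unop.1) →+ TwistForms p k Γ(Z, V.unop.1) from
                cartierHom p k Γ(Z, V.unop.1))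
            naturality := fun V W i => ?_ }, ⟨fun V a α β h => ?_, fun V f α h => ?_,
              fun V f α h => ?_⟩⟩
  · ext α
    let V' : Z.affineOpens := V.unop
    have h := mem V' α
    exact key W.unop _ _ (map_mem_cartierGraph (res k i.unop.le) h)
  · refine key V β _ ?_
    rw [h]
    exact smul_mem_cartierGraph a (mem V α)
  · refine key V α _ ?_
    rw [h]
    exact D_mem_cartierGraph f
  · refine key V α _ ?_
    rw [h]
    have := pow_smul_D_mem_cartierGraph (p := p) (k := k) 1 f
    rwa [map_one, one_smul, one_smul] at this

/-- The chosen Cartier operator takes its values in the graph: this is where the existence of a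
Cartier operator enters, and every closed form is a combination of the generators of the graph. -/
theorem cartierOperator_mem (V : Z.affineOpens) (α : closedForms k Γ(Z, V.1)) :
    (α.1, (show TwistForms p k Γ(Z, V.1) from ((cartierOperator p k Z).app (op V)).hom α))
      ∈ cartierGraph p k Γ(Z, V.1) := by
  have hC : IsCartierOperator p k Z (cartierOperator p k Z) := by
    rw [cartierOperator, dif_pos (exists_isCartierOperator p k Z)]
    exact (exists_isCartierOperator p k Z).choose_spec
  let C : closedForms k Γ(Z, V.1) →+ TwistForms p k Γ(Z, V.1) :=
    ((cartierOperator p k Z).app (op V)).hom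
  have key : ∀ {ω : Ω[Γ(Z, V.1)⁄k]} {γ : TwistForms p k Γ(Z, V.1)}
      (_ : (ω, γ) ∈ cartierGraph p k Γ(Z, V.1)) (h : ω ∈ closedForms k Γ(Z, V.1)),
      C ⟨ω, h⟩ = γ := by
    intro ω γ hω
    induction hω using cartierGraph_induction with
    | exact g => exact fun h => hC.map_exact V g ⟨_, h⟩ rfl
    | pow t f =>
      intro h
      have h1 := pow_smul_D_mem_cartierGraph (p := p) (k := k) 1 f
      rw [map_one, one_smul, one_smul] at h1
      have h2 := closed_of_mem_cartierGraph h1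
      exact (hC.map_smul V t ⟨_, h2⟩ ⟨_, h⟩ rfl).trans
        (congrArg (t • ·) (hC.map_pow_mul_D V f ⟨_, h2⟩ rfl))
    | add ω ω' γ γ' hm hm' ih ih' =>
      intro h
      rw [← ih (closed_of_mem_cartierGraph hm), ← ih' (closed_of_mem_cartierGraph hm'), ← map_add]
      rfl
    | neg ω γ hm ih =>
      intro h
      rw [← ih (closed_of_mem_cartierGraph hm), ← map_neg]
      rfl
  have := smooth_sections (k := k) V.2
  obtain ⟨γ, hγ⟩ := exists_mem_cartierGraph (p := p) α.2
  change (α.1, C α) ∈ _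
  rwa [key hγ α.2]

end CartierOperator

section Evaluation

variable {p : ℕ} [hp : Fact p.Prime] {k : Type u} [Field k] [CharP k p]
  {Z : Scheme.{u}} [Z.Over (Spec (.of k))] {U : Z.Opens}

/-- The function `α(x)` on an affine open subset, for a closed form `α` and a vector field `x`. -/
def evForm (α : (closedSheaf k Z).obj (op U)) (V : {V : Z.affineOpens // V.1 ≤ U})
    (x : VectorFields k V.1.1) : Γ(Z, V.1.1) :=
  (VectorFields.der x).liftKaehlerDifferential (α.1 V).1

/-- The `p`-th power of the function `γ(x')`, for a form `γ` on the twist and a vector field `x`. -/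
def evTwist (γ : (twistSheaf p k Z).obj (op U)) (V : {V : Z.affineOpens // V.1 ≤ U})
    (x : VectorFields k V.1.1) : Γ(Z, V.1.1) :=
  twistPairing p (VectorFields.der x) (γ.1 V)

theorem lift_add_left {A : Type u} [CommRing A] [Algebra k A] (x y : Derivation k A A)
    (ω : Ω[A⁄k]) : (x + y).liftKaehlerDifferential ω
      = x.liftKaehlerDifferential ω + y.liftKaehlerDifferential ω := by
  induction ω using kaehler_induction with
  | smul_D a b => simp [mul_add]
  | add ω η h h' => rw [map_add, map_add, map_add, h, h']; ring

theorem lift_smul_left {A : Type u} [CommRing A] [Algebra k A] (f : A) (x : Derivation k A A)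
    (ω : Ω[A⁄k]) : (f • x).liftKaehlerDifferential ω = f * x.liftKaehlerDifferential ω := by
  induction ω using kaehler_induction with
  | smul_D a b => simp; ring
  | add ω η h h' => rw [map_add, map_add, h, h']; ring

variable (α β : (closedSheaf k Z).obj (op U)) (γ δ : (twistSheaf p k Z).obj (op U))
  (V : {V : Z.affineOpens // V.1 ≤ U}) (x y : VectorFields k V.1.1)

theorem evForm_add : evForm (α + β) V x = evForm α V x + evForm β V x :=
  map_add _ _ _

theorem evForm_sub : evForm (α - β) V x = evForm α V x - evForm β V x :=
  map_sub _ _ _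

theorem evForm_neg : evForm (-α) V x = -evForm α V x :=
  map_neg _ _

theorem evTwist_sub : evTwist (γ - δ) V x = evTwist γ V x - evTwist δ V x :=
  twistPairing_sub _ _ _

theorem evForm_add_right : evForm α V (x + y) = evForm α V x + evForm α V y :=
  lift_add_left _ _ _

theorem evForm_smul_right (f : Γ(Z, V.1.1)) : evForm α V (f • x) = f * evForm α V x := by
  rw [evForm, VectorFields.der_smul]
  exact lift_smul_left _ _ _

theorem evTwist_add_right : evTwist γ V (x + y) = evTwist γ V x + evTwist γ V y :=
  twistPairing_add_left _ _ _

theorem evTwist_smul_right (f : Γ(Z, V.1.1)) : evTwist γ V (f • x) = f ^ p * evTwist γ V x := by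
  rw [evTwist, VectorFields.der_smul]
  exact twistPairing_smul_left _ _ _

theorem evForm_lie : evForm α V ⁅x, y⁆
    = VectorFields.der x (evForm α V y) - VectorFields.der y (evForm α V x) :=
  closed_lie (α.1 V).2 _ _

theorem der_evTwist : VectorFields.der x (evTwist γ V y) = 0 :=
  derivation_twistPairing _ _ _

variable {V}

theorem res_evForm (W : {V : Z.affineOpens // V.1 ≤ U}) (h : W.1.1 ≤ V.1.1) :
    res k h (evForm α V x) = evForm α W (VectorFields.restrict h x) := by
  have h1 : kaehlerMapAlg (res k h) (α.1 V).1 = (α.1 W).1 := congrArg Subtype.val (α.2 V W h)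
  rw [evForm, evForm, ← h1]
  exact (lift_kaehlerMapAlg _ _ _ (fun a => (VectorFields.res_der h x a).symm) _).symm

theorem res_evTwist (W : {V : Z.affineOpens // V.1 ≤ U}) (h : W.1.1 ≤ V.1.1) :
    res k h (evTwist γ V x) = evTwist γ W (VectorFields.restrict h x) := by
  have h1 : kaehlerMapAlg (twistMap p k (res k h)) (γ.1 V) = γ.1 W := γ.2 V W h
  rw [evTwist, evTwist, ← h1]
  exact (twistPairing_map _ _ _ (fun a => (VectorFields.res_der h x a).symm) _).symm

theorem evForm_rst {U' : Z.Opens} (h : U' ≤ U) (V : {V : Z.affineOpens // V.1 ≤ U'})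
    (x : VectorFields k V.1.1) :
    evForm (rst (closedSheaf k Z) h α) V x = evForm α ⟨V.1, V.2.trans h⟩ x := rfl

theorem evTwist_rst {U' : Z.Opens} (h : U' ≤ U) (V : {V : Z.affineOpens // V.1 ≤ U'})
    (x : VectorFields k V.1.1) :
    evTwist (rst (twistSheaf p k Z) h γ) V x = evTwist γ ⟨V.1, V.2.trans h⟩ x := rfl

/-- The pairing of `α' - C(α)` with `x'`. -/
theorem evTwist_atiyahComplex [Smooth (Z ↘ Spec (.of k))] :
    evTwist (((atiyahComplex p k Z).app (op U)).hom α) V x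
      = evForm α V x ^ p - (evForm α V (VectorFields.pPow p x)
        - (VectorFields.der x)^[p - 1] (evForm α V x)) := by
  have h := twistPairing_of_mem_cartierGraph (cartierOperator_mem p k Z V.1 (α.1 V))
    (VectorFields.der x)
  have h' := twistPairing_twistForm (p := p) (VectorFields.der x) (α.1 V).1
  exact (twistPairing_sub _ _ _).trans (congrArg₂ (· - ·) h' h)

section Chart

variable {n : ℕ} (c : Chart k U n) {V₀ : Z.Opens} (h₀ : V₀ ≤ U)
include c h₀

/-- Closed forms on an open subset of a chart are determined by their values on vector fields. -/
theorem closedSheaf_ext {α β : (closedSheaf k Z).obj (op V₀)}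
    (h : ∀ V x, evForm α V x = evForm β V x) : α = β := by
  refine Subtype.ext (funext fun V => Subtype.ext ?_)
  refine (c.coord V.1.2 (V.2.trans h₀)).form_ext fun i => ?_
  rw [← c.der_del V.1.2 (V.2.trans h₀)]
  exact h V _

/-- Forms on the twist of an open subset of a chart are determined by their pairings with vector
fields. -/
theorem twistSheaf_ext [Smooth (Z ↘ Spec (.of k))] {γ δ : (twistSheaf p k Z).obj (op V₀)}
    (h : ∀ V x, evTwist γ V x = evTwist δ V x) : γ = δ := by
  refine Subtype.ext (funext fun V => ?_)
  have := smooth_sections (k := k) V.1.2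
  refine (c.coord V.1.2 (V.2.trans h₀)).twistForm_ext fun i => ?_
  rw [← c.der_del V.1.2 (V.2.trans h₀)]
  exact h V _

/-- Closed forms on an open subset of a chart are the compatible families of linear forms `a` on
the vector fields with `a([x, y]) = x(a(y)) - y(a(x))`. -/
theorem exists_closedSheaf
    (a : ∀ V : {V : Z.affineOpens // V.1 ≤ V₀}, VectorFields k V.1.1 →ₗ[Γ(Z, V.1.1)] Γ(Z, V.1.1))
    (a_res : ∀ (V W : {V : Z.affineOpens // V.1 ≤ V₀}) (h : W.1.1 ≤ V.1.1) (x),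
      res k h (a V x) = a W (VectorFields.restrict h x))
    (a_lie : ∀ V (x y : VectorFields k V.1.1),
      a V ⁅x, y⁆ = VectorFields.der x (a V y) - VectorFields.der y (a V x)) :
    ∃ α : (closedSheaf k Z).obj (op V₀), ∀ V x, evForm α V x = a V x := by
  let e : ∀ (V : {V : Z.affineOpens // V.1 ≤ V₀}) (i : Fin n), VectorFields k V.1.1 := fun V i =>
    VectorFields.restrict (V.2.trans h₀) (c.del i)
  let X : ∀ V : {V : Z.affineOpens // V.1 ≤ V₀}, Coordinates k Γ(Z, V.1.1) n := fun V =>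
    c.coord V.1.2 (V.2.trans h₀)
  have he : ∀ V i, VectorFields.der (e V i) = (X V).d i := fun V i =>
    c.der_del V.1.2 (V.2.trans h₀) i
  let ω : ∀ V : {V : Z.affineOpens // V.1 ≤ V₀}, Ω[Γ(Z, V.1.1)⁄k] := fun V =>
    ∑ i, a V (e V i) • KaehlerDifferential.D k Γ(Z, V.1.1) ((X V).x i)
  have hω : ∀ V, ω V ∈ closedForms k Γ(Z, V.1.1) := fun V =>
    (X V).mem_closedForms fun i j => by
      rw [(X V).lift_sum, (X V).lift_sum, ← he, ← he, ← sub_eq_zero, ← a_lie]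
      have : ⁅e V i, e V j⁆ = 0 :=
        congrArg (VectorFields.restrict (V.2.trans h₀)) (c.del_lie i j)
      rw [this, map_zero]
  refine ⟨⟨fun V => ⟨ω V, hω V⟩, fun V W h => Subtype.ext ?_⟩, fun V x => ?_⟩
  · change kaehlerMapAlg (res k h) (ω V) = ω W
    rw [map_sum]
    refine Finset.sum_congr rfl fun i _ => ?_
    rw [kaehlerMapAlg_smul_D, a_res]
    congr 2
    exact res_res k _ _ _
  · change (VectorFields.der x).liftKaehlerDifferential (ω V) = a V x
    conv_rhs => rw [c.vectorField_eq (V.2.trans h₀) x]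
    rw [map_sum, map_sum]
    refine Finset.sum_congr rfl fun i _ => ?_
    rw [map_smul, map_smul, Derivation.liftKaehlerDifferential_comp_D, smul_eq_mul, smul_eq_mul,
      mul_comm]
    rfl

/-- Forms on the twist of an open subset of a chart are the compatible families of additive maps
`a` on the vector fields with values in the functions killed by all vector fields and with
`a(f x) = f ^ p a(x)`. -/
theorem exists_twistSheaf [Smooth (Z ↘ Spec (.of k))]
    (a : ∀ V : {V : Z.affineOpens // V.1 ≤ V₀}, VectorFields k V.1.1 →+ Γ(Z, V.1.1))
    (a_res : ∀ (V W : {V : Z.affineOpens // V.1 ≤ V₀}) (h : W.1.1 ≤ V.1.1) (x),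
      res k h (a V x) = a W (VectorFields.restrict h x))
    (a_smul : ∀ V (f : Γ(Z, V.1.1)) (x : VectorFields k V.1.1), a V (f • x) = f ^ p * a V x)
    (a_der : ∀ V (x y : VectorFields k V.1.1), VectorFields.der x (a V y) = 0) :
    ∃ γ : (twistSheaf p k Z).obj (op V₀), ∀ V x, evTwist γ V x = a V x := by
  have hsm : ∀ V : {V : Z.affineOpens // V.1 ≤ V₀}, Algebra.Smooth k Γ(Z, V.1.1) :=
    fun V => smooth_sections V.1.2
  let e : ∀ (V : {V : Z.affineOpens // V.1 ≤ V₀}) (i : Fin n), VectorFields k V.1.1 := fun V i =>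
    VectorFields.restrict (V.2.trans h₀) (c.del i)
  let X : ∀ V : {V : Z.affineOpens // V.1 ≤ V₀}, Coordinates k Γ(Z, V.1.1) n := fun V =>
    c.coord V.1.2 (V.2.trans h₀)
  have he : ∀ V i, VectorFields.der (e V i) = (X V).d i := fun V i =>
    c.der_del V.1.2 (V.2.trans h₀) i
  -- Functions killed by all derivations come from the twist.
  have ht : ∀ V i, ∃ t : Twist p k Γ(Z, V.1.1), relFrob p k Γ(Z, V.1.1) t = a V (e V i) :=
    fun V i => (X V).exists_relFrob_eq fun j => by rw [← he, a_der]
  choose t ht using ht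
  let γ : ∀ V : {V : Z.affineOpens // V.1 ≤ V₀}, TwistForms p k Γ(Z, V.1.1) := fun V =>
    ∑ i, t V i • KaehlerDifferential.D (Frob p k k) (Twist p k Γ(Z, V.1.1)) (1 ⊗ₜ (X V).x i)
  have hγ : ∀ V x, twistPairing p (VectorFields.der x) (γ V) = a V x := fun V x => by
    conv_rhs => rw [c.vectorField_eq (V.2.trans h₀) x]
    have h1 : ∀ s : Finset (Fin n), twistPairing p (VectorFields.der x) (∑ i ∈ s, t V i •
        KaehlerDifferential.D (Frob p k k) (Twist p k Γ(Z, V.1.1)) (1 ⊗ₜ (X V).x i))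
        = ∑ i ∈ s, VectorFields.der x ((X V).x i) ^ p * a V (e V i) := fun s => by
      induction s using Finset.induction_on with
      | empty => simp [twistPairing_zero]
      | insert j s hj ih =>
        rw [Finset.sum_insert hj, Finset.sum_insert hj, twistPairing_add, ih, twistPairing_smul,
          twistPairing_D_one_tmul, ht, mul_comm]
    rw [h1, map_sum]
    exact Finset.sum_congr rfl fun i _ => (a_smul V _ _).symm
  refine ⟨⟨γ, fun V W h => ?_⟩, hγ⟩
  change kaehlerMapAlg (twistMap p k (res k h)) (γ V) = γ W
  refine (X W).twistForm_ext fun i => ?_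
  rw [← he, hγ, twistPairing_map (res k h) (VectorFields.der (e V i)) (VectorFields.der (e W i))
    fun f => (VectorFields.res_der h (e V i) f).symm, hγ, a_res]
  rfl

end Chart

end Evaluation

/-! ### Splittings of restricted Atiyah algebras -/

section Local

variable {p : ℕ} [hp : Fact p.Prime] {k : Type u} [Field k] [CharP k p]
  {Z : Scheme.{u}} [Z.Over (Spec (.of k))]

theorem iterate_prime_apply {α : Type*} (f : α → α) (a : α) : f^[p] a = f^[p - 1] (f a) := by
  rw [← Function.iterate_succ_apply, Nat.succ_eq_add_one, Nat.sub_add_cancel hp.out.one_le]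

namespace RestrictedAtiyahAlgebra

open VectorFields

variable (A : RestrictedAtiyahAlgebra p k Z) {U V : Z.Opens}

theorem br_zero (x : Γ(A.M, U)) : A.br U x 0 = 0 := by
  have := A.br_add U x 0 0
  rwa [add_zero, left_eq_add] at this

theorem br_skew (x y : Γ(A.M, U)) : A.br U x y = -A.br U y x := by
  have := A.br_self U (x + y)
  rw [A.add_br, A.br_add, A.br_add, A.br_self, A.br_self, zero_add, add_zero] at this
  exact eq_neg_of_add_eq_zero_left this

theorem br_neg (x y : Γ(A.M, U)) : A.br U x (-y) = -A.br U x y := by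
  have := A.br_add U x y (-y)
  rw [add_neg_cancel, A.br_zero] at this
  exact (neg_eq_of_add_eq_zero_right this.symm).symm

theorem br_sub (x y z : Γ(A.M, U)) : A.br U x (y - z) = A.br U x y - A.br U x z := by
  rw [sub_eq_add_neg, A.br_add, A.br_neg, ← sub_eq_add_neg]

theorem sub_br (x y z : Γ(A.M, U)) : A.br U (x - y) z = A.br U x z - A.br U y z := by
  rw [A.br_skew, A.br_sub, A.br_skew z x, A.br_skew z y]; abel

theorem br_sum {ι : Type*} (s : Finset ι) (x : Γ(A.M, U)) (y : ι → Γ(A.M, U)) :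
    A.br U x (∑ i ∈ s, y i) = ∑ i ∈ s, A.br U x (y i) :=
  map_sum (AddMonoidHom.mk' (A.br U x) (A.br_add U x)) y s

theorem anchor_incl (f : Γ(Z, U)) : A.anchor U (A.incl U f) = 0 :=
  (A.exact U _).mpr ⟨f, rfl⟩

theorem incl_br (f : Γ(Z, U)) (x : Γ(A.M, U)) :
    A.br U (A.incl U f) x = -A.incl U (der (A.anchor U x) f) := by
  rw [A.br_skew, A.br_incl]

theorem incl_br_incl (f g : Γ(Z, U)) : A.br U (A.incl U f) (A.incl U g) = 0 := by
  rw [A.br_incl, A.anchor_incl, der_zero]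
  exact map_zero _

theorem br_iterate_incl (x : Γ(A.M, U)) (n : ℕ) (f : Γ(Z, U)) :
    (A.br U x)^[n] (A.incl U f) = A.incl U ((der (A.anchor U x))^[n] f) := by
  induction n with
  | zero => rfl
  | succ n ih => rw [Function.iterate_succ_apply', Function.iterate_succ_apply', ih, A.br_incl]

theorem jacobsonCoeff_incl (g : Γ(Z, U)) (e : Γ(A.M, U)) (n j : ℕ) :
    jacobsonCoeff (A.br U) (A.incl U g) e n j
      = A.incl U (if j = 0 then (der (A.anchor U e))^[n] g else 0) := by
  induction n generalizing j with
  | zero => cases j <;> simp [jacobsonCoeff]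
  | succ n ih =>
    cases j with
    | zero => simp [jacobsonCoeff, ih, A.br_incl, Function.iterate_succ_apply']
    | succ j => simp [jacobsonCoeff, ih, A.incl_br_incl, A.br_zero]

/-- The effect on the `p`-operation of a change of a section by a function. -/
theorem pOp_incl_add (g : Γ(Z, U)) (e : Γ(A.M, U)) :
    A.pOp U (A.incl U g + e)
      = A.pOp U e + A.incl U (g ^ p + (der (A.anchor U e))^[p - 1] g) := by
  rw [A.pOp_add, A.pOp_incl, Finset.sum_eq_single 1]
  · rw [A.jacobsonCoeff_incl, if_pos (Nat.sub_self 1), Nat.cast_one, inv_one, map_one, one_smul,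
      map_add]
    abel
  · intro i hi h1
    have := (Finset.mem_Icc.mp hi).1
    rw [A.jacobsonCoeff_incl, if_neg (by omega), map_zero, smul_zero]
  · intro h
    exact absurd (Finset.mem_Icc.mpr ⟨le_rfl, by have := hp.out.two_le; omega⟩) h

theorem exists_incl_eq {x y : Γ(A.M, U)} (h : A.anchor U x = A.anchor U y) :
    ∃ f, A.incl U f = x - y :=
  (A.exact U _).mp (by rw [map_sub, h, sub_self])

section Chart

variable {n : ℕ} (c : Chart k U n)

theorem der_del_self (i j : Fin n) : der (c.del i) (c.X.x j) = if i = j then 1 else 0 := by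
  have := c.der_del_x le_rfl i j
  rwa [restrict_refl, res_refl] at this

/-- Lifts of the coordinate vector fields can be changed by functions such that their `p`-operations
become constants. -/
theorem exists_lift_pOp (e : Fin n → Γ(A.M, U)) (he : ∀ i, A.anchor U (e i) = c.del i) :
    ∃ (e' : Fin n → Γ(A.M, U)) (q : Fin n → Γ(Z, U)), (∀ i, A.anchor U (e' i) = c.del i) ∧
      (∀ i, A.pOp U (e' i) = A.incl U (q i)) ∧ ∀ i (x : VectorFields k U), der x (q i) = 0 := by
  have h1 : ∀ i, ∃ h, A.incl U h = A.pOp U (e i) := fun i =>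
    (A.exact U _).mp (by rw [A.anchor_pOp, he, c.pPow_del])
  choose h hh using h1
  have h2 : ∀ i, der (c.del i) (h i) = 0 := fun i => by
    have h3 := A.pOp_br U (e i) (e i)
    rw [iterate_prime_apply, A.br_self, ← hh, A.incl_br, he] at h3
    have h4 : (A.br U (e i))^[p - 1] 0 = 0 := by
      rw [← map_zero (A.incl U), A.br_iterate_incl, iterate_map_zero']
    rw [h4, neg_eq_zero, ← map_zero (A.incl U)] at h3
    exact A.incl_injective U h3
  have hpow : ∀ i, (der (c.del i))^[p - 1] (c.X.x i ^ (p - 1)) = -1 := fun i => by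
    have h3 := iterate_pow_pred_mul (p := p) (der (c.del i)) (c.X.x i)
    rw [der_del_self, if_pos rfl, mul_one, one_pow, ← powDerivation_apply p, ← der_pPow, c.pPow_del,
      der_zero] at h3
    rw [eq_neg_iff_add_eq_zero, h3]
    exact mul_zero _
  -- Since `∂ᵢ hᵢ = 0` and `∂ᵢ ^ (p - 1) xᵢ ^ (p - 1) = -1`, adding `hᵢ xᵢ ^ (p - 1)` to `eᵢ`
  -- changes `eᵢ ^ [p] = hᵢ` into the `p`-th power of `hᵢ xᵢ ^ (p - 1)`.
  refine ⟨fun i => A.incl U (h i * c.X.x i ^ (p - 1)) + e i,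
    fun i => (h i * c.X.x i ^ (p - 1)) ^ p, fun i => ?_, fun i => ?_, fun i x => ?_⟩
  · rw [map_add, A.anchor_incl, zero_add, he]
  · rw [A.pOp_incl_add, he, iterate_mul_of_apply_eq_zero _ (h2 i), hpow, ← hh, ← map_add]
    congr 1
    ring
  · exact derivation_pow_char p _ _

/-- Lifts of the coordinate vector fields can be changed by functions such that they commute. -/
theorem exists_commuting_lift (e : Fin n → Γ(A.M, U)) (he : ∀ i, A.anchor U (e i) = c.del i) :
    ∃ e' : Fin n → Γ(A.M, U), (∀ i, A.anchor U (e' i) = c.del i) ∧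
      ∀ i j, A.br U (e' i) (e' j) = 0 := by
  obtain ⟨e, q, he, hpe, hq⟩ := A.exists_lift_pOp c e he
  have h1 : ∀ i j, ∃ F, A.incl U F = A.br U (e i) (e j) := fun i j =>
    (A.exact U _).mp (by rw [A.anchor_br, he, he, c.del_lie])
  choose F hF using h1
  -- The functions `Fᵢⱼ = [eᵢ, eⱼ]` are the components of a closed `2`-form, by the Jacobi identity.
  -- As `eᵢ ^ [p]` is a constant, `ad(eᵢ) ^ p (eⱼ) = 0`, which says that `∂ᵢ ^ (p - 1) Fᵢⱼ = 0`.
  obtain ⟨g, hg⟩ := exists_primitive_two (p := p) (x := c.X.x) (d := fun i => der (c.del i))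
    (der_del_self c)
    (fun i j a => by
      have := congrArg (fun x => der x a) (c.del_lie i j)
      exact sub_eq_zero.mp this)
    (fun i a => by rw [← powDerivation_apply, ← der_pPow, c.pPow_del]; rfl)
    F
    (fun i => A.incl_injective U (by rw [hF, A.br_self, map_zero]))
    (fun i j => A.incl_injective U (by rw [hF, map_neg, hF, A.br_skew]))
    (fun i j l => A.incl_injective U (by
      have h2 : ∀ i j l, A.incl U (der (c.del i) (F j l)) = A.br U (e i) (A.br U (e j) (e l)) :=
        fun i j l => by rw [← hF, A.br_incl, he]
      rw [map_add, map_add, h2, h2, h2, A.jacobi, A.br_skew (A.br U (e i) (e j)), map_zero,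
        A.br_skew (e l) (e i), A.br_neg]
      abel))
    (fun i j => A.incl_injective U (by
      have h2 := A.pOp_br U (e i) (e j)
      rw [hpe, A.incl_br, hq, map_zero, neg_zero, iterate_prime_apply, ← hF, A.br_iterate_incl,
        he] at h2
      rw [map_zero]
      exact h2.symm))
  refine ⟨fun i => e i - A.incl U (g i), fun i => ?_, fun i j => ?_⟩
  · rw [map_sub, A.anchor_incl, sub_zero, he]
  · rw [A.br_sub, A.sub_br, A.sub_br, A.incl_br_incl, A.br_incl, A.incl_br, he, he, ← hF, hg]
    simp only [map_sub]
    abel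

/-- The linear map that sends the coordinate vector fields to given sections. -/
def linearLift (e : Fin n → Γ(A.M, U)) {V : Z.Opens} (h : V ≤ U) :
    VectorFields k V →ₗ[Γ(Z, V)] Γ(A.M, V) where
  toFun x := ∑ i, der x (res k h (c.X.x i)) • resM A.M h (e i)
  map_add' x y := by
    simp only [der_add, Derivation.add_apply, add_smul, Finset.sum_add_distrib]
  map_smul' f x := by
    simp only [der_smul, Derivation.smul_apply, smul_eq_mul, mul_smul, Finset.smul_sum,
      RingHom.id_apply]

theorem linearLift_apply (e : Fin n → Γ(A.M, U)) (h : V ≤ U) (x : VectorFields k V) :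
    A.linearLift c e h x = ∑ i, der x (res k h (c.X.x i)) • resM A.M h (e i) := rfl

theorem anchor_linearLift (e : Fin n → Γ(A.M, U)) (he : ∀ i, A.anchor U (e i) = c.del i)
    (h : V ≤ U) (x : VectorFields k V) : A.anchor V (A.linearLift c e h x) = x := by
  conv_rhs => rw [c.vectorField_eq h x]
  rw [linearLift_apply, map_sum]
  refine Finset.sum_congr rfl fun i _ => ?_
  rw [map_smul, ← A.anchor_res, he]

/-- The splitting of the anchor map given by commuting lifts of the coordinate vector fields. -/
def splittingOfLift (e : Fin n → Γ(A.M, U)) (he : ∀ i, A.anchor U (e i) = c.del i)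
    (hcomm : ∀ i j, A.br U (e i) (e j) = 0) : A.LieSplitting U where
  σ V h := A.linearLift c e h
  σ_res V W h h' x := by
    rw [linearLift_apply, linearLift_apply, map_sum]
    refine Finset.sum_congr rfl fun i _ => ?_
    rw [resM_smul (k := k), resM_resM, res_der, res_res]
  anchor_σ V h x := A.anchor_linearLift c e he h x
  σ_lie V h x y := by
    have hbr : ∀ (x : VectorFields k V) (j : Fin n),
        A.br V (A.linearLift c e h x) (resM A.M h (e j))
          = -∑ i, der (restrict h (c.del j)) (der x (res k h (c.X.x i))) • resM A.M h (e i) := by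
      intro x j
      rw [A.br_skew, linearLift_apply, A.br_sum, neg_inj]
      refine Finset.sum_congr rfl fun i _ => ?_
      rw [A.br_smul, ← A.br_res, hcomm, map_zero, smul_zero, zero_add, ← A.anchor_res, he]
    rw [linearLift_apply, A.linearLift_apply c e h y, A.br_sum]
    simp only [A.br_smul, Finset.sum_add_distrib, A.anchor_linearLift c e he]
    have h1 : ∑ j, der y (res k h (c.X.x j)) • A.br V (A.linearLift c e h x) (resM A.M h (e j))
        = -∑ i, der y (der x (res k h (c.X.x i))) • resM A.M h (e i) := by
      simp only [hbr, smul_neg, Finset.sum_neg_distrib, neg_inj, Finset.smul_sum]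
      rw [Finset.sum_comm]
      refine Finset.sum_congr rfl fun i _ => ?_
      conv_rhs => rw [c.vectorField_eq h y, der_sum, derivation_sum_apply, Finset.sum_smul]
      refine Finset.sum_congr rfl fun j _ => ?_
      rw [der_smul, Derivation.smul_apply, smul_eq_mul, mul_smul]
    refine Eq.trans ?_ (congrArg₂ (· + ·) h1.symm rfl)
    rw [neg_add_eq_sub, ← Finset.sum_sub_distrib]
    refine Finset.sum_congr rfl fun i _ => ?_
    rw [der_lie, Derivation.commutator_apply, sub_smul]

end Chart

/-- Every point has a neighbourhood that is a chart over which the anchor map has a splitting which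
respects the Lie brackets. -/
theorem exists_lieSplitting [Smooth (Z ↘ Spec (.of k))] (z : Z) :
    ∃ U : Z.Opens, z ∈ U ∧ ∃ n, Nonempty (Chart k U n) ∧ Nonempty (A.LieSplitting U) := by
  obtain ⟨U, hz, -, n, ⟨c⟩⟩ := exists_chart (k := k) (U := ⊤) (z := z) trivial
  -- Local lifts of the coordinate vector fields exist on a common affine neighbourhood.
  have h1 := fun i => A.anchor_surjective U (c.del i) z hz
  choose V hVU hzV e he using h1
  have hzW : z ∈ U ⊓ Finset.univ.inf V := ⟨hz, by
    rw [SetLike.mem_coe]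
    induction (Finset.univ : Finset (Fin n)) using Finset.induction_on with
    | empty => simp
    | insert i s hi ih => rw [Finset.inf_insert]; exact ⟨hzV i, ih⟩⟩
  obtain ⟨W, hzW, hW⟩ := exists_affine_le hzW
  have hWU : W.1 ≤ U := hW.trans inf_le_left
  have hWV : ∀ i, W.1 ≤ V i := fun i =>
    (hW.trans inf_le_right).trans (Finset.inf_le (Finset.mem_univ i))
  let c' : Chart k W.1 n := ⟨W.2, c.coord W.2 hWU⟩
  obtain ⟨e', he', hcomm⟩ := A.exists_commuting_lift c' (fun i => resM A.M (hWV i) (e i))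
    fun i => by
      rw [← A.anchor_res, he, restrict_restrict]
      refine c'.vectorField_ext le_rfl fun j => ?_
      rw [res_refl, der_del_self]
      exact c.der_del_x hWU i j
  exact ⟨W.1, hzW, n, ⟨c'⟩, ⟨A.splittingOfLift c' e' he' hcomm⟩⟩

end RestrictedAtiyahAlgebra

end Local

section Splittings

variable {p : ℕ} [hp : Fact p.Prime] {k : Type u} [Field k] [CharP k p]
  {Z : Scheme.{u}} [Z.Over (Spec (.of k))]

theorem jacobsonCoeff_map {L L' : Type*} [AddCommGroup L] [AddCommGroup L'] {br : L → L → L}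
    {br' : L' → L' → L'} (φ : L →+ L') (h : ∀ x y, φ (br x y) = br' (φ x) (φ y)) (x y : L)
    (n j : ℕ) : φ (jacobsonCoeff br x y n j) = jacobsonCoeff br' (φ x) (φ y) n j := by
  induction n generalizing j with
  | zero => cases j <;> simp [jacobsonCoeff]
  | succ n ih => cases j <;> simp [jacobsonCoeff, ih, h]

namespace RestrictedAtiyahAlgebra.LieSplitting

open VectorFields

variable {A : RestrictedAtiyahAlgebra p k Z} {U U' V W : Z.Opens}

theorem exists_pCurv (s : A.LieSplitting U) (h : V ≤ U) (x : VectorFields k V) :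
    ∃ f, A.incl V f = A.pOp V (s.σ V h x) - s.σ V h (pPow p x) :=
  A.exists_incl_eq (by rw [A.anchor_pOp, s.anchor_σ, s.anchor_σ])

/-- The `p`-curvature `σ(x) ^ [p] - σ(x ^ p)` of a splitting `σ`. -/
def pCurv (s : A.LieSplitting U) (h : V ≤ U) (x : VectorFields k V) : Γ(Z, V) :=
  (s.exists_pCurv h x).choose

theorem incl_pCurv (s : A.LieSplitting U) (h : V ≤ U) (x : VectorFields k V) :
    A.incl V (s.pCurv h x) = A.pOp V (s.σ V h x) - s.σ V h (pPow p x) :=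
  (s.exists_pCurv h x).choose_spec

theorem res_pCurv (s : A.LieSplitting U) (h : V ≤ U) (h' : W ≤ V) (x : VectorFields k V) :
    res k h' (s.pCurv h x) = s.pCurv (h'.trans h) (restrict h' x) := by
  apply A.incl_injective
  rw [← A.incl_res, incl_pCurv, incl_pCurv, map_sub, A.pOp_res, s.σ_res, s.σ_res, restrict_pPow]

/-- The `p`-curvature is additive, by Jacobson's formula in `A` and, through the anchor map, for
vector fields. -/
theorem pCurv_add (s : A.LieSplitting U) (h : V ≤ U) (x y : VectorFields k V) :
    s.pCurv h (x + y) = s.pCurv h x + s.pCurv h y := by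
  have h1 := A.pOp_add V (s.σ V h x) (s.σ V h y)
  have hmap : ∀ j, jacobsonCoeff (A.br V) (s.σ V h x) (s.σ V h y) (p - 1) j
      = s.σ V h (jacobsonCoeff (fun x y => ⁅x, y⁆) x y (p - 1) j) := fun j =>
    (jacobsonCoeff_map (s.σ V h).toAddMonoidHom (s.σ_lie V h) x y _ j).symm
  simp only [hmap, ← map_smul, ← map_sum] at h1
  have h2 := congrArg (A.anchor V) h1
  rw [← map_add (s.σ V h), A.anchor_pOp, s.anchor_σ, map_add, map_add, A.anchor_pOp, A.anchor_pOp,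
    s.anchor_σ, s.anchor_σ, s.anchor_σ] at h2
  apply A.incl_injective
  rw [map_add, incl_pCurv, incl_pCurv, incl_pCurv, map_add (s.σ V h), h1, h2]
  simp only [map_add]
  abel

/-- The `p`-curvature is `p`-linear, by Hochschild's formula in `A` and, through the anchor map, for
vector fields. -/
theorem pCurv_smul (s : A.LieSplitting U) (h : V ≤ U) (f : Γ(Z, V)) (x : VectorFields k V) :
    s.pCurv h (f • x) = f ^ p * s.pCurv h x := by
  have hσ := (s.σ V h).map_smul
  have hτ := (A.anchor V).map_smul
  have h1 := A.pOp_smul V f (s.σ V h x)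
  rw [← hσ, s.anchor_σ] at h1
  generalize (der (f • x))^[p - 1] f = g at h1
  have h2 := congrArg (A.anchor V) h1
  rw [A.anchor_pOp, s.anchor_σ, (A.anchor V).map_add, hτ, hτ, A.anchor_pOp, s.anchor_σ] at h2
  apply A.incl_injective
  have h3 : A.incl V (f ^ p * s.pCurv h x) = f ^ p • A.incl V (s.pCurv h x) :=
    (A.incl V).map_smul _ _
  rw [h3, incl_pCurv, incl_pCurv, h1, h2, (s.σ V h).map_add, hσ, hσ, smul_sub]
  abel

/-- The values of the `p`-curvature are killed by all vector fields, since
`[σ(y) ^ [p], σ(x)] = ad(σ(y)) ^ p (σ(x))` is the image under `σ` of `[y ^ p, x]`. -/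
theorem der_pCurv (s : A.LieSplitting U) (h : V ≤ U) (x y : VectorFields k V) :
    der x (s.pCurv h y) = 0 := by
  have h1 := A.pOp_br V (s.σ V h y) (s.σ V h x)
  have h2 : ∀ n, (A.br V (s.σ V h y))^[n] (s.σ V h x) = s.σ V h ((fun z => ⁅y, z⁆)^[n] x) := by
    intro n
    induction n with
    | zero => rfl
    | succ n ih => rw [Function.iterate_succ_apply', Function.iterate_succ_apply', ih, s.σ_lie]
  rw [h2] at h1
  have h3 := congrArg (A.anchor V) h1
  rw [A.anchor_br, A.anchor_pOp, s.anchor_σ, s.anchor_σ, s.anchor_σ] at h3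
  apply A.incl_injective
  have h4 := A.br_incl V (s.σ V h x) (s.pCurv h y)
  rw [s.anchor_σ] at h4
  rw [← h4, incl_pCurv, A.br_sub, A.br_skew, h1, ← h3, s.σ_lie, A.br_skew (s.σ V h x), map_zero]
  abel

/-- The `p`-curvature of a splitting over a chart is a `1`-form on the Frobenius twist. -/
theorem exists_evTwist_eq [Smooth (Z ↘ Spec (.of k))] (s : A.LieSplitting U) {n : ℕ}
    (c : Chart k U n) : ∃ γ : (twistSheaf p k Z).obj (op U), ∀ V x,
      evTwist γ V x = s.pCurv V.2 x :=
  exists_twistSheaf c le_rfl (fun V => AddMonoidHom.mk' (s.pCurv V.2) (s.pCurv_add V.2))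
    (fun V _ h x => s.res_pCurv V.2 h x) (fun V f x => s.pCurv_smul V.2 f x)
    (fun V x y => s.der_pCurv V.2 x y)

theorem exists_diff (s : A.LieSplitting U) (t : A.LieSplitting U') (h : V ≤ U) (h' : V ≤ U')
    (x : VectorFields k V) : ∃ f, A.incl V f = s.σ V h x - t.σ V h' x :=
  A.exists_incl_eq (by rw [s.anchor_σ, t.anchor_σ])

/-- The difference of two splittings, as a linear form on vector fields. -/
def diff (s : A.LieSplitting U) (t : A.LieSplitting U') (h : V ≤ U) (h' : V ≤ U') :
    VectorFields k V →ₗ[Γ(Z, V)] Γ(Z, V) where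
  toFun x := (s.exists_diff t h h' x).choose
  map_add' x y := A.incl_injective V (by
    rw [map_add (A.incl V),
      (s.exists_diff t h h' _).choose_spec, (s.exists_diff t h h' _).choose_spec,
      (s.exists_diff t h h' _).choose_spec, map_add, map_add]
    abel)
  map_smul' f x := A.incl_injective V (by
    rw [map_smul (A.incl V), (s.exists_diff t h h' _).choose_spec,
      (s.exists_diff t h h' _).choose_spec,
      map_smul, map_smul, smul_sub]
    rfl)

theorem incl_diff (s : A.LieSplitting U) (t : A.LieSplitting U') (h : V ≤ U) (h' : V ≤ U')
    (x : VectorFields k V) : A.incl V (s.diff t h h' x) = s.σ V h x - t.σ V h' x :=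
  (s.exists_diff t h h' x).choose_spec

theorem res_diff (s : A.LieSplitting U) (t : A.LieSplitting U') (h : V ≤ U) (h' : V ≤ U')
    (hW : W ≤ V) (x : VectorFields k V) :
    res k hW (s.diff t h h' x) = s.diff t (hW.trans h) (hW.trans h') (restrict hW x) := by
  apply A.incl_injective
  rw [← A.incl_res, incl_diff, incl_diff, map_sub, s.σ_res, t.σ_res]

theorem diff_lie (s : A.LieSplitting U) (t : A.LieSplitting U') (h : V ≤ U) (h' : V ≤ U')
    (x y : VectorFields k V) :
    s.diff t h h' ⁅x, y⁆ = der x (s.diff t h h' y) - der y (s.diff t h h' x) := by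
  have hσ : ∀ x, s.σ V h x = A.incl V (s.diff t h h' x) + t.σ V h' x := fun x => by
    rw [incl_diff, sub_add_cancel]
  apply A.incl_injective
  rw [incl_diff, s.σ_lie, t.σ_lie, hσ, hσ, A.br_add, A.add_br, A.add_br, A.incl_br_incl,
    A.incl_br, A.br_incl, t.anchor_σ, t.anchor_σ, map_sub]
  abel

/-- The difference of the `p`-curvatures of two splittings. -/
theorem pCurv_sub_pCurv (s : A.LieSplitting U) (t : A.LieSplitting U') (h : V ≤ U) (h' : V ≤ U')
    (x : VectorFields k V) : s.pCurv h x - t.pCurv h' x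
      = s.diff t h h' x ^ p - (s.diff t h h' (pPow p x)
        - (der x)^[p - 1] (s.diff t h h' x)) := by
  have hσ : ∀ x, s.σ V h x = A.incl V (s.diff t h h' x) + t.σ V h' x := fun x => by
    rw [incl_diff, sub_add_cancel]
  apply A.incl_injective
  rw [map_sub, incl_pCurv, incl_pCurv, hσ, hσ, A.pOp_incl_add, t.anchor_σ]
  simp only [map_sub, map_add]
  abel

/-- If `α` is the difference of two splittings, then `α' - C(α)` is the difference of their
`p`-curvatures. -/
theorem evTwist_atiyahComplex_eq [Smooth (Z ↘ Spec (.of k))] (s : A.LieSplitting U)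
    (t : A.LieSplitting U') {V₀ : Z.Opens} (h : V₀ ≤ U) (h' : V₀ ≤ U')
    (α : (closedSheaf k Z).obj (op V₀)) (V : {V : Z.affineOpens // V.1 ≤ V₀})
    (hα : ∀ x, evForm α V x = s.diff t (V.2.trans h) (V.2.trans h') x)
    (x : VectorFields k V.1.1) :
    evTwist (((atiyahComplex p k Z).app (op V₀)).hom α) V x
      = s.pCurv (V.2.trans h) x - t.pCurv (V.2.trans h') x := by
  rw [evTwist_atiyahComplex, hα, hα, pCurv_sub_pCurv]

/-- The difference of two splittings over an open subset of a chart is a closed `1`-form. -/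
theorem exists_evForm_eq {U₀ V₀ : Z.Opens} (s : A.LieSplitting U) (t : A.LieSplitting U') {n : ℕ}
    (c : Chart k U₀ n) (h₀ : V₀ ≤ U₀) (h : V₀ ≤ U) (h' : V₀ ≤ U') :
    ∃ α : (closedSheaf k Z).obj (op V₀), ∀ V x,
      evForm α V x = s.diff t (V.2.trans h) (V.2.trans h') x :=
  exists_closedSheaf c h₀ (fun V => s.diff t (V.2.trans h) (V.2.trans h'))
    (fun _ _ hW x => s.res_diff t _ _ hW x) (fun _ x y => s.diff_lie t _ _ x y)

end RestrictedAtiyahAlgebra.LieSplitting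

namespace RestrictedAtiyahAlgebra

open VectorFields

variable {A : RestrictedAtiyahAlgebra p k Z}

/-- Cocycles of a restricted Atiyah algebra in terms of differences and `p`-curvatures of
splittings. -/
theorem isCocycleOf_iff (c : Cocycle (atiyahComplex p k Z)) :
    A.IsCocycleOf c ↔ ∃ s : ∀ i, A.LieSplitting (c.U i),
      (∀ (i j : c.ι) V x, (s i).diff (s j) (V.2.trans inf_le_left) (V.2.trans inf_le_right) x
        = evForm (c.α i j) V x) ∧
      ∀ (i : c.ι) V x, (s i).pCurv V.2 x = evTwist (c.γ i) V x := by
  refine exists_congr fun s => and_congr ?_ ?_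
  · refine forall_congr' fun i => forall_congr' fun j => forall_congr' fun V =>
      forall_congr' fun x => ?_
    rw [← LieSplitting.incl_diff]
    exact (A.incl_injective V.1).eq_iff
  · refine forall_congr' fun i => forall_congr' fun V => forall_congr' fun x => ?_
    rw [← LieSplitting.incl_pCurv]
    exact (A.incl_injective V.1).eq_iff

/-- Every restricted Atiyah algebra has a cocycle. -/
theorem exists_isCocycleOf [Smooth (Z ↘ Spec (.of k))] (A : RestrictedAtiyahAlgebra p k Z) :
    ∃ c, A.IsCocycleOf c := by
  -- The cover is indexed by the points of `Z`.
  choose U hU n c s using A.exists_lieSplitting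
  replace c := fun z => (c z).some
  replace s := fun z => (s z).some
  choose α hα using fun i j : Z => (s i).exists_evForm_eq (s j) (c i)
    (inf_le_left : U i ⊓ U j ≤ U i) inf_le_left inf_le_right
  choose γ hγ using fun i => (s i).exists_evTwist_eq (c i)
  refine ⟨⟨Z, U, fun z => ⟨z, hU z⟩, α, γ, fun i j l W hi hj hl => ?_, fun i j => ?_⟩,
    (isCocycleOf_iff _).mpr ⟨s, fun i j V x => (hα i j V x).symm, fun i V x => (hγ i V x).symm⟩⟩
  · refine closedSheaf_ext (c i) hi fun V x => ?_
    rw [evForm_add, evForm_rst, evForm_rst, evForm_rst, hα, hα, hα]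
    apply A.incl_injective
    rw [map_add, LieSplitting.incl_diff, LieSplitting.incl_diff, LieSplitting.incl_diff]
    exact sub_add_sub_cancel _ _ _
  · refine twistSheaf_ext (c i) inf_le_left fun V x => ?_
    rw [evTwist_sub, evTwist_rst, evTwist_rst, hγ, hγ]
    exact ((s i).evTwist_atiyahComplex_eq (s j) inf_le_left inf_le_right (α i j) V (hα i j V)
      x).symm

/-- Two cocycles of a restricted Atiyah algebra are cohomologous. -/
theorem cohomologous_of_isCocycleOf [Smooth (Z ↘ Spec (.of k))]
    {c c' : Cocycle (atiyahComplex p k Z)} (h : A.IsCocycleOf c) (h' : A.IsCocycleOf c') :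
    Cohomologous c c' := by
  obtain ⟨s, hs, hs'⟩ := (isCocycleOf_iff c).mp h
  obtain ⟨t, ht, ht'⟩ := (isCocycleOf_iff c').mp h'
  choose r hr using c.cover
  choose r' hr' using c'.cover
  choose W hzW hW n e using fun z : Z => exists_chart (k := k) (U := c.U (r z) ⊓ c'.U (r' z))
    (z := z) ⟨hr z, hr' z⟩
  replace e := fun z => (e z).some
  have hWU : ∀ z, W z ≤ c.U (r z) := fun z => (hW z).trans inf_le_left
  have hWU' : ∀ z, W z ≤ c'.U (r' z) := fun z => (hW z).trans inf_le_right
  -- On common charts of the two covers, `b` is the difference of the two splittings.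
  choose b hb using fun z => (s (r z)).exists_evForm_eq (t (r' z)) (e z) le_rfl (hWU z) (hWU' z)
  refine ⟨Z, W, fun z => ⟨z, hzW z⟩, r, r', hWU, hWU', b, fun m n => ?_, fun m => ?_⟩
  · refine closedSheaf_ext (e m) inf_le_left fun V x => ?_
    rw [evForm_sub, evForm_sub, evForm_rst, evForm_rst, evForm_rst, evForm_rst, hb, hb, ← hs, ← ht]
    apply A.incl_injective
    simp only [map_sub, LieSplitting.incl_diff]
    abel
  · refine twistSheaf_ext (e m) le_rfl fun V x => ?_
    rw [evTwist_sub, evTwist_rst, evTwist_rst,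
      (s (r m)).evTwist_atiyahComplex_eq (t (r' m)) (hWU m) (hWU' m) (b m) V (hb m V)]
    exact congrArg₂ (· - ·) (hs' (r m) ⟨V.1, _⟩ x).symm (ht' (r' m) ⟨V.1, _⟩ x).symm

theorem resM_app {M N : Z.Modules} (φ : M ⟶ N) {U V : Z.Opens} (h : V ≤ U) (y : Γ(M, U)) :
    resM N h (φ.app U y) = φ.app V (resM M h y) :=
  (NatTrans.naturality_apply φ.mapPresheaf (homOfLE h).op y).symm

/-- The image of a splitting under an isomorphism of restricted Atiyah algebras. -/
def LieSplitting.map {B : RestrictedAtiyahAlgebra p k Z} {U : Z.Opens} (s : A.LieSplitting U)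
    (e : A.M ⟶ B.M)
    (he : ∀ (U : Z.Opens) (x y : Γ(A.M, U)), e.app U (A.br U x y) = B.br U (e.app U x) (e.app U y))
    (he' : ∀ (U : Z.Opens) (x : Γ(A.M, U)), B.anchor U (e.app U x) = A.anchor U x) :
    B.LieSplitting U where
  σ V h :=
    { toFun := fun x => e.app V (s.σ V h x)
      map_add' := fun x y =>
        (congrArg (e.app V) ((s.σ V h).map_add x y)).trans (map_add (e.app V).hom _ _)
      map_smul' := fun f x =>
        (congrArg (e.app V) ((s.σ V h).map_smul f x)).trans (Scheme.Modules.Hom.app_smul _ _ _) }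
  σ_res V W h h' x := (resM_app e h' _).trans (congrArg (e.app W) (s.σ_res V W h h' x))
  anchor_σ V h x := (he' V _).trans (s.anchor_σ V h x)
  σ_lie V h x y := (congrArg (e.app V) (s.σ_lie V h x y)).trans (he V _ _)

/-- Isomorphic restricted Atiyah algebras have the same cocycles. -/
theorem IsCocycleOf.of_isomorphic {B : RestrictedAtiyahAlgebra p k Z}
    {c : Cocycle (atiyahComplex p k Z)} (h : A.IsCocycleOf c) (hAB : Isomorphic A B) :
    B.IsCocycleOf c := by
  obtain ⟨e, he⟩ := hAB
  obtain ⟨s, hs, hs'⟩ := h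
  have hsub : ∀ (V : Z.Opens) (x y : Γ(A.M, V)),
      e.hom.app V (x - y) = e.hom.app V x - e.hom.app V y := fun V x y =>
    map_sub (e.hom.app V).hom x y
  refine ⟨fun i => (s i).map e.hom (fun U => (he U).1) (fun U => (he U).2.2.1),
    fun i j V x => ?_, fun i V x => ?_⟩
  · have h1 := congrArg (e.hom.app V.1.1) (hs i j V x)
    rw [hsub] at h1
    exact h1.trans ((he V.1).2.2.2 _)
  · have h1 := congrArg (e.hom.app V.1.1) (hs' i V x)
    rw [hsub, (he V.1).2.1] at h1
    exact h1.trans ((he V.1).2.2.2 _)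

end RestrictedAtiyahAlgebra

end Splittings

/-! ### Cohomologous cocycles give isomorphic restricted Atiyah algebras -/

section HomGluing

variable {Z : Scheme.{u}}

theorem resM_smul_map (M : Z.Modules) {U V : Z.Opens} (h : V ≤ U) (f : Γ(Z, U)) (x : Γ(M, U)) :
    resM M h (f • x) = (Z.presheaf.map (homOfLE h).op).hom f • resM M h x :=
  Scheme.Modules.map_smul M (homOfLE h) f x

/-- Morphisms of sheaves of modules can be glued from linear maps over the members of an affine
cover. -/
theorem AffineCover.exists_hom {M N : Z.Modules} {P : Z.affineOpens → Prop}
    (h : AffineCover ⊤ P) (φ : ∀ V : {V // P V}, Γ(M, V.1.1) →ₗ[Γ(Z, V.1.1)] Γ(N, V.1.1))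
    (hφ : ∀ (V W : {V // P V}) (h : W.1.1 ≤ V.1.1) (y : Γ(M, V.1.1)),
      resM N h (φ V y) = φ W (resM M h y)) :
    ∃ Φ : M ⟶ N, ∀ (V : {V // P V}) (y : Γ(M, V.1.1)), Φ.app V.1.1 y = φ V y := by
  have key : ∀ (U : Z.Opens) (y : Γ(M, U)), ∃ w : Γ(N, U), ∀ (V : {V // P V}) (hV : V.1.1 ≤ U),
      resM N hV w = φ V (resM M hV y) := fun U y => by
    obtain ⟨w, hw, -⟩ := (h.inf (le_top : U ≤ ⊤)).existsUnique_resM N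
      (fun V => φ ⟨V.1, V.2.1⟩ (resM M V.2.2 y)) (fun V W hW => by
        rw [hφ ⟨V.1, V.2.1⟩ ⟨W.1, W.2.1⟩ hW, resM_resM])
    exact ⟨w, fun V hV => hw ⟨V.1, V.2, hV⟩⟩
  choose w hw using key
  have hext : ∀ (U : Z.Opens) (a b : Γ(N, U)),
      (∀ (V : {V // P V}) (hV : V.1.1 ≤ U), resM N hV a = resM N hV b) → a = b :=
    fun U a b hab => (h.inf le_top).ext_resM N fun V hV => hab ⟨V, hV.1⟩ hV.2
  have hadd : ∀ (U : Z.Opens) (a b : Γ(M, U)), w U (a + b) = w U a + w U b := fun U a b =>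
    hext _ _ _ fun V hV => by
      rw [(resM N hV).map_add, hw, hw, hw, (resM M hV).map_add, (φ V).map_add]
  let Ψ : M.presheaf ⟶ N.presheaf :=
    { app := fun U => AddCommGrpCat.ofHom
        (show Γ(M, U.unop) →+ Γ(N, U.unop) from AddMonoidHom.mk' (w U.unop) (hadd U.unop))
      naturality := fun U U' i => by
        ext y
        refine hext U'.unop _ _ fun V hV => ?_
        change resM N hV (w U'.unop (resM M i.unop.le y))
          = resM N hV (resM N i.unop.le (w U.unop y))
        rw [hw, resM_resM, resM_resM, hw] }
  refine ⟨⟨PresheafOfModules.homMk Ψ fun U r y => ?_⟩, fun V y => ?_⟩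
  · let U' : Z.Opens := U.unop
    let r' : Γ(Z, U') := r
    let y' : Γ(M, U') := y
    change w U' (r' • y') = r' • w U' y'
    refine hext _ _ _ fun V hV => ?_
    rw [hw, resM_smul_map, resM_smul_map, hw, (φ V).map_smul]
  · change w V.1.1 y = φ V y
    have := hw V.1.1 y V le_rfl
    rwa [resM_refl, resM_refl] at this

end HomGluing

section Comparison

variable {p : ℕ} [hp : Fact p.Prime] {k : Type u} [Field k] [CharP k p]
  {Z : Scheme.{u}} [Z.Over (Spec (.of k))]

namespace RestrictedAtiyahAlgebra

open VectorFields

namespace LieSplitting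

variable {A B : RestrictedAtiyahAlgebra p k Z} {U U' V W : Z.Opens}

/-- Restriction of a splitting. -/
def restrict (s : A.LieSplitting U) (h : U' ≤ U) : A.LieSplitting U' where
  σ V hV := s.σ V (hV.trans h)
  σ_res V W hV hW x := s.σ_res V W (hV.trans h) hW x
  anchor_σ V hV x := s.anchor_σ V (hV.trans h) x
  σ_lie V hV x y := s.σ_lie V (hV.trans h) x y

theorem exists_coef (s : A.LieSplitting U) (h : V ≤ U) (y : Γ(A.M, V)) :
    ∃ f, A.incl V f = y - s.σ V h (A.anchor V y) :=
  A.exists_incl_eq (by rw [s.anchor_σ])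

/-- The function `f` in the decomposition `y = σ(τ(y)) + f`. -/
def coef (s : A.LieSplitting U) (h : V ≤ U) : Γ(A.M, V) →ₗ[Γ(Z, V)] Γ(Z, V) where
  toFun y := (s.exists_coef h y).choose
  map_add' x y := A.incl_injective V (by
    rw [(A.incl V).map_add, (s.exists_coef h _).choose_spec, (s.exists_coef h _).choose_spec,
      (s.exists_coef h _).choose_spec, (A.anchor V).map_add, (s.σ V h).map_add]
    abel)
  map_smul' f x := A.incl_injective V (by
    rw [(A.incl V).map_smul, (s.exists_coef h _).choose_spec, (s.exists_coef h _).choose_spec,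
      (A.anchor V).map_smul, (s.σ V h).map_smul, RingHom.id_apply, smul_sub])

theorem incl_coef (s : A.LieSplitting U) (h : V ≤ U) (y : Γ(A.M, V)) :
    A.incl V (s.coef h y) = y - s.σ V h (A.anchor V y) :=
  (s.exists_coef h y).choose_spec

theorem exists_eq (s : A.LieSplitting U) (h : V ≤ U) (y : Γ(A.M, V)) :
    ∃ x f, y = s.σ V h x + A.incl V f :=
  ⟨A.anchor V y, s.coef h y, by rw [incl_coef, add_sub_cancel]⟩

theorem anchor_add_incl (s : A.LieSplitting U) (h : V ≤ U) (x : VectorFields k V) (f : Γ(Z, V)) :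
    A.anchor V (s.σ V h x + A.incl V f) = x := by
  rw [(A.anchor V).map_add, s.anchor_σ, A.anchor_incl, add_zero]

theorem coef_add_incl (s : A.LieSplitting U) (h : V ≤ U) (x : VectorFields k V) (f : Γ(Z, V)) :
    s.coef h (s.σ V h x + A.incl V f) = f := by
  apply A.incl_injective
  rw [incl_coef, anchor_add_incl, add_sub_cancel_left]

theorem br_add_incl (s : A.LieSplitting U) (h : V ≤ U) (x y : VectorFields k V) (f g : Γ(Z, V)) :
    A.br V (s.σ V h x + A.incl V f) (s.σ V h y + A.incl V g)
      = s.σ V h ⁅x, y⁆ + A.incl V (der x g - der y f) := by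
  rw [A.add_br, A.br_add, A.br_add, A.incl_br_incl, A.br_incl, A.incl_br, s.anchor_σ, s.anchor_σ,
    s.σ_lie, (A.incl V).map_sub]
  abel

theorem pOp_add_incl (s : A.LieSplitting U) (h : V ≤ U) (x : VectorFields k V) (f : Γ(Z, V)) :
    A.pOp V (s.σ V h x + A.incl V f)
      = s.σ V h (pPow p x) + A.incl V (f ^ p + (der x)^[p - 1] f + s.pCurv h x) := by
  rw [add_comm (s.σ V h x), A.pOp_incl_add, s.anchor_σ, (A.incl V).map_add _ (s.pCurv h x),
    incl_pCurv]
  abel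

end LieSplitting

variable {A B : RestrictedAtiyahAlgebra p k Z} {κ : Type u} {W : κ → Z.Opens}

/-- The local isomorphism `σ(x) + f ↦ σ'(x) + f + b(x)`. -/
def localHom {U : Z.Opens} (s : A.LieSplitting U) (t : B.LieSplitting U)
    (b : (closedSheaf k Z).obj (op U)) (V : {V : Z.affineOpens // V.1 ≤ U}) :
    Γ(A.M, V.1.1) →ₗ[Γ(Z, V.1.1)] Γ(B.M, V.1.1) :=
  (t.σ V.1.1 V.2).comp (A.anchor V.1.1) + (B.incl V.1.1).comp (s.coef V.2 +
    LinearMap.comp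
      { toFun := evForm b V
        map_add' := evForm_add_right b V
        map_smul' := fun f x => evForm_smul_right b V x f } (A.anchor V.1.1))

theorem localHom_apply {U : Z.Opens} (s : A.LieSplitting U) (t : B.LieSplitting U)
    (b : (closedSheaf k Z).obj (op U)) (V : {V : Z.affineOpens // V.1 ≤ U})
    (x : VectorFields k V.1.1) (f : Γ(Z, V.1.1)) :
    localHom s t b V (s.σ V.1 V.2 x + A.incl V.1 f)
      = t.σ V.1 V.2 x + B.incl V.1 (f + evForm b V x) := by
  change t.σ V.1 V.2 (A.anchor V.1 _) + B.incl V.1 (s.coef V.2 _ + evForm b V (A.anchor V.1 _)) = _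
  rw [s.anchor_add_incl, s.coef_add_incl]

theorem resM_localHom {U : Z.Opens} (s : A.LieSplitting U) (t : B.LieSplitting U)
    (b : (closedSheaf k Z).obj (op U)) (V V' : {V : Z.affineOpens // V.1 ≤ U})
    (h : V'.1.1 ≤ V.1.1) (y : Γ(A.M, V.1.1)) :
    resM B.M h (localHom s t b V y) = localHom s t b V' (resM A.M h y) := by
  obtain ⟨x, f, rfl⟩ := s.exists_eq V.2 y
  rw [localHom_apply, (resM A.M h).map_add, (resM B.M h).map_add, s.σ_res, t.σ_res, A.incl_res,
    B.incl_res, localHom_apply s t b V', map_add (res k h), res_evForm b x V' h]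

/-- Two local isomorphisms agree if the forms `b` and `b'` account for the changes of the
splittings. -/
theorem localHom_eq {U U' : Z.Opens} (s : A.LieSplitting U) (t : B.LieSplitting U)
    (s' : A.LieSplitting U') (t' : B.LieSplitting U')
    (b : (closedSheaf k Z).obj (op U)) (b' : (closedSheaf k Z).obj (op U'))
    {V : Z.affineOpens} (h : V.1 ≤ U) (h' : V.1 ≤ U')
    (hb : ∀ x, s.diff s' h h' x - t.diff t' h h' x
      = evForm b ⟨V, h⟩ x - evForm b' ⟨V, h'⟩ x) :
    localHom s t b ⟨V, h⟩ = localHom s' t' b' ⟨V, h'⟩ := by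
  ext y
  obtain ⟨x, f, rfl⟩ := s.exists_eq h y
  rw [localHom_apply s t b ⟨V, h⟩]
  have h1 : s.σ V.1 h x + A.incl V.1 f = s'.σ V.1 h' x + A.incl V.1 (f + s.diff s' h h' x) := by
    rw [(A.incl V.1).map_add, LieSplitting.incl_diff]
    abel
  rw [h1, localHom_apply s' t' b' ⟨V, h'⟩]
  have h2 : t.σ V.1 h x = t'.σ V.1 h' x + B.incl V.1 (t.diff t' h h' x) := by
    rw [LieSplitting.incl_diff]
    abel
  rw [h2, add_assoc, ← (B.incl V.1).map_add]
  congr 2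
  linear_combination -(hb x)

/-- Splittings of `A` and `B` over a common cover whose cocycles of differences are cohomologous
give a morphism of modules. -/
theorem exists_hom_of_splittings (hW : ∀ z : Z, ∃ m, z ∈ W m) (s : ∀ m, A.LieSplitting (W m))
    (t : ∀ m, B.LieSplitting (W m)) (b : ∀ m, (closedSheaf k Z).obj (op (W m)))
    (hb : ∀ m n (V : Z.affineOpens) (h : V.1 ≤ W m) (h' : V.1 ≤ W n) x,
      (s m).diff (s n) h h' x - (t m).diff (t n) h h' x
        = evForm (b m) ⟨V, h⟩ x - evForm (b n) ⟨V, h'⟩ x) :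
    ∃ Φ : A.M ⟶ B.M, ∀ m (V : {V : Z.affineOpens // V.1 ≤ W m}) y,
      Φ.app V.1.1 y = localHom (s m) (t m) (b m) V y := by
  have hcov := affineCover_of_cover (U := ⊤) W fun z _ => hW z
  have heq : ∀ m n (V : Z.affineOpens) (h : V.1 ≤ W m) (h' : V.1 ≤ W n),
      localHom (s m) (t m) (b m) ⟨V, h⟩ = localHom (s n) (t n) (b n) ⟨V, h'⟩ := fun m n V h h' =>
    localHom_eq _ _ _ _ _ _ h h' (hb m n V h h')
  obtain ⟨Φ, hΦ⟩ := hcov.exists_hom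
    (fun V => localHom (s V.2.2.choose) (t V.2.2.choose) (b V.2.2.choose)
      ⟨V.1, V.2.2.choose_spec⟩)
    (fun V V' h y => by
      rw [← heq V.2.2.choose _ V'.1 (h.trans V.2.2.choose_spec)]
      exact resM_localHom _ _ _ ⟨V.1, V.2.2.choose_spec⟩
        ⟨V'.1, h.trans V.2.2.choose_spec⟩ h y)
  refine ⟨Φ, fun m V y => ?_⟩
  refine (hΦ ⟨V.1, le_top, m, V.2⟩ y).trans ?_
  rw [heq _ m V.1 _ V.2]

/-- Whether the composition of two morphisms is the identity can be checked on affine covers. -/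
theorem AffineCover.hom_inv {M N : Z.Modules} {P : Z.Opens → Z.affineOpens → Prop}
    (hcov : ∀ U, AffineCover U (P U)) (Φ : M ⟶ N) (Ψ : N ⟶ M)
    (h : ∀ U V, P U V → ∀ y : Γ(M, V.1), Ψ.app V.1 (Φ.app V.1 y) = y) : Φ ≫ Ψ = 𝟙 M :=
  Scheme.Modules.hom_ext _ _ fun U => by
    ext y
    refine (hcov U).ext_resM M fun V hV => ?_
    change resM M _ (Ψ.app U (Φ.app U y)) = resM M _ y
    rw [resM_app, resM_app, h U V hV]

/-- Compatibility with the bracket, the `p`-operation, the anchor map and the inclusion of the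
functions can be checked on affine covers. -/
theorem isomorphic_of_affineCover [Smooth (Z ↘ Spec (.of k))]
    {P : Z.Opens → Z.affineOpens → Prop}
    (hcov : ∀ U, AffineCover U (P U)) (e : A.M ≅ B.M)
    (hbr : ∀ U V, P U V → ∀ x y : Γ(A.M, V.1),
      e.hom.app V.1 (A.br V.1 x y) = B.br V.1 (e.hom.app V.1 x) (e.hom.app V.1 y))
    (hp : ∀ U V, P U V → ∀ x : Γ(A.M, V.1),
      e.hom.app V.1 (A.pOp V.1 x) = B.pOp V.1 (e.hom.app V.1 x))
    (ha : ∀ U V, P U V → ∀ x : Γ(A.M, V.1), B.anchor V.1 (e.hom.app V.1 x) = A.anchor V.1 x)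
    (hi : ∀ U V, P U V → ∀ f : Γ(Z, V.1), e.hom.app V.1 (A.incl V.1 f) = B.incl V.1 f) :
    Isomorphic A B := by
  refine ⟨e, fun U => ⟨fun x y => ?_, fun x => ?_, fun x => ?_, fun f => ?_⟩⟩
  · refine (hcov U).ext_resM B.M fun V hV => ?_
    rw [B.br_res, resM_app, resM_app, resM_app, A.br_res, hbr U V hV]
  · refine (hcov U).ext_resM B.M fun V hV => ?_
    rw [B.pOp_res, resM_app, resM_app, A.pOp_res, hp U V hV]
  · refine (hcov U).ext_vectorFields fun V hV => ?_
    rw [B.anchor_res, A.anchor_res, resM_app, ha U V hV]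
  · refine (hcov U).ext_resM B.M fun V hV => ?_
    rw [resM_app, A.incl_res, B.incl_res, hi U V hV]

section Local

variable {U : Z.Opens} (s : A.LieSplitting U) (t : B.LieSplitting U)
  (b : (closedSheaf k Z).obj (op U)) (V : {V : Z.affineOpens // V.1 ≤ U})

theorem localHom_br (x y : Γ(A.M, V.1.1)) :
    localHom s t b V (A.br V.1.1 x y)
      = B.br V.1.1 (localHom s t b V x) (localHom s t b V y) := by
  obtain ⟨x, f, rfl⟩ := s.exists_eq V.2 x
  obtain ⟨y, g, rfl⟩ := s.exists_eq V.2 y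
  rw [s.br_add_incl, localHom_apply, localHom_apply, localHom_apply, t.br_add_incl, evForm_lie,
    (der x).map_add, (der y).map_add]
  congr 2
  ring

/-- The local isomorphism respects the `p`-operations if the difference of the `p`-curvatures is the
pairing of `b' - C(b)`. -/
theorem localHom_pOp (h : ∀ x, s.pCurv V.2 x - t.pCurv V.2 x = evForm b V x ^ p
      - (evForm b V (pPow p x) - (der x)^[p - 1] (evForm b V x))) (x : Γ(A.M, V.1.1)) :
    localHom s t b V (A.pOp V.1.1 x) = B.pOp V.1.1 (localHom s t b V x) := by
  obtain ⟨x, f, rfl⟩ := s.exists_eq V.2 x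
  rw [s.pOp_add_incl, localHom_apply, localHom_apply, t.pOp_add_incl]
  congr 2
  have h1 := h x
  have h0 : (p : Γ(Z, V.1.1)) = 0 := natCast_eq_zero_of_algebra k p _
  have h2 := commute_add_pow_prime h0 (Commute.all f (evForm b V x))
  have h3 : (der x)^[p - 1] (f + evForm b V x)
      = (der x)^[p - 1] f + (der x)^[p - 1] (evForm b V x) :=
    iterate_map_add (der x) _ _ _
  rw [h2, h3]
  linear_combination h1

theorem anchor_localHom (x : Γ(A.M, V.1.1)) :
    B.anchor V.1.1 (localHom s t b V x) = A.anchor V.1.1 x := by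
  obtain ⟨x, f, rfl⟩ := s.exists_eq V.2 x
  rw [localHom_apply, s.anchor_add_incl, t.anchor_add_incl]

theorem localHom_incl (f : Γ(Z, V.1.1)) :
    localHom s t b V (A.incl V.1.1 f) = B.incl V.1.1 f := by
  have h := localHom_apply s t b V 0 f
  rw [(s.σ V.1.1 V.2).map_zero, (t.σ V.1.1 V.2).map_zero, zero_add, zero_add] at h
  have h2 := evForm_smul_right b V 0 0
  rw [zero_smul, zero_mul] at h2
  rw [h, h2, add_zero]

theorem localHom_localHom (y : Γ(A.M, V.1.1)) :
    localHom t s (-b) V (localHom s t b V y) = y := by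
  obtain ⟨x, f, rfl⟩ := s.exists_eq V.2 y
  rw [localHom_apply, localHom_apply t s, evForm_neg, add_neg_cancel_right]

end Local

/-- The morphisms given by `b` and `-b` are inverse to each other. The second condition, on the
`p`-curvatures, makes them compatible with the `p`-operations. -/
theorem isomorphic_of_splittings [Smooth (Z ↘ Spec (.of k))] (hW : ∀ z : Z, ∃ m, z ∈ W m)
    (s : ∀ m, A.LieSplitting (W m))
    (t : ∀ m, B.LieSplitting (W m)) (b : ∀ m, (closedSheaf k Z).obj (op (W m)))
    (hb : ∀ m n (V : Z.affineOpens) (h : V.1 ≤ W m) (h' : V.1 ≤ W n) x,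
      (s m).diff (s n) h h' x - (t m).diff (t n) h h' x
        = evForm (b m) ⟨V, h⟩ x - evForm (b n) ⟨V, h'⟩ x)
    (hb' : ∀ m (V : {V : Z.affineOpens // V.1 ≤ W m}) x,
      (s m).pCurv V.2 x - (t m).pCurv V.2 x = evForm (b m) V x ^ p
        - (evForm (b m) V (pPow p x) - (der x)^[p - 1] (evForm (b m) V x))) :
    Isomorphic A B := by
  obtain ⟨Φ, hΦ⟩ := exists_hom_of_splittings hW s t b hb
  obtain ⟨Ψ, hΨ⟩ := exists_hom_of_splittings hW t s (fun m => -b m) fun m n V h h' x => by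
    rw [evForm_neg, evForm_neg, ← neg_sub, hb]
    ring
  have hcov : ∀ U : Z.Opens, AffineCover U _ := fun U =>
    affineCover_of_cover (U := U) W fun z _ => hW z
  let e : A.M ≅ B.M :=
    { hom := Φ
      inv := Ψ
      hom_inv_id := AffineCover.hom_inv hcov Φ Ψ fun U V ⟨_, m, hV⟩ y => by
        rw [hΦ m ⟨V, hV⟩, hΨ m ⟨V, hV⟩, localHom_localHom]
      inv_hom_id := AffineCover.hom_inv hcov Ψ Φ fun U V ⟨_, m, hV⟩ y => by
        have := localHom_localHom (t m) (s m) (-b m) ⟨V, hV⟩ y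
        rw [neg_neg] at this
        rw [hΨ m ⟨V, hV⟩, hΦ m ⟨V, hV⟩, this] }
  refine isomorphic_of_affineCover hcov e ?_ ?_ ?_ ?_
  · rintro U V ⟨_, m, hV⟩ x y
    change Φ.app V.1 _ = B.br V.1 (Φ.app V.1 x) (Φ.app V.1 y)
    rw [hΦ m ⟨V, hV⟩, hΦ m ⟨V, hV⟩, hΦ m ⟨V, hV⟩, localHom_br]
  · rintro U V ⟨_, m, hV⟩ x
    change Φ.app V.1 _ = B.pOp V.1 (Φ.app V.1 x)
    rw [hΦ m ⟨V, hV⟩, hΦ m ⟨V, hV⟩, localHom_pOp _ _ _ _ (hb' m ⟨V, hV⟩)]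
  · rintro U V ⟨_, m, hV⟩ x
    change B.anchor V.1 (Φ.app V.1 x) = _
    rw [hΦ m ⟨V, hV⟩]
    exact anchor_localHom _ _ _ ⟨V, hV⟩ x
  · rintro U V ⟨_, m, hV⟩ f
    change Φ.app V.1 _ = _
    rw [hΦ m ⟨V, hV⟩, localHom_incl]

/-- Restricted Atiyah algebras with cohomologous cocycles are isomorphic. -/
theorem isomorphic_of_cohomologous [Smooth (Z ↘ Spec (.of k))]
    {c c' : Cocycle (atiyahComplex p k Z)} (hA : A.IsCocycleOf c) (hB : B.IsCocycleOf c')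
    (h : Cohomologous c c') : Isomorphic A B := by
  obtain ⟨s₀, hs, hs'⟩ := (isCocycleOf_iff c).mp hA
  obtain ⟨t₀, ht, ht'⟩ := (isCocycleOf_iff c').mp hB
  obtain ⟨κ, W, hW, r, r', hr, hr', b, hb, hb'⟩ := h
  refine isomorphic_of_splittings hW (fun m => (s₀ (r m)).restrict (hr m))
    (fun m => (t₀ (r' m)).restrict (hr' m)) b ?_ ?_
  · intro m n V h h' x
    have h1 := congrArg (fun β => evForm β ⟨V, le_inf h h'⟩ x) (hb m n)
    simp only [evForm_sub, evForm_rst] at h1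
    refine Eq.trans (congrArg₂ (· - ·) ?_ ?_) h1
    · exact hs (r m) (r n) ⟨V, _⟩ x
    · exact ht (r' m) (r' n) ⟨V, _⟩ x
  · intro m V x
    rw [← evTwist_atiyahComplex, ← hb' m, evTwist_sub, evTwist_rst, evTwist_rst]
    exact congrArg₂ (· - ·) (hs' (r m) ⟨V.1, _⟩ x) (ht' (r' m) ⟨V.1, _⟩ x)

end RestrictedAtiyahAlgebra

end Comparison

/-! ### The restricted Atiyah algebra of a cocycle: sections -/

section Model

variable {p : ℕ} [hp : Fact p.Prime] {k : Type u} [Field k] [CharP k p]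
  {Z : Scheme.{u}} [Z.Over (Spec (.of k))]
  (c : Cocycle (atiyahComplex p k Z))

open VectorFields

/-- The sections over `U` of the restricted Atiyah algebra with cocycle `c`: pairs of a vector
field `x` over `U` and functions `f i` on `U ⊓ c.U i` with `f j - f i = c.α i j (x)`. The function
`f i` is given by its restrictions to the affine open subsets of `U ⊓ c.U i`. -/
def modelSections (U : Z.Opens) : AddSubgroup (VectorFields k U ×
    ∀ (i : c.ι) (V : {V : Z.affineOpens // V.1 ≤ U ∧ V.1 ≤ c.U i}), Γ(Z, V.1.1)) where
  carrier := {y |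
    (∀ i (V W : Z.affineOpens) (hU : V.1 ≤ U) (hi : V.1 ≤ c.U i) (h : W.1 ≤ V.1),
      res k h (y.2 i ⟨V, hU, hi⟩) = y.2 i ⟨W, h.trans hU, h.trans hi⟩) ∧
    ∀ i j (V : Z.affineOpens) (hU : V.1 ≤ U) (hi : V.1 ≤ c.U i) (hj : V.1 ≤ c.U j),
      y.2 j ⟨V, hU, hj⟩ - y.2 i ⟨V, hU, hi⟩ = evForm (c.α i j) ⟨V, le_inf hi hj⟩ (restrict hU y.1)}
  zero_mem' := by
    refine ⟨fun i V W hU hi h => map_zero _, fun i j V hU hi hj => ?_⟩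
    have h := evForm_smul_right (c.α i j) ⟨V, le_inf hi hj⟩ 0 0
    rw [zero_smul, zero_mul] at h
    exact (sub_self _).trans h.symm
  add_mem' {y z} hy hz := by
    refine ⟨fun i V W hU hi h => ?_, fun i j V hU hi hj => ?_⟩
    · change res k h (y.2 i ⟨V, hU, hi⟩ + z.2 i ⟨V, hU, hi⟩) = _
      rw [map_add, hy.1 i V W hU hi h, hz.1 i V W hU hi h]; rfl
    · refine Eq.trans ?_ (evForm_add_right (c.α i j) ⟨V, le_inf hi hj⟩ (restrict hU y.1)
        (restrict hU z.1)).symm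
      rw [← hy.2 i j V hU hi hj, ← hz.2 i j V hU hi hj]
      exact add_sub_add_comm _ _ _ _
  neg_mem' {y} hy := by
    refine ⟨fun i V W hU hi h => ?_, fun i j V hU hi hj => ?_⟩
    · change res k h (-y.2 i ⟨V, hU, hi⟩) = _
      rw [map_neg, hy.1 i V W hU hi h]; rfl
    · have h := evForm_smul_right (c.α i j) ⟨V, le_inf hi hj⟩ (restrict hU y.1) (-1)
      rw [neg_one_smul, neg_one_mul, ← hy.2 i j V hU hi hj] at h
      refine Eq.trans ?_ h.symm
      change -_ - -_ = _
      ring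

variable {c} {U U' : Z.Opens}

namespace modelSections

/-- The vector field underlying a section. -/
def field (y : modelSections c U) : VectorFields k U := y.1.1

/-- The functions that make up a section. -/
def comp (y : modelSections c U) (i : c.ι) (V : Z.affineOpens) (hU : V.1 ≤ U) (hi : V.1 ≤ c.U i) :
    Γ(Z, V.1) := y.1.2 i ⟨V, hU, hi⟩

theorem res_comp (y : modelSections c U) (i : c.ι) {V W : Z.affineOpens} (hU : V.1 ≤ U)
    (hi : V.1 ≤ c.U i) (h : W.1 ≤ V.1) :
    res k h (comp y i V hU hi) = comp y i W (h.trans hU) (h.trans hi) := y.2.1 i V W hU hi h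

theorem comp_sub_comp (y : modelSections c U) (i j : c.ι) (V : Z.affineOpens) (hU : V.1 ≤ U)
    (hi : V.1 ≤ c.U i) (hj : V.1 ≤ c.U j) :
    comp y j V hU hj - comp y i V hU hi
      = evForm (c.α i j) ⟨V, le_inf hi hj⟩ (restrict hU (field y)) := y.2.2 i j V hU hi hj

theorem comp_eq (y : modelSections c U) (i j : c.ι) (V : Z.affineOpens) (hU : V.1 ≤ U)
    (hi : V.1 ≤ c.U i) (hj : V.1 ≤ c.U j) :
    comp y j V hU hj
      = comp y i V hU hi + evForm (c.α i j) ⟨V, le_inf hi hj⟩ (restrict hU (field y)) := by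
  rw [← comp_sub_comp y i j V hU hi hj, add_sub_cancel]

theorem ext {y z : modelSections c U} (h : field y = field z)
    (h' : ∀ i V hU hi, comp y i V hU hi = comp z i V hU hi) : y = z :=
  Subtype.ext (Prod.ext h (funext fun i => funext fun V =>
    h' i V.1 V.2.1 V.2.2))

/-- Two sections agree if they agree over the members of an affine cover. -/
theorem ext_affineCover {y z : modelSections c U} {P : Z.affineOpens → Prop}
    (hP : AffineCover U P)
    (h : ∀ (V : Z.affineOpens) (hV : P V),
      restrict (hP.le hV) (field y) = restrict (hP.le hV) (field z))
    (h' : ∀ (V : Z.affineOpens) (hV : P V) i hi,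
      comp y i V (hP.le hV) hi = comp z i V (hP.le hV) hi) : y = z := by
  refine ext (hP.ext_vectorFields fun V hV => by rw [h V hV]) fun i V hU hi => ?_
  refine (hP.inf hU).ext_res k fun W hW => ?_
  rw [res_comp y i hU hi, res_comp z i hU hi]
  exact h' W hW.1 i _

instance : Module Γ(Z, U) (modelSections c U) where
  smul f y := ⟨(f • field y, fun i V => res k V.2.1 f * comp y i V.1 V.2.1 V.2.2),
    fun i V W hU hi h => by
      change res k h (res k hU f * comp y i V hU hi) = _
      rw [map_mul, res_res, res_comp],
    fun i j V hU hi hj => by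
      change res k hU f * comp y j V hU hj - res k hU f * comp y i V hU hi = _
      rw [restrict_smul, evForm_smul_right, ← comp_sub_comp y i j V hU hi hj, mul_sub]⟩
  one_smul y := ext (one_smul _ (field y)) fun i V hU hi => by
    change res k hU 1 * comp y i V hU hi = _
    rw [map_one, one_mul]
  mul_smul f g y := ext (mul_smul f g (field y)) fun i V hU hi => by
    change res k hU (f * g) * comp y i V hU hi = res k hU f * (res k hU g * comp y i V hU hi)
    rw [map_mul, mul_assoc]
  smul_zero f := ext (smul_zero f) fun i V hU hi => mul_zero (res k hU f)
  smul_add f y z := ext (smul_add f (field y) (field z)) fun i V hU hi =>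
    mul_add (res k hU f) (comp y i V hU hi) (comp z i V hU hi)
  add_smul f g y := ext (add_smul f g (field y)) fun i V hU hi => by
    change res k hU (f + g) * comp y i V hU hi
      = res k hU f * comp y i V hU hi + res k hU g * comp y i V hU hi
    rw [map_add, add_mul]
  zero_smul y := ext (zero_smul _ (field y)) fun i V hU hi => by
    change res k hU 0 * comp y i V hU hi = 0
    rw [map_zero, zero_mul]

theorem field_smul (f : Γ(Z, U)) (y : modelSections c U) : field (f • y) = f • field y := rfl

/-- Restriction of sections. -/
def restr (h : U' ≤ U) : modelSections c U →+ modelSections c U' where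
  toFun y := ⟨(restrict h (field y), fun i V => comp y i V.1 (V.2.1.trans h) V.2.2),
    fun i _ _ hU hi hW => res_comp y i (hU.trans h) hi hW,
    fun i j V hU hi hj => comp_sub_comp y i j V (hU.trans h) hi hj⟩
  map_zero' := rfl
  map_add' _ _ := rfl

theorem restr_smul (h : U' ≤ U) (f : Γ(Z, U)) (y : modelSections c U) :
    restr h (f • y) = res k h f • restr h y :=
  ext (restrict_smul h f (field y)) fun i V hU hi => by
    change res k (hU.trans h) f * comp y i V (hU.trans h) hi
      = res k hU (res k h f) * comp y i V (hU.trans h) hi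
    rw [res_res]

/-- The bracket `[(x, f), (y, g)] = ([x, y], x(g) - y(f))`. -/
def bracket (y z : modelSections c U) : modelSections c U :=
  ⟨(⁅field y, field z⁆, fun i V => der (restrict V.2.1 (field y)) (comp z i V.1 V.2.1 V.2.2)
      - der (restrict V.2.1 (field z)) (comp y i V.1 V.2.1 V.2.2)),
    fun i V W hU hi h => by
      change res k h (der _ _ - der _ _) = der _ _ - der _ _
      rw [map_sub, res_der, res_der, res_comp, res_comp]
      rfl,
    fun i j V hU hi hj => by
      change (der _ _ - der _ _) - (der _ _ - der _ _)
        = evForm (c.α i j) ⟨V, le_inf hi hj⟩ ⁅restrict hU (field y), restrict hU (field z)⁆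
      rw [evForm_lie, comp_eq z i j V hU hi hj, comp_eq y i j V hU hi hj, map_add, map_add]
      ring⟩

variable [Smooth (Z ↘ Spec (.of k))]

/-- The `p`-operation `(x, f) ^ [p] = (x ^ p, f ^ p + x ^ (p - 1) (f) + γ(x) ^ p)`. -/
def pOperation (y : modelSections c U) : modelSections c U :=
  ⟨(pPow p (field y), fun i V => comp y i V.1 V.2.1 V.2.2 ^ p
      + (der (restrict V.2.1 (field y)))^[p - 1] (comp y i V.1 V.2.1 V.2.2)
      + evTwist (c.γ i) ⟨V.1, V.2.2⟩ (restrict V.2.1 (field y))),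
    fun i V W hU hi h => by
      have h1 : res k h ((der (restrict hU (field y)))^[p - 1] (comp y i V hU hi))
          = (der (restrict (h.trans hU) (field y)))^[p - 1]
            (res k h (comp y i V hU hi)) :=
        (Function.Semiconj.iterate_right (f := res k h) (fun g => res_der h _ g) (p - 1)) _
      have h2 : res k h (evTwist (c.γ i) ⟨V, hi⟩ (restrict hU (field y)))
          = evTwist (c.γ i) ⟨W, h.trans hi⟩ (restrict (h.trans hU) (field y)) :=
        res_evTwist (c.γ i) (V := ⟨V, hi⟩) (restrict hU (field y)) ⟨W, h.trans hi⟩ h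
      refine (map_add (res k h) _ _).trans (congrArg₂ (· + ·) ?_ h2)
      rw [map_add, map_pow, h1, res_comp],
    fun i j V hU hi hj => by
      change (_ ^ p + _ + _) - (_ ^ p + _ + _)
        = evForm (c.α i j) ⟨V, le_inf hi hj⟩ (pPow p (restrict hU (field y)))
      have h0 : (p : Γ(Z, V.1)) = 0 := natCast_eq_zero_of_algebra k p _
      -- The cocycle condition `γᵢ - γⱼ = αᵢⱼ' - C(αᵢⱼ)`, paired with the vector field.
      have h1 := congrArg (fun γ => evTwist γ ⟨V, le_inf hi hj⟩ (restrict hU (field y)))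
        (c.sub_eq i j)
      rw [evTwist_sub, evTwist_rst, evTwist_rst, evTwist_atiyahComplex] at h1
      have h2 := commute_add_pow_prime h0 (Commute.all (comp y i V hU hi)
        (evForm (c.α i j) ⟨V, le_inf hi hj⟩ (restrict hU (field y))))
      have h3 := iterate_map_add (der (restrict hU (field y))) (p - 1) (comp y i V hU hi)
        (evForm (c.α i j) ⟨V, le_inf hi hj⟩ (restrict hU (field y)))
      rw [comp_eq y i j V hU hi hj, h2, h3]
      linear_combination -h1⟩

end modelSections

end Model

/-! ### The restricted Atiyah algebra of a cocycle: identities -/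

section Commutators

theorem add_comm_left {R : Type*} [Ring R] (a b z : R) : comm (a + b) z = comm a z + comm b z := by
  simp only [comm]; noncomm_ring

theorem add_comm_right {R : Type*} [Ring R] (z a b : R) : comm z (a + b) = comm z a + comm z b := by
  simp only [comm]; noncomm_ring

theorem comm_jacobi {R : Type*} [Ring R] (a b z : R) :
    comm a (comm b z) = comm (comm a b) z + comm b (comm a z) := by
  simp only [comm, mul_sub, sub_mul, mul_assoc]; abel

variable {k : Type u} [Field k] {A : Type u} [CommRing A] [Algebra k A]

theorem comm_lmul_mul (x : Derivation k A A) (f a : A) (t : Module.End k A) :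
    comm (firstOrder x f) (Algebra.lmul k A a * t)
      = Algebra.lmul k A a * comm (firstOrder x f) t + Algebra.lmul k A (x a) * t := by
  refine LinearMap.ext fun b => ?_
  change x (a * t b) + f * (a * t b) - a * t (firstOrder x f b)
    = a * (x (t b) + f * t b - t (firstOrder x f b)) + x a * t b
  rw [x.leibniz, smul_eq_mul, smul_eq_mul]
  ring

theorem comm_lmul_firstOrder (x : Derivation k A A) (f : A) {a : A} (ha : x a = 0) :
    comm (Algebra.lmul k A a) (firstOrder x f) = 0 := by
  refine LinearMap.ext fun b => ?_
  change a * (x b + f * b) - (x (a * b) + f * (a * b)) = 0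
  rw [x.leibniz, ha, smul_zero, smul_eq_mul]
  ring

end Commutators

section ModelIdentities

variable {p : ℕ} [hp : Fact p.Prime] {k : Type u} [Field k] [CharP k p]
  {Z : Scheme.{u}} [Z.Over (Spec (.of k))] {c : Cocycle (atiyahComplex p k Z)} {U : Z.Opens}

open VectorFields

namespace modelSections

/-- The action `g ↦ x(g) + f g` of a section `(x, f)` on functions. Through these operators the
identities of a restricted Atiyah algebra reduce to identities in associative algebras. -/
def op (i : c.ι) (V : Z.affineOpens) (hU : V.1 ≤ U) (hi : V.1 ≤ c.U i) :
    modelSections c U →+ Module.End k Γ(Z, V.1) where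
  toFun y := firstOrder (der (restrict hU (field y))) (comp y i V hU hi)
  map_zero' := by
    refine LinearMap.ext fun a => ?_
    change 0 + 0 * a = 0
    rw [zero_mul, add_zero]
  map_add' y z := by
    refine LinearMap.ext fun a => ?_
    change der (restrict hU (field y)) a + der (restrict hU (field z)) a
      + (comp y i V hU hi + comp z i V hU hi) * a
      = der (restrict hU (field y)) a + comp y i V hU hi * a
        + (der (restrict hU (field z)) a + comp z i V hU hi * a)
    ring

/-- A section is determined by the operators that it defines on the members of the cover. -/
theorem ext_op {y z : modelSections c U}
    (h : ∀ (i : c.ι) (V : Z.affineOpens) (hU : V.1 ≤ U) (hi : V.1 ≤ c.U i),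
      op i V hU hi y = op i V hU hi z) : y = z := by
  have hP := affineCover_of_cover (U := U) c.U fun z _ => c.cover z
  refine ext (hP.ext_vectorFields fun V hV => ?_) fun i V hU hi =>
    (firstOrder_injective (h i V hU hi)).2
  obtain ⟨i, hi⟩ := hV.2
  exact (firstOrder_injective (h i V hV.1 hi)).1

variable (i : c.ι) (V : Z.affineOpens) (hU : V.1 ≤ U) (hi : V.1 ≤ c.U i)

theorem op_eq (y : modelSections c U) :
    op i V hU hi y = firstOrder (der (restrict hU (field y))) (comp y i V hU hi) := rfl

theorem op_add (x y : modelSections c U) :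
    op i V hU hi (x + y) = op i V hU hi x + op i V hU hi y := (op i V hU hi).map_add x y

theorem op_smul (f : Γ(Z, U)) (y : modelSections c U) :
    op i V hU hi (f • y) = Algebra.lmul k _ (res k hU f) * op i V hU hi y := by
  refine LinearMap.ext fun a => ?_
  change res k hU f * der (restrict hU (field y)) a + res k hU f * comp y i V hU hi * a
    = res k hU f * (der (restrict hU (field y)) a + comp y i V hU hi * a)
  ring

theorem op_bracket (y z : modelSections c U) :
    op i V hU hi (bracket y z) = comm (op i V hU hi y) (op i V hU hi z) :=
  (comm_firstOrder _ _ _ _).symm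

theorem bracket_add (x y z : modelSections c U) :
    bracket x (y + z) = bracket x y + bracket x z := ext_op fun i V hU hi => by
  simp only [op_add, op_bracket, add_comm_right]

theorem add_bracket (x y z : modelSections c U) :
    bracket (x + y) z = bracket x z + bracket y z := ext_op fun i V hU hi => by
  simp only [op_add, op_bracket, add_comm_left]

theorem bracket_self (x : modelSections c U) : bracket x x = 0 := ext_op fun i V hU hi => by
  rw [op_bracket, comm, sub_self, (op i V hU hi).map_zero]

theorem bracket_jacobi (x y z : modelSections c U) :
    bracket x (bracket y z) = bracket (bracket x y) z + bracket y (bracket x z) :=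
  ext_op fun i V hU hi => by
    simp only [op_add, op_bracket]
    exact comm_jacobi _ _ _

theorem bracket_smul (x y : modelSections c U) (f : Γ(Z, U)) :
    bracket x (f • y) = f • bracket x y + der (field x) f • y := ext_op fun i V hU hi => by
  simp only [op_add, op_bracket, op_smul, res_der]
  exact comm_lmul_mul _ _ _ _

theorem bracket_restr {U' : Z.Opens} (h : U' ≤ U) (x y : modelSections c U) :
    restr h (bracket x y) = bracket (restr h x) (restr h y) := rfl

theorem op_iterate_bracket (x y : modelSections c U) (n : ℕ) :
    op i V hU hi ((bracket x)^[n] y) = (comm (op i V hU hi x))^[n] (op i V hU hi y) :=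
  (Function.Semiconj.iterate_right (f := op i V hU hi) (fun z => op_bracket i V hU hi x z) n) y

theorem op_smul_const (a : k) (x : modelSections c U) :
    op i V hU hi (algebraMap k Γ(Z, U) a • x) = a • op i V hU hi x := by
  refine (op_smul i V hU hi _ x).trans (LinearMap.ext fun b => ?_)
  change res k hU (algebraMap k Γ(Z, U) a) * op i V hU hi x b = a • op i V hU hi x b
  rw [AlgHom.commutes, Algebra.smul_def]

/-- The function `γ(x) ^ p` for a section `(x, f)`. -/
def curv (y : modelSections c U) : Γ(Z, V.1) := evTwist (c.γ i) ⟨V, hi⟩ (restrict hU (field y))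

theorem curv_add (x y : modelSections c U) :
    curv i V hU hi (x + y) = curv i V hU hi x + curv i V hU hi y :=
  evTwist_add_right (c.γ i) ⟨V, hi⟩ (restrict hU (field x)) (restrict hU (field y))

theorem curv_smul (f : Γ(Z, U)) (x : modelSections c U) :
    curv i V hU hi (f • x) = res k hU f ^ p * curv i V hU hi x :=
  (congrArg (evTwist (c.γ i) ⟨V, hi⟩) (restrict_smul hU f (field x))).trans
    (evTwist_smul_right (c.γ i) ⟨V, hi⟩ (restrict hU (field x)) (res k hU f))

theorem der_curv (x : modelSections c U) (y : VectorFields k V.1) :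
    der y (curv i V hU hi x) = 0 :=
  der_evTwist (c.γ i) ⟨V, hi⟩ _ _

variable [Smooth (Z ↘ Spec (.of k))]

/-- The `p`-operation is the `p`-th power of operators, corrected by the function `γ(x) ^ p`. -/
theorem op_pOperation (y : modelSections c U) :
    op i V hU hi (pOperation y)
      = op i V hU hi y ^ p + Algebra.lmul k Γ(Z, V.1) (curv i V hU hi y) := by
  rw [op_eq i V hU hi y, firstOrder_pow_prime]
  refine LinearMap.ext fun a => ?_
  change powDerivation p (der (restrict hU (field y))) a + (comp y i V hU hi ^ p
      + (der (restrict hU (field y)))^[p - 1] (comp y i V hU hi) + curv i V hU hi y) * a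
    = powDerivation p (der (restrict hU (field y))) a + (comp y i V hU hi ^ p
      + (der (restrict hU (field y)))^[p - 1] (comp y i V hU hi)) * a + curv i V hU hi y * a
  rw [add_mul _ (curv i V hU hi y), add_assoc]

theorem restr_pOperation {U' : Z.Opens} (h : U' ≤ U) (x : modelSections c U) :
    restr h (pOperation x) = pOperation (restr h x) := rfl

theorem bracket_pOperation (x y : modelSections c U) :
    bracket (pOperation x) y = (bracket x)^[p] y := ext_op fun i V hU hi => by
  have h0 : (p : Module.End k Γ(Z, V.1)) = 0 := natCast_eq_zero_of_algebra k p _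
  -- All vector fields kill the function `γ(x) ^ p`.
  have h : comm (Algebra.lmul k Γ(Z, V.1) (curv i V hU hi x)) (op i V hU hi y) = 0 :=
    comm_lmul_firstOrder _ _ (der_curv i V hU hi x _)
  simp only [op_iterate_bracket, op_bracket, op_pOperation, add_comm_left, h, add_zero]
  exact (comm_iterate_prime h0 _ _).symm

theorem pOperation_smul_const (a : k) (x : modelSections c U) :
    pOperation (algebraMap k Γ(Z, U) a • x) = algebraMap k Γ(Z, U) (a ^ p) • pOperation x :=
  ext_op fun i V hU hi => by
    have h := curv_smul i V hU hi (algebraMap k Γ(Z, U) a) x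
    have h' : res k hU (algebraMap k Γ(Z, U) a) ^ p * curv i V hU hi x
        = a ^ p • curv i V hU hi x := by
      rw [AlgHom.commutes, Algebra.smul_def, map_pow]
    simp only [op_pOperation, op_smul_const, h, h', smul_pow, smul_add]
    exact congrArg _ (map_smul (Algebra.lmul k Γ(Z, V.1)) (a ^ p) (curv i V hU hi x))

theorem pOperation_add (x y : modelSections c U) :
    pOperation (x + y) = pOperation x + pOperation y + ∑ i ∈ Finset.Icc 1 (p - 1),
      algebraMap k Γ(Z, U) (i : k)⁻¹ • jacobsonCoeff bracket x y (p - 1) (i - 1) :=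
  ext_op fun i V hU hi => by
    have h2 : ∀ j ∈ Finset.Icc 1 (p - 1), op i V hU hi (algebraMap k Γ(Z, U) (j : k)⁻¹ •
        jacobsonCoeff bracket x y (p - 1) (j - 1))
        = (j : k)⁻¹ • jacobsonCoeff comm (op i V hU hi x) (op i V hU hi y) (p - 1) (j - 1) :=
      fun j _ =>
        (op_smul_const i V hU hi _ _).trans (congrArg _
          (jacobsonCoeff_map (L := modelSections c U) (br := bracket) (op i V hU hi)
            (fun a b => op_bracket i V hU hi a b) x y _ _))
    have h3 := add_pow_prime_jacobson (p := p) (k := k) (op i V hU hi x) (op i V hU hi y)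
    have h4 := map_add (Algebra.lmul k Γ(Z, V.1)) (curv i V hU hi x) (curv i V hU hi y)
    have h5 := (map_sum (op i V hU hi) (fun j : ℕ => algebraMap k Γ(Z, U) (j : k)⁻¹ •
        jacobsonCoeff bracket x y (p - 1) (j - 1)) (Finset.Icc 1 (p - 1))).trans
      (Finset.sum_congr rfl h2)
    simp only [op_add, op_pOperation, curv_add, h3, h4, h5]
    abel

theorem pOperation_smul (f : Γ(Z, U)) (x : modelSections c U) :
    pOperation (f • x) = f ^ p • pOperation x + (der (field (f • x)))^[p - 1] f • x :=
  ext_op fun i V hU hi => by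
    have h2 : res k hU ((der (field (f • x)))^[p - 1] f)
        = (res k hU f • der (restrict hU (field x)))^[p - 1] (res k hU f) := by
      rw [← der_smul, ← restrict_smul, ← field_smul]
      exact (Function.Semiconj.iterate_right (f := res k hU) (fun g => res_der hU _ g) (p - 1)) _
    have h3 : (Algebra.lmul k Γ(Z, V.1) (res k hU f) * op i V hU hi x) ^ p
        = Algebra.lmul k Γ(Z, V.1) (res k hU f ^ p) * op i V hU hi x ^ p
          + Algebra.lmul k Γ(Z, V.1) ((res k hU f • der (restrict hU (field x)))^[p - 1]
            (res k hU f)) * op i V hU hi x := lmul_mul_firstOrder_pow_prime _ _ _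
    have h4 := map_mul (Algebra.lmul k Γ(Z, V.1)) (res k hU f ^ p) (curv i V hU hi x)
    have h5 := map_pow (res k hU) f p
    simp only [op_add, op_pOperation, op_smul, curv_smul, h2, h3, h4, h5, mul_add]
    abel

end modelSections

end ModelIdentities

/-! ### The restricted Atiyah algebra of a cocycle: the sheaf of modules -/

section ModelSheaf

variable {p : ℕ} [hp : Fact p.Prime] {k : Type u} [Field k] [CharP k p]
  {Z : Scheme.{u}} [Z.Over (Spec (.of k))] {c : Cocycle (atiyahComplex p k Z)} {U : Z.Opens}

open VectorFields

namespace modelSections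

/-- Sections can be glued: the vector field and the functions are glued separately. -/
theorem existsUnique_glue {κ : Type*} (W : κ → Z.Opens) (s : ∀ a, modelSections c (W a))
    (hs : ∀ a b, restr (c := c) (inf_le_left : W a ⊓ W b ≤ W a) (s a)
      = restr (c := c) (inf_le_right : W a ⊓ W b ≤ W b) (s b)) :
    ∃! t : modelSections c (iSup W), ∀ a, restr (c := c) (le_iSup W a) t = s a := by
  have hmem : ∀ z ∈ iSup W, ∃ a, z ∈ W a := fun z hz => Opens.mem_iSup.mp hz
  have hcov := affineCover_of_cover (U := iSup W) W hmem
  have hfield : ∀ (a b : κ) (V : Z.affineOpens) (ha : V.1 ≤ W a) (hb : V.1 ≤ W b),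
      restrict ha (field (s a)) = restrict hb (field (s b)) := fun a b V ha hb =>
    congrArg (fun y => restrict (le_inf ha hb) (field y)) (hs a b)
  have hcomp : ∀ (a b : κ) (V : Z.affineOpens) (ha : V.1 ≤ W a) (hb : V.1 ≤ W b) (i : c.ι)
      (hi : V.1 ≤ c.U i), comp (s a) i V ha hi = comp (s b) i V hb hi := fun a b V ha hb i hi =>
    congrArg (fun y => comp y i V (le_inf ha hb) hi) (hs a b)
  obtain ⟨x, hx⟩ := hcov.exists_vectorField
    (fun V => der (restrict V.2.2.choose_spec (field (s V.2.2.choose)))) fun V V' h f => by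
      rw [res_der h, restrict_restrict, hfield _ _ V'.1 _ V'.2.2.choose_spec]
  have hx' : ∀ (a : κ) (V : Z.affineOpens) (hV : V.1 ≤ iSup W) (ha : V.1 ≤ W a),
      restrict hV x = restrict ha (field (s a)) := fun a V hV ha => by
    refine (affineCover_self V.1).ext_vectorFields fun V' hV' => ?_
    refine (hx ⟨V', hV'.trans hV, a, hV'.trans ha⟩).trans ?_
    rw [hfield _ a V' _ (hV'.trans ha)]
    rfl
  have key : ∀ (i : c.ι) (V : Z.affineOpens) (hV : V.1 ≤ iSup W) (hi : V.1 ≤ c.U i),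
      ∃ f : Γ(Z, V.1), ∀ (a : κ) (V' : Z.affineOpens) (h : V'.1 ≤ V.1) (ha : V'.1 ≤ W a),
        res k h f = comp (s a) i V' ha (h.trans hi) := fun i V hV hi => by
    obtain ⟨f, hf, -⟩ := (affineCover_of_cover (U := V.1) W
        fun z hz => hmem z (hV hz)).existsUnique_res k
      (fun V' => comp (s V'.2.2.choose) i V'.1 V'.2.2.choose_spec (V'.2.1.trans hi))
      fun V' V'' h => by
        rw [res_comp]
        exact hcomp _ _ _ _ _ _ _
    exact ⟨f, fun a V' h ha => (hf ⟨V', h, a, ha⟩).trans (hcomp _ _ _ _ _ _ _)⟩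
  choose f hf using key
  have hcov' : ∀ V : Z.affineOpens, V.1 ≤ iSup W →
      AffineCover V.1 fun V' => V'.1 ≤ V.1 ∧ ∃ a, V'.1 ≤ W a := fun V hV =>
    affineCover_of_cover (U := V.1) W fun z hz => hmem z (hV hz)
  let t : modelSections c (iSup W) :=
    ⟨(x, fun i V => f i V.1 V.2.1 V.2.2),
      fun i V V' hV hi h => (hcov' V' (h.trans hV)).ext_res k fun V'' ⟨h', a, ha⟩ => by
        rw [res_res]
        exact (hf i V hV hi a V'' _ ha).trans (hf i V' _ _ a V'' h' ha).symm,
      fun i j V hV hi hj => (hcov' V hV).ext_res k fun V' ⟨h', a, ha⟩ => by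
        refine Eq.trans ?_ (res_evForm (c.α i j) (V := ⟨V, le_inf hi hj⟩) (restrict hV x)
          ⟨V', h'.trans (le_inf hi hj)⟩ h').symm
        refine (map_sub (res k h') _ _).trans ?_
        refine (congrArg₂ (· - ·) (hf j V hV hj a V' h' ha) (hf i V hV hi a V' h' ha)).trans ?_
        rw [restrict_restrict, hx' a V' _ ha]
        exact comp_sub_comp (s a) i j V' ha _ _⟩
  refine ⟨t, fun a => ext_affineCover (affineCover_self (W a)) (fun V hV => ?_)
    fun V hV i hi => ?_, fun t' ht' => ext_affineCover hcov (fun V hV => ?_) fun V hV i hi => ?_⟩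
  · exact hx' a V (hV.trans (le_iSup W a)) hV
  · exact (res_refl k _).symm.trans (hf i V (hV.trans (le_iSup W a)) hi a V le_rfl hV)
  · obtain ⟨hV, a, ha⟩ := hV
    exact (congrArg (fun y => restrict ha (field y)) (ht' a)).trans (hx' a V hV ha).symm
  · obtain ⟨hV, a, ha⟩ := hV
    refine (congrArg (fun y => comp y i V ha hi) (ht' a)).trans ?_
    exact ((res_refl k _).symm.trans (hf i V hV hi a V le_rfl ha)).symm

end modelSections

variable (c)

/-- The presheaf of sections of the restricted Atiyah algebra with cocycle `c`. -/
def modelPresheaf : TopCat.Presheaf Ab.{u} Z where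
  obj U := AddCommGrpCat.of (modelSections c U.unop)
  map i := AddCommGrpCat.ofHom (modelSections.restr i.unop.le)

theorem modelPresheaf_isSheaf : (modelPresheaf c).IsSheaf := by
  rw [TopCat.Presheaf.isSheaf_iff_isSheafUniqueGluing]
  intro κ W s hs
  exact modelSections.existsUnique_glue W s hs

instance (U : Z.Opensᵒᵖ) : Module (Z.ringCatSheaf.obj.obj U) ((modelPresheaf c).obj U) :=
  inferInstanceAs (Module Γ(Z, U.unop) (modelSections c U.unop))

/-- The sheaf of modules underlying the restricted Atiyah algebra with cocycle `c`. -/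
def modelSheaf : Z.Modules where
  val := PresheafOfModules.ofPresheaf (R := Z.ringCatSheaf.obj) (modelPresheaf c)
    fun _ _ i f y => modelSections.restr_smul i.unop.le f y
  isSheaf := modelPresheaf_isSheaf c

end ModelSheaf

/-! ### The restricted Atiyah algebra of a cocycle: splittings and local bases -/

section Bases

/-- A basis of a split extension of a module with a basis by a free module of rank one. -/
theorem exists_basis_of_extension {R N T : Type*} [CommRing R] [AddCommGroup N] [Module R N]
    [AddCommGroup T] [Module R T] (ι : R →ₗ[R] N) (a : N →ₗ[R] T) (s : T →ₗ[R] N)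
    (hι : Function.Injective ι) (ha : ∀ y, a y = 0 ↔ ∃ f, ι f = y) (hs : ∀ x, a (s x) = x)
    {n : ℕ} (b : Module.Basis (Fin n) R T) :
    ∃ b' : Module.Basis (Fin (n + 1)) R N,
      ∀ j, b' j = (Fin.cons (ι 1) fun j => s (b j) : Fin (n + 1) → N) j := by
  have hι1 : ∀ f, f • ι 1 = ι f := fun f => by rw [← map_smul, smul_eq_mul, mul_one]
  have h0 : ∀ f, a (ι f) = 0 := fun f => (ha _).mpr ⟨f, rfl⟩
  have hli : LinearIndependent R (Fin.cons (ι 1) fun j => s (b j) : Fin (n + 1) → N) := by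
    rw [Fintype.linearIndependent_iff]
    intro g hg
    simp only [Fin.sum_univ_succ, Fin.cons_zero, Fin.cons_succ, hι1] at hg
    have h1 : ∑ j, g (Fin.succ j) • b j = 0 := by
      have := congrArg a hg
      simpa only [map_add, h0, zero_add, map_sum, map_smul, hs, map_zero] using this
    have h2 := Fintype.linearIndependent_iff.mp b.linearIndependent _ h1
    simp only [h2, zero_smul, Finset.sum_const_zero, add_zero] at hg
    refine Fin.cases (hι (by rw [hg, map_zero])) h2
  have hsp : ⊤ ≤ Submodule.span R
      (Set.range (Fin.cons (ι 1) fun j => s (b j) : Fin (n + 1) → N)) := by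
    intro y _
    obtain ⟨f, hf⟩ := (ha (y - s (a y))).mp (by rw [map_sub, hs, sub_self])
    have hy : y = f • ι 1 + ∑ j, b.repr (a y) j • s (b j) := by
      have h1 : s (a y) = ∑ j, b.repr (a y) j • s (b j) := by
        conv_lhs => rw [← b.sum_repr (a y)]
        simp only [map_sum, map_smul]
      rw [hι1, hf, ← h1, sub_add_cancel]
    rw [hy]
    refine add_mem (Submodule.smul_mem _ _ (Submodule.subset_span ⟨0, rfl⟩))
      (sum_mem fun j _ => Submodule.smul_mem _ _ (Submodule.subset_span ⟨j.succ, rfl⟩))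
  exact ⟨Module.Basis.mk hli hsp, fun j => Module.Basis.mk_apply _ _ _⟩

variable {k : Type u} [Field k] {Z : Scheme.{u}} [Z.Over (Spec (.of k))]

/-- The coordinate vector fields of a chart are a basis of the vector fields over each open
subset. -/
theorem Chart.exists_basis {U V : Z.Opens} {n : ℕ} (X : Chart k U n) (h : V ≤ U) :
    ∃ b : Module.Basis (Fin n) Γ(Z, V) (VectorFields k V),
      ∀ j, b j = VectorFields.restrict h (X.del j) := by
  have hli : LinearIndependent Γ(Z, V) fun j => VectorFields.restrict h (X.del j) := by
    rw [Fintype.linearIndependent_iff]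
    intro g hg j
    have h1 := congrArg (fun x => VectorFields.der x (res k h (X.X.x j))) hg
    rw [VectorFields.der_sum, derivation_sum_apply] at h1
    simp only [VectorFields.der_smul, Derivation.smul_apply, der_del_x, smul_eq_mul, mul_ite,
      mul_one, mul_zero, Finset.sum_ite_eq', Finset.mem_univ, if_true] at h1
    exact h1
  have hsp : ⊤ ≤ Submodule.span Γ(Z, V)
      (Set.range fun j => VectorFields.restrict h (X.del j)) := by
    intro y _
    rw [X.vectorField_eq h y]
    exact sum_mem fun j _ => Submodule.smul_mem _ _ (Submodule.subset_span ⟨j, rfl⟩)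
  exact ⟨Module.Basis.mk hli hsp, fun j => Module.Basis.mk_apply _ _ _⟩

end Bases

section ModelSplitting

variable {p : ℕ} [hp : Fact p.Prime] {k : Type u} [Field k] [CharP k p]
  {Z : Scheme.{u}} [Z.Over (Spec (.of k))] {c : Cocycle (atiyahComplex p k Z)} {U U' : Z.Opens}

open VectorFields

namespace modelSections

variable (c U) in
/-- The anchor map `(x, f) ↦ x`. -/
def anchor : modelSections c U →ₗ[Γ(Z, U)] VectorFields k U where
  toFun := field
  map_add' _ _ := rfl
  map_smul' _ _ := rfl

variable (c U) in
/-- The inclusion of the functions. -/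
def inclusion : Γ(Z, U) →ₗ[Γ(Z, U)] modelSections c U where
  toFun f := ⟨(0, fun _ V => res k V.2.1 f), fun _ _ _ _ _ _ => res_res k _ _ f,
    fun i j V hU hi hj => by
      have h := evForm_smul_right (c.α i j) ⟨V, le_inf hi hj⟩ 0 0
      rw [zero_smul, zero_mul] at h
      exact (sub_self (res k hU f)).trans h.symm⟩
  map_add' f g := ext (zero_add _).symm fun _ _ hU _ => map_add (res k hU) f g
  map_smul' f g := ext (smul_zero f).symm fun _ _ hU _ => map_mul (res k hU) f g

theorem restr_inclusion (h : U' ≤ U) (f : Γ(Z, U)) :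
    restr h (inclusion c U f) = inclusion c U' (res k h f) :=
  ext rfl fun _ _ hU _ => (res_res k h hU f).symm

theorem inclusion_injective : Function.Injective (inclusion c U) := fun _ _ h =>
  (affineCover_of_cover (U := U) c.U fun z _ => c.cover z).ext_res k fun V ⟨hU, i, hi⟩ =>
    congrArg (fun y => comp y i V hU hi) h

theorem op_inclusion (f : Γ(Z, U)) (i : c.ι) (V : Z.affineOpens) (hU : V.1 ≤ U)
    (hi : V.1 ≤ c.U i) :
    op i V hU hi (inclusion c U f) = Algebra.lmul k Γ(Z, V.1) (res k hU f) :=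
  LinearMap.ext fun a => zero_add (res k hU f * a)

theorem bracket_inclusion (x : modelSections c U) (f : Γ(Z, U)) :
    bracket x (inclusion c U f) = inclusion c U (der (field x) f) :=
  ext (ext_der fun _ hV => lie_zero (der (restrict hV (field x)))) fun _ _ hU _ =>
    (sub_zero (der (restrict hU (field x)) (res k hU f))).trans (res_der hU (field x) f).symm

theorem pOperation_inclusion [Smooth (Z ↘ Spec (.of k))] (f : Γ(Z, U)) :
    pOperation (inclusion c U f) = inclusion c U (f ^ p) := ext_op fun i V hU hi => by
  have h1 : curv i V hU hi (inclusion c U f) = 0 := by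
    have h := evTwist_smul_right (c.γ i) ⟨V, hi⟩ 0 0
    rw [zero_smul, zero_pow hp.out.ne_zero, zero_mul] at h
    exact h
  have h2 := map_pow (Algebra.lmul k Γ(Z, V.1)) (res k hU f) p
  have h3 := map_zero (Algebra.lmul k Γ(Z, V.1))
  have h4 := map_pow (res k hU) f p
  simp only [op_pOperation, h1, op_inclusion, h2, h3, h4, add_zero]

/-- A section `(0, f)` consists of functions which agree on overlaps, hence of one function. -/
theorem field_eq_zero_iff (y : modelSections c U) :
    field y = 0 ↔ ∃ f, inclusion c U f = y := by
  refine ⟨fun h => ?_, fun ⟨f, hf⟩ => hf ▸ rfl⟩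
  have hc : ∀ (i j : c.ι) (V : Z.affineOpens) (hU : V.1 ≤ U) (hi : V.1 ≤ c.U i)
      (hj : V.1 ≤ c.U j), comp y j V hU hj = comp y i V hU hi := fun i j V hU hi hj => by
    have h1 := comp_sub_comp y i j V hU hi hj
    have h2 := evForm_smul_right (c.α i j) ⟨V, le_inf hi hj⟩ 0 0
    rw [zero_smul, zero_mul] at h2
    rw [h] at h1
    exact sub_eq_zero.mp (h1.trans h2)
  have hcov := affineCover_of_cover (U := U) c.U fun z _ => c.cover z
  obtain ⟨f, hf, -⟩ := hcov.existsUnique_res k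
    (fun V => comp y V.2.2.choose V.1 V.2.1 V.2.2.choose_spec) fun V W h => by
      rw [res_comp]
      exact hc _ _ _ _ _ _
  refine ⟨f, ext h.symm fun i V hU hi => ?_⟩
  exact (hf ⟨V, hU, i, hi⟩).trans (hc _ _ _ _ _ _)

theorem evForm_add_evForm (i j l : c.ι) (V : Z.affineOpens) (hi : V.1 ≤ c.U i) (hj : V.1 ≤ c.U j)
    (hl : V.1 ≤ c.U l) (x : VectorFields k V.1) :
    evForm (c.α i j) ⟨V, le_inf hi hj⟩ x + evForm (c.α j l) ⟨V, le_inf hj hl⟩ x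
      = evForm (c.α i l) ⟨V, le_inf hi hl⟩ x := by
  have h := congrArg (fun a => evForm a ⟨V, le_rfl⟩ x) (c.add_eq i j l V.1 hi hj hl)
  exact (evForm_add _ _ _ _).symm.trans h

variable (c) in
/-- The splitting `x ↦ (x, (c.α i j (x)) j)` of the anchor map over `c.U i`. -/
def splitting (i : c.ι) (h : U ≤ c.U i) : VectorFields k U →ₗ[Γ(Z, U)] modelSections c U where
  toFun x := ⟨(x, fun j V => evForm (c.α i j) ⟨V.1, le_inf (V.2.1.trans h) V.2.2⟩
      (restrict V.2.1 x)),
    fun j V W hU hj hW =>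
      res_evForm (c.α i j) (V := ⟨V, le_inf (hU.trans h) hj⟩) (restrict hU x)
        ⟨W, hW.trans (le_inf (hU.trans h) hj)⟩ hW,
    fun j l V hU hj hl =>
      sub_eq_of_eq_add' (evForm_add_evForm i j l V (hU.trans h) hj hl (restrict hU x)).symm⟩
  map_add' x y := ext rfl fun j V hU hj =>
    evForm_add_right (c.α i j) ⟨V, le_inf (hU.trans h) hj⟩ (restrict hU x) (restrict hU y)
  map_smul' f x := ext rfl fun j V hU hj =>
    (congrArg _ (restrict_smul hU f x)).trans
      (evForm_smul_right (c.α i j) ⟨V, le_inf (hU.trans h) hj⟩ (restrict hU x) (res k hU f))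

theorem splitting_lie (i : c.ι) (h : U ≤ c.U i) (x y : VectorFields k U) :
    splitting c i h ⁅x, y⁆ = bracket (splitting c i h x) (splitting c i h y) :=
  ext rfl fun j V hU hj =>
    evForm_lie (c.α i j) ⟨V, le_inf (hU.trans h) hj⟩ (restrict hU x) (restrict hU y)

theorem splitting_sub_splitting (i j : c.ι) (V : Z.affineOpens) (hi : V.1 ≤ c.U i)
    (hj : V.1 ≤ c.U j) (x : VectorFields k V.1) :
    splitting c i hi x - splitting c j hj x
      = inclusion c V.1 (evForm (c.α i j) ⟨V, le_inf hi hj⟩ x) :=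
  ext (sub_self x) fun l W hW hl => by
    refine Eq.trans ?_ (res_evForm (c.α i j) (V := ⟨V, le_inf hi hj⟩) x
      ⟨W, hW.trans (le_inf hi hj)⟩ hW).symm
    exact sub_eq_of_eq_add
      (evForm_add_evForm i j l W (hW.trans hi) (hW.trans hj) hl (restrict hW x)).symm

/-- The `p`-curvature of the tautological splitting over `c.U i` is `c.γ i`. -/
theorem pOperation_splitting_sub [Smooth (Z ↘ Spec (.of k))] (i : c.ι) (V : Z.affineOpens)
    (hi : V.1 ≤ c.U i) (x : VectorFields k V.1) :
    pOperation (splitting c i hi x) - splitting c i hi (pPow p x)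
      = inclusion c V.1 (evTwist (c.γ i) ⟨V, hi⟩ x) :=
  ext (sub_self _) fun j W hW hj => by
    refine Eq.trans ?_ (res_evTwist (c.γ i) (V := ⟨V, hi⟩) x ⟨W, hW.trans hi⟩ hW).symm
    have h1 := congrArg (fun γ => evTwist γ ⟨W, le_inf (hW.trans hi) hj⟩ (restrict hW x))
      (c.sub_eq i j)
    rw [evTwist_sub, evTwist_rst, evTwist_rst, evTwist_atiyahComplex] at h1
    change (evForm (c.α i j) ⟨W, le_inf (hW.trans hi) hj⟩ (restrict hW x) ^ p
      + (der (restrict hW x))^[p - 1]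
        (evForm (c.α i j) ⟨W, le_inf (hW.trans hi) hj⟩ (restrict hW x))
      + evTwist (c.γ j) ⟨W, hj⟩ (restrict hW x))
      - evForm (c.α i j) ⟨W, le_inf (hW.trans hi) hj⟩ (pPow p (restrict hW x))
      = evTwist (c.γ i) ⟨W, hW.trans hi⟩ (restrict hW x)
    linear_combination -h1

variable (c) in
/-- The sections `1` and the lifts of the coordinate vector fields of a chart. -/
def frame {n : ℕ} (X : Chart k U n) (i : c.ι) (h : U ≤ c.U i) (j : Fin (n + 1)) :
    modelSections c U :=
  Fin.cases (motive := fun _ => modelSections c U) (inclusion c U 1)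
    (fun j => splitting c i h (X.del j)) j

theorem exists_basis_frame {n : ℕ} (X : Chart k U n) (i : c.ι) (h : U ≤ c.U i) (h' : U' ≤ U) :
    ∃ b : Module.Basis (Fin (n + 1)) Γ(Z, U') (modelSections c U'),
      ∀ j, b j = restr h' (frame c X i h j) := by
  obtain ⟨b, hb⟩ := X.exists_basis h'
  obtain ⟨b', hb'⟩ := exists_basis_of_extension (inclusion c U') (anchor c U')
    (splitting c i (h'.trans h)) inclusion_injective field_eq_zero_iff (fun _ => rfl) b
  refine ⟨b', fun j => (hb' j).trans ?_⟩
  induction j using Fin.cases with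
  | zero =>
    exact ((restr_inclusion (c := c) h' 1).trans
      (congrArg (inclusion c U') (map_one (res k h')))).symm
  | succ j => exact congrArg (splitting c i (h'.trans h)) (hb j)

theorem exists_frame_of_chart {n : ℕ} {z : Z} (hz : z ∈ U) (X : Chart k U n) (i : c.ι)
    (h : U ≤ c.U i) : ∃ (U : Z.Opens) (_ : z ∈ U) (n : ℕ)
    (e : Fin n → modelSections c U), ∀ (V : Z.Opens) (h : V ≤ U),
      ∃ b : Module.Basis (Fin n) Γ(Z, V) (modelSections c V), ∀ j, b j = restr h (e j) :=
  ⟨U, hz, n + 1, frame c X i h, fun _ h' => exists_basis_frame X i h h'⟩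

theorem exists_frame [Smooth (Z ↘ Spec (.of k))] (z : Z) : ∃ (U : Z.Opens) (_ : z ∈ U) (n : ℕ)
    (e : Fin n → modelSections c U), ∀ (V : Z.Opens) (h : V ≤ U),
      ∃ b : Module.Basis (Fin n) Γ(Z, V) (modelSections c V), ∀ j, b j = restr h (e j) := by
  have hi := (c.cover z).choose_spec
  have h := exists_chart (k := k) hi
  exact exists_frame_of_chart h.choose_spec.1 h.choose_spec.2.2.choose_spec.some _
    h.choose_spec.2.1

end modelSections

end ModelSplitting

/-! ### The restricted Atiyah algebra of a cocycle and the classification -/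

section ModelAlgebra

variable {p : ℕ} [hp : Fact p.Prime] {k : Type u} [Field k] [CharP k p]
  {Z : Scheme.{u}} [Z.Over (Spec (.of k))] [Smooth (Z ↘ Spec (.of k))]

open VectorFields modelSections

/-- The restricted Lie algebroid with cocycle `c`. -/
def modelAlgebroid (c : Cocycle (atiyahComplex p k Z)) : RestrictedLieAlgebroid p k Z where
  M := modelSheaf c
  locally_free z := exists_frame z
  br U x y := bracket (c := c) (U := U) x y
  br_res h x y := bracket_restr (c := c) h x y
  add_br U x y z := add_bracket (c := c) (U := U) x y z
  br_add U x y z := bracket_add (c := c) (U := U) x y z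
  br_self U x := bracket_self (c := c) (U := U) x
  jacobi U x y z := bracket_jacobi (c := c) (U := U) x y z
  anchor U := anchor c U
  anchor_res _ _ := rfl
  anchor_br _ _ _ := rfl
  br_smul U x y f := bracket_smul (c := c) (U := U) x y f
  pOp U x := pOperation (c := c) (U := U) x
  pOp_res h x := restr_pOperation (c := c) h x
  pOp_br U x y := bracket_pOperation (c := c) (U := U) x y
  pOp_smul_const U a x := pOperation_smul_const (c := c) (U := U) a x
  pOp_add U x y := pOperation_add (c := c) (U := U) x y
  anchor_pOp _ _ := rfl
  pOp_smul U f x := pOperation_smul (c := c) (U := U) f x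

/-- The restricted Atiyah algebra with cocycle `c`. -/
def modelAlgebra (c : Cocycle (atiyahComplex p k Z)) : RestrictedAtiyahAlgebra p k Z where
  toRestrictedLieAlgebroid := modelAlgebroid c
  incl U := inclusion c U
  incl_res h f := restr_inclusion (c := c) h f
  incl_injective _ := inclusion_injective
  exact U x := field_eq_zero_iff (c := c) (U := U) x
  anchor_surjective U x z hz := by
    obtain ⟨i, hi⟩ := c.cover z
    exact ⟨U ⊓ c.U i, inf_le_left, ⟨hz, hi⟩, splitting c i inf_le_right (restrict inf_le_left x),
      rfl⟩
  br_incl U x f := bracket_inclusion (c := c) (U := U) x f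
  pOp_incl U f := pOperation_inclusion (c := c) (U := U) f

/-- The tautological splittings of the restricted Atiyah algebra with cocycle `c`. -/
def modelSplitting (c : Cocycle (atiyahComplex p k Z)) (i : c.ι) :
    (modelAlgebra c).LieSplitting (c.U i) where
  σ _ h := splitting c i h
  σ_res _ _ _ _ _ := rfl
  anchor_σ _ _ _ := rfl
  σ_lie _ h x y := splitting_lie i h x y

theorem isCocycleOf_modelAlgebra (c : Cocycle (atiyahComplex p k Z)) :
    (modelAlgebra c).IsCocycleOf c :=
  ⟨modelSplitting c,
    fun i j V x => splitting_sub_splitting i j V.1 (V.2.trans inf_le_left)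
      (V.2.trans inf_le_right) x,
    fun i V x => pOperation_splitting_sub i V.1 V.2 x⟩

variable (p k Z)

/-- The class in `H¹` of the cocycles of a restricted Atiyah algebra. -/
def atiyahClass : Quotient (RestrictedAtiyahAlgebra.isoSetoid (p := p) (k := k) (Z := Z)) →
    H1 (atiyahComplex p k Z) :=
  Quotient.lift (fun A => Quotient.mk _ A.exists_isCocycleOf.choose) fun A B h =>
    Quotient.sound (RestrictedAtiyahAlgebra.cohomologous_of_isCocycleOf
      (A.exists_isCocycleOf.choose_spec.of_isomorphic h) B.exists_isCocycleOf.choose_spec)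

variable {p k Z} in
theorem atiyahClass_mk {A : RestrictedAtiyahAlgebra p k Z} {c : Cocycle (atiyahComplex p k Z)}
    (h : A.IsCocycleOf c) : atiyahClass p k Z (Quotient.mk _ A) = Quotient.mk _ c :=
  Quotient.sound (RestrictedAtiyahAlgebra.cohomologous_of_isCocycleOf
    A.exists_isCocycleOf.choose_spec h)

/-- The class is injective by `isomorphic_of_cohomologous` and surjective because every cocycle has
its restricted Atiyah algebra. -/
theorem atiyahClass_bijective : Function.Bijective (atiyahClass p k Z) := by
  constructor
  · intro a b h
    induction a using Quotient.inductionOn with | _ A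
    induction b using Quotient.inductionOn with | _ B
    obtain ⟨c, hA⟩ := A.exists_isCocycleOf
    obtain ⟨c', hB⟩ := B.exists_isCocycleOf
    rw [atiyahClass_mk hA, atiyahClass_mk hB] at h
    exact Quotient.sound
      (RestrictedAtiyahAlgebra.isomorphic_of_cohomologous hA hB (Quotient.exact h))
  · intro c
    induction c using Quotient.inductionOn with | _ c
    exact ⟨Quotient.mk _ (modelAlgebra c), atiyahClass_mk (isCocycleOf_modelAlgebra c)⟩

end ModelAlgebra

end RAtiyah

end

theorem mainTheorem5 (p : ℕ) [Fact p.Prime] (k : Type u) [Field k] [CharP k p]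
    (Z : Scheme.{u}) [Z.Over (Spec (.of k))] [Smooth (Z ↘ Spec (.of k))] :
    ∃ Φ : Quotient (RAtiyah.RestrictedAtiyahAlgebra.isoSetoid (p := p) (k := k) (Z := Z)) ≃
        RAtiyah.H1 (RAtiyah.atiyahComplex p k Z),
      ∀ A : RAtiyah.RestrictedAtiyahAlgebra p k Z,
        (∃ c : RAtiyah.Cocycle (RAtiyah.atiyahComplex p k Z), A.IsCocycleOf c) ∧
        ∀ c : RAtiyah.Cocycle (RAtiyah.atiyahComplex p k Z), A.IsCocycleOf c →
          Φ (Quotient.mk _ A) = Quotient.mk _ c :=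
  ⟨Equiv.ofBijective _ (RAtiyah.atiyahClass_bijective p k Z), fun A =>
    ⟨A.exists_isCocycleOf, fun _ hc => RAtiyah.atiyahClass_mk hc⟩⟩
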